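/- Let $\mathsf k$ be an ordered field (totally ordered, with the order compatible with addition and multiplication). **Circuits.** A *prop* is a symmetric strict monoidal category whose objects are the natural numbers, with monoidal product $\oplus$ given on objects by addition; $;$ is composition in diagrammatic order, $1=\mathrm{id}_1$ is the wire and $\sigma=\sigma_{1,1}$ the symmetry. Consider the *forward* generators $$\mathrm{copy}:1\to2,\quad \mathrm{del}:1\to0,\quad [a]:1\to1\ (a\in\mathsf k),\quad \mathrm{add}:2\to1,\quad \mathrm{zero}:0\to1,$$ the *backward* generators, which are their mirror images, $$\overline{\mathrm{copy}}:2\to1,\quad \overline{\mathrm{del}}:0\to1,\quad \overline{[a]}:1\to1\ (a\in\mathsf k),\quad \overline{\mathrm{add}}:1\to2,\quad \overline{\mathrm{zero}}:1\to0,$$ and one further generator $\geq\,:1\to1$. Let $\overrightarrow{\mathsf{Circ}}$, $\overleftarrow{\mathsf{Circ}}$ and $\mathsf{Circ}^{\geq}$ be the props freely generated by the forward, the backward, and all the generators, respectively; the first two are regarded as sub-props of the third. Write $\mathrm{cup}=\overline{\mathrm{del}};\mathrm{copy}$, $\mathrm{cap}=\overline{\mathrm{copy}};\mathrm{del}$,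 and $\leq\;:=(\mathrm{cup}\oplus1);(1\oplus{\geq}\oplus1);(1\oplus\mathrm{cap})$. **The theory $\mathbb{IHP}$.** It consists of the following axioms (for all $a,b\in\mathsf k$ unless restricted). (A) The axioms below, each together with its left-right mirror image (reverse the order of composition and exchange each forward generator with its backward counterpart): * $(\mathrm{add}\oplus1);\mathrm{add}=(1\oplus\mathrm{add});\mathrm{add}$, $\ \sigma;\mathrm{add}=\mathrm{add}$, $\ (\mathrm{zero}\oplus1);\mathrm{add}=1$; * $\mathrm{copy};(\mathrm{copy}\oplus1)=\mathrm{copy};(1\oplus\mathrm{copy})$, $\ \mathrm{copy};\sigma=\mathrm{copy}$, $\ \mathrm{copy};(\mathrm{del}\oplus1)=1$; * $\mathrm{add};\mathrm{copy}=(\mathrm{copy}\oplus\mathrm{copy});(1\oplus\sigma\oplus1);(\mathrm{add}\oplus\mathrm{add})$, $\ \mathrm{zero};\mathrm{copy}=\mathrm{zero}\oplus\mathrm{zero}$, $\ \mathrm{add};\mathrm{del}=\mathrm{del}\oplus\mathrm{del}$, $\ \mathrm{zero};\mathrm{del}=\mathrm{id}_0$; * $\mathrm{add};[a]=([a]\oplus[a]);\mathrm{add}$,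 $\ \mathrm{zero}=\mathrm{zero};[a]$, $\ [a];\mathrm{copy}=\mathrm{copy};([a]\oplus[a])$, $\ [a];\mathrm{del}=\mathrm{del}$, $\ [a];[b]=[ab]$, $\ \mathrm{copy};([a]\oplus[b]);\mathrm{add}=[a+b]$, $\ [0]=\mathrm{del};\mathrm{zero}$; * $\overline{\mathrm{zero}}\subseteq\mathrm{del}$. (B) $[a];\overline{[a]}=1=\overline{[a]};[a]$ for $a\neq0$; the Frobenius laws $(\mathrm{copy}\oplus1);(1\oplus\overline{\mathrm{copy}})=\overline{\mathrm{copy}};\mathrm{copy}=(1\oplus\mathrm{copy});(\overline{\mathrm{copy}}\oplus1)$ and $(\overline{\mathrm{add}}\oplus1);(1\oplus\mathrm{add})=\mathrm{add};\overline{\mathrm{add}}=(1\oplus\overline{\mathrm{add}});(\mathrm{add}\oplus1)$; $\ \mathrm{copy};\overline{\mathrm{copy}}=1$, $\ \overline{\mathrm{add}};\mathrm{add}=1$, $\ \overline{\mathrm{del}};\mathrm{del}=\mathrm{id}_0$, $\ \mathrm{zero};\overline{\mathrm{zero}}=\mathrm{id}_0$; $\ \mathrm{add};\overline{\mathrm{zero}}=([-1]\oplus1);\mathrm{cap}$,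 $\ \mathrm{zero};\overline{\mathrm{add}}=\mathrm{cup};([-1]\oplus1)$. (C) ${\geq};\mathrm{copy}\subseteq\mathrm{copy};({\geq}\oplus{\geq})$; $\ \mathrm{add};{\geq}=({\geq}\oplus{\geq});\mathrm{add}$; $\ {\geq};\mathrm{del}=\mathrm{del}$; $\ \overline{\mathrm{zero}}\subseteq{\geq};\overline{\mathrm{zero}}$; $\ [a];{\geq}={\geq};[a]$ for $a>0$; $\ [a];{\geq}={\leq};[a]$ for $a<0$; $\ \mathrm{copy};({\geq}\oplus{\leq});\overline{\mathrm{copy}}\subseteq1$; $\ {\leq};{\geq}=\mathrm{del};\overline{\mathrm{del}}$; and $$({\geq}\oplus{\geq});\overline{\mathrm{copy}};\mathrm{copy};({\geq}\oplus{\geq})=(\mathrm{copy}\oplus\mathrm{copy});({\geq}\oplus{\geq}\oplus{\geq}\oplus{\geq});(1\oplus\sigma\oplus1);(\overline{\mathrm{copy}}\oplus\overline{\mathrm{copy}}).$$ Each equation is read as two inclusions. *Derivable inclusion* $\overset{\mathbb{IHP}}{\subseteq}$ is the smallest reflexive and transitive relation on parallel arrows of $\mathsf{Circ}^{\geq}$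 that contains these axioms and is closed under $;$ and $\oplus$; and $c\overset{\mathbb{IHP}}{=}d$ means $c\overset{\mathbb{IHP}}{\subseteq}d$ and $d\overset{\mathbb{IHP}}{\subseteq}c$. **The polar operator.** $(\cdot)^\circ:\mathsf{Circ}^{\geq}\to\mathsf{Circ}^{\geq}$ is the prop morphism (identity on objects, preserving identities, symmetries, $;$ and $\oplus$) given on generators by $$\mathrm{copy}\mapsto\overline{\mathrm{add}},\quad \mathrm{del}\mapsto\overline{\mathrm{zero}},\quad [a]\mapsto\overline{[a]},\quad \mathrm{add}\mapsto\overline{\mathrm{copy}},\quad \mathrm{zero}\mapsto\overline{\mathrm{del}},$$ $$\overline{\mathrm{copy}}\mapsto\mathrm{add},\quad \overline{\mathrm{del}}\mapsto\mathrm{zero},\quad \overline{[a]}\mapsto[a],\quad \overline{\mathrm{add}}\mapsto\mathrm{copy},\quad \overline{\mathrm{zero}}\mapsto\mathrm{del},$$ $$\geq\ \mapsto\ \mathrm{copy};({\geq}\oplus1);(\overline{\mathrm{zero}}\oplus1).$$ **Proposition.** For all $n,m$ and all arrows $c,d:n\to m$ of $\mathsf{Circ}^{\geq}$: 1. if $c\overset{\mathbb{IHP}}{\subseteq}d$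 then $d^\circ\overset{\mathbb{IHP}}{\subseteq}c^\circ$; 2. $(c^\circ)^\circ\overset{\mathbb{IHP}}{=}c$; 3. if $c$ is an arrow of $\overrightarrow{\mathsf{Circ}}$, then $c^\circ$ is an arrow of $\overleftarrow{\mathsf{Circ}}$. -/

import Mathlib

universe u v

/-! ### Terms over a monoidal signature and the free prop -/

/-- A monoidal signature: `S n m` is the type of generators of arity `n` and coarity `m`. -/
abbrev MonSig := ℕ → ℕ → Type u

/-- Terms over a signature: built from generators, identities and symmetries by sequential
composition and by the monoidal product (addition on objects). -/
inductive MonTerm (S : MonSig.{u}) : ℕ → ℕ → Type u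
  | gen {n m : ℕ} (g : S n m) : MonTerm S n m
  | id (n : ℕ) : MonTerm S n n
  | sym (n m : ℕ) : MonTerm S (n + m) (m + n)
  | comp {n m l : ℕ} (c : MonTerm S n m) (d : MonTerm S m l) : MonTerm S n l
  | tensor {n m n' m' : ℕ} (c : MonTerm S n m) (d : MonTerm S n' m') :
      MonTerm S (n + n') (m + m')

namespace MonTerm

variable {S : MonSig.{u}}

/-- Transport along equalities of objects (strictness of the monoidal product on objects). -/
def cast {n m n' m' : ℕ} (hn : n = n') (hm : m = m') (c : MonTerm S n m) : MonTerm S n' m' :=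
  hn ▸ hm ▸ c

/-- The laws of symmetric strict monoidal categories: the smallest congruence on terms making them
the arrows of a prop. -/
inductive Rel : {n m : ℕ} → MonTerm S n m → MonTerm S n m → Prop
  | refl {n m : ℕ} (c : MonTerm S n m) : Rel c c
  | symm {n m : ℕ} {c d : MonTerm S n m} : Rel c d → Rel d c
  | trans {n m : ℕ} {c d e : MonTerm S n m} : Rel c d → Rel d e → Rel c e
  | comp_congr {n m l : ℕ} {c c' : MonTerm S n m} {d d' : MonTerm S m l} :
      Rel c c' → Rel d d' → Rel (comp c d) (comp c' d')
  | tensor_congr {n m n' m' : ℕ} {c c' : MonTerm S n m} {d d' : MonTerm S n' m'} :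
      Rel c c' → Rel d d' → Rel (tensor c d) (tensor c' d')
  | id_comp {n m : ℕ} (c : MonTerm S n m) : Rel (comp (id n) c) c
  | comp_id {n m : ℕ} (c : MonTerm S n m) : Rel (comp c (id m)) c
  | comp_assoc {n m l p : ℕ} (c : MonTerm S n m) (d : MonTerm S m l) (e : MonTerm S l p) :
      Rel (comp (comp c d) e) (comp c (comp d e))
  | tensor_id (n m : ℕ) : Rel (tensor (id n) (id m)) (id (n + m))
  | interchange {n m l n' m' l' : ℕ} (c : MonTerm S n m) (d : MonTerm S m l)
      (c' : MonTerm S n' m') (d' : MonTerm S m' l') :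
      Rel (tensor (comp c d) (comp c' d')) (comp (tensor c c') (tensor d d'))
  | tensor_assoc {n₁ m₁ n₂ m₂ n₃ m₃ : ℕ} (c : MonTerm S n₁ m₁) (d : MonTerm S n₂ m₂)
      (e : MonTerm S n₃ m₃) :
      Rel (cast (Nat.add_assoc n₁ n₂ n₃) (Nat.add_assoc m₁ m₂ m₃) (tensor (tensor c d) e))
        (tensor c (tensor d e))
  | id_zero_tensor {n m : ℕ} (c : MonTerm S n m) :
      Rel (cast (Nat.zero_add n) (Nat.zero_add m) (tensor (id 0) c)) c
  | tensor_id_zero {n m : ℕ} (c : MonTerm S n m) : Rel (tensor c (id 0)) c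
  | sym_sym (n m : ℕ) : Rel (comp (sym n m) (sym m n)) (id (n + m))
  | sym_natural {n m n' m' : ℕ} (c : MonTerm S n m) (d : MonTerm S n' m') :
      Rel (comp (tensor c d) (sym m m')) (comp (sym n n') (tensor d c))
  | hexagon (n m l : ℕ) :
      Rel (sym n (m + l))
        (comp
          (cast (Nat.add_assoc n m l) (Nat.add_assoc m n l) (tensor (sym n m) (id l)))
          (cast rfl (Nat.add_assoc m l n).symm (tensor (id m) (sym n l))))

/-- Terms up to the laws of symmetric strict monoidal categories. -/
def setoid (S : MonSig.{u}) (n m : ℕ) : Setoid (MonTerm S n m) where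
  r := Rel
  iseqv := ⟨Rel.refl, Rel.symm, Rel.trans⟩

end MonTerm

/-- The arrows `n → m` of the prop freely generated by the signature `S`. -/
def FreeProp (S : MonSig.{u}) (n m : ℕ) : Type u :=
  Quotient (MonTerm.setoid S n m)

namespace FreeProp

variable {S : MonSig.{u}} {T : MonSig.{v}}

/-- The arrow denoted by a term. -/
def mk {n m : ℕ} (c : MonTerm S n m) : FreeProp S n m :=
  Quotient.mk (MonTerm.setoid S n m) c

/-- A generator as an arrow. -/
def gen {n m : ℕ} (g : S n m) : FreeProp S n m := mk (MonTerm.gen g)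

/-- Identities. -/
def id (n : ℕ) : FreeProp S n n := mk (MonTerm.id n)

/-- Symmetries. -/
def sym (n m : ℕ) : FreeProp S (n + m) (m + n) := mk (MonTerm.sym n m)

/-- Sequential composition, in diagrammatic order. -/
def comp {n m l : ℕ} (c : FreeProp S n m) (d : FreeProp S m l) : FreeProp S n l :=
  Quotient.map₂ MonTerm.comp (fun _ _ h _ _ h' => MonTerm.Rel.comp_congr h h') c d

/-- Monoidal product. -/
def tensor {n m n' m' : ℕ} (c : FreeProp S n m) (d : FreeProp S n' m') :
    FreeProp S (n + n') (m + m') :=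
  Quotient.map₂ MonTerm.tensor (fun _ _ h _ _ h' => MonTerm.Rel.tensor_congr h h') c d

/-- Interpretation of terms over `S` in the free prop over `T`, given by an arrow for each
generator. -/
def interp (f : ∀ {n m : ℕ}, S n m → FreeProp T n m) :
    {n m : ℕ} → MonTerm S n m → FreeProp T n m
  | _, _, .gen g => f g
  | _, _, .id n => id n
  | _, _, .sym n m => sym n m
  | _, _, .comp c d => comp (interp f c) (interp f d)
  | _, _, .tensor c d => tensor (interp f c) (interp f d)

theorem exists_mk {n m : ℕ} (c : FreeProp S n m) : ∃ t : MonTerm S n m, mk t = c :=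
  Quotient.exists_rep c

theorem sound {n m : ℕ} {c d : MonTerm S n m} (h : MonTerm.Rel c d) : mk c = mk d :=
  Quotient.sound h

theorem interp_cast (f : ∀ {n m : ℕ}, S n m → FreeProp T n m) {n m n' m' : ℕ} (hn : n = n')
    (hm : m = m') (c : MonTerm S n m) (t : MonTerm T n m) (h : interp f c = mk t) :
    interp f (c.cast hn hm) = mk (t.cast hn hm) := by
  subst hn hm
  exact h

theorem interp_rel (f : ∀ {n m : ℕ}, S n m → FreeProp T n m) {n m : ℕ} {c d : MonTerm S n m}
    (h : MonTerm.Rel c d) : interp f c = interp f d := by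
  induction h with
  | refl => rfl
  | symm _ ih => exact ih.symm
  | trans _ _ ih₁ ih₂ => exact ih₁.trans ih₂
  | comp_congr _ _ ih₁ ih₂ => simp only [interp, ih₁, ih₂]
  | tensor_congr _ _ ih₁ ih₂ => simp only [interp, ih₁, ih₂]
  | id_comp c =>
    obtain ⟨t, ht⟩ := exists_mk (interp f c)
    simp only [interp, ← ht]
    exact sound (.id_comp t)
  | comp_id c =>
    obtain ⟨t, ht⟩ := exists_mk (interp f c)
    simp only [interp, ← ht]
    exact sound (.comp_id t)
  | comp_assoc c d e =>
    obtain ⟨t, ht⟩ := exists_mk (interp f c)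
    obtain ⟨s, hs⟩ := exists_mk (interp f d)
    obtain ⟨r, hr⟩ := exists_mk (interp f e)
    simp only [interp, ← ht, ← hs, ← hr]
    exact sound (.comp_assoc t s r)
  | tensor_id n m => exact sound (.tensor_id n m)
  | interchange c d c' d' =>
    obtain ⟨t, ht⟩ := exists_mk (interp f c)
    obtain ⟨s, hs⟩ := exists_mk (interp f d)
    obtain ⟨t', ht'⟩ := exists_mk (interp f c')
    obtain ⟨s', hs'⟩ := exists_mk (interp f d')
    simp only [interp, ← ht, ← hs, ← ht', ← hs']
    exact sound (.interchange t s t' s')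
  | tensor_assoc c d e =>
    obtain ⟨t, ht⟩ := exists_mk (interp f c)
    obtain ⟨s, hs⟩ := exists_mk (interp f d)
    obtain ⟨r, hr⟩ := exists_mk (interp f e)
    rw [interp_cast f _ _ _ ((t.tensor s).tensor r)
      (by simp only [interp, ← ht, ← hs, ← hr]; rfl)]
    simp only [interp, ← ht, ← hs, ← hr]
    exact sound (.tensor_assoc t s r)
  | id_zero_tensor c =>
    obtain ⟨t, ht⟩ := exists_mk (interp f c)
    rw [interp_cast f _ _ _ ((MonTerm.id 0).tensor t) (by simp only [interp, ← ht]; rfl), ← ht]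
    exact sound (.id_zero_tensor t)
  | tensor_id_zero c =>
    obtain ⟨t, ht⟩ := exists_mk (interp f c)
    simp only [interp, ← ht]
    exact sound (.tensor_id_zero t)
  | sym_sym n m => exact sound (.sym_sym n m)
  | sym_natural c d =>
    obtain ⟨t, ht⟩ := exists_mk (interp f c)
    obtain ⟨s, hs⟩ := exists_mk (interp f d)
    simp only [interp, ← ht, ← hs]
    exact sound (.sym_natural t s)
  | hexagon n m l =>
    simp only [interp]
    rw [interp_cast f _ _ _ ((MonTerm.sym n m).tensor (MonTerm.id l)) rfl,
      interp_cast f _ _ _ ((MonTerm.id m).tensor (MonTerm.sym n l)) rfl]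
    exact sound (.hexagon n m l)

/-- The prop morphism (identity on objects, preserving identities, symmetries, composition and
monoidal product) out of a free prop that is determined by its values on the generators. -/
def lift (f : ∀ {n m : ℕ}, S n m → FreeProp T n m) {n m : ℕ} (c : FreeProp S n m) :
    FreeProp T n m :=
  Quotient.lift (interp f) (fun _ _ h => interp_rel f h) c

/-- The homset preorder presented by a set `I` of inequations: the smallest precongruence, for
composition and monoidal product, that contains `I`. -/
inductive Precong (I : ∀ {n m : ℕ}, FreeProp S n m → FreeProp S n m → Prop) :
    {n m : ℕ} → FreeProp S n m → FreeProp S n m → Prop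
  | ax {n m : ℕ} {c d : FreeProp S n m} : I c d → Precong I c d
  | refl {n m : ℕ} (c : FreeProp S n m) : Precong I c c
  | trans {n m : ℕ} {c d e : FreeProp S n m} : Precong I c d → Precong I d e → Precong I c e
  | comp {n m l : ℕ} {c c' : FreeProp S n m} {d d' : FreeProp S m l} :
      Precong I c c' → Precong I d d' → Precong I (FreeProp.comp c d) (FreeProp.comp c' d')
  | tensor {n m n' m' : ℕ} {c c' : FreeProp S n m} {d d' : FreeProp S n' m'} :
      Precong I c c' → Precong I d d' → Precong I (FreeProp.tensor c d) (FreeProp.tensor c' d')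

end FreeProp

infixr:60 " ⨾ " => FreeProp.comp
infixr:70 " ⊕ₚ " => FreeProp.tensor

/-! ### The signatures and the circuits -/

/-- The generators of forward (matrix) circuits over `k`. -/
inductive FwdGen (k : Type u) : ℕ → ℕ → Type u
  | copy : FwdGen k 1 2
  | delete : FwdGen k 1 0
  | scalar (a : k) : FwdGen k 1 1
  | add : FwdGen k 2 1
  | zero : FwdGen k 0 1

/-- The generators of backward circuits: the mirror images of the forward ones. -/
inductive BwdGen (k : Type u) : ℕ → ℕ → Type u
  | coCopy : BwdGen k 2 1
  | coDelete : BwdGen k 0 1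
  | coScalar (a : k) : BwdGen k 1 1
  | coAdd : BwdGen k 1 2
  | coZero : BwdGen k 1 0

/-- All generators: forward, backward, and the order generator `geq`. -/
inductive GeqGen (k : Type u) : ℕ → ℕ → Type u
  | fwd {n m : ℕ} (g : FwdGen k n m) : GeqGen k n m
  | bwd {n m : ℕ} (g : BwdGen k n m) : GeqGen k n m
  | geq : GeqGen k 1 1

/-- The free prop of forward circuits. -/
abbrev FwdCirc (k : Type u) (n m : ℕ) : Type u := FreeProp (FwdGen k) n m

/-- The free prop of backward circuits. -/
abbrev BwdCirc (k : Type u) (n m : ℕ) : Type u := FreeProp (BwdGen k) n m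

/-- The free prop of circuits over all generators, including `geq`. -/
abbrev GeqCirc (k : Type u) (n m : ℕ) : Type u := FreeProp (GeqGen k) n m

/-- The inclusion of forward circuits. -/
def FwdCirc.incl {k : Type u} {n m : ℕ} (c : FwdCirc k n m) : GeqCirc k n m :=
  FreeProp.lift (fun g => FreeProp.gen (GeqGen.fwd g)) c

/-- The inclusion of backward circuits. -/
def BwdCirc.incl {k : Type u} {n m : ℕ} (c : BwdCirc k n m) : GeqCirc k n m :=
  FreeProp.lift (fun g => FreeProp.gen (GeqGen.bwd g)) c

namespace GeqCirc

variable {k : Type u}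

/-- The identity wire on one port. -/
abbrev wire : GeqCirc k 1 1 := FreeProp.id 1

/-- The empty diagram. -/
abbrev empty : GeqCirc k 0 0 := FreeProp.id 0

/-- The symmetry of two wires. -/
abbrev swap : GeqCirc k 2 2 := FreeProp.sym 1 1

def copy : GeqCirc k 1 2 := FreeProp.gen (.fwd .copy)

def delete : GeqCirc k 1 0 := FreeProp.gen (.fwd .delete)

def scalar (a : k) : GeqCirc k 1 1 := FreeProp.gen (.fwd (.scalar a))

def add : GeqCirc k 2 1 := FreeProp.gen (.fwd .add)

def zero : GeqCirc k 0 1 := FreeProp.gen (.fwd .zero)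

def coCopy : GeqCirc k 2 1 := FreeProp.gen (.bwd .coCopy)

def coDelete : GeqCirc k 0 1 := FreeProp.gen (.bwd .coDelete)

def coScalar (a : k) : GeqCirc k 1 1 := FreeProp.gen (.bwd (.coScalar a))

def coAdd : GeqCirc k 1 2 := FreeProp.gen (.bwd .coAdd)

def coZero : GeqCirc k 1 0 := FreeProp.gen (.bwd .coZero)

def geq : GeqCirc k 1 1 := FreeProp.gen .geq

def cup : GeqCirc k 0 2 := coDelete ⨾ copy

def cap : GeqCirc k 2 0 := coCopy ⨾ delete

/-- The opposite of `geq`, obtained by bending its two wires. -/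
def leq : GeqCirc k 1 1 :=
  (cup ⊕ₚ wire : GeqCirc k 1 3) ⨾ ((wire ⊕ₚ geq ⊕ₚ wire : GeqCirc k 3 3) ⨾
    (wire ⊕ₚ cap : GeqCirc k 3 1))

/-! ### The theory of polyhedral cones -/

/-- The equational axioms of interacting Hopf algebras. A name with the prefix `co_` denotes the
left-right mirror image of an axiom (axioms without such a companion are self-mirrored). -/
inductive IHEq [Field k] : {n m : ℕ} → GeqCirc k n m → GeqCirc k n m → Prop
  | add_assoc : IHEq ((add ⊕ₚ wire) ⨾ add : GeqCirc k 3 1) ((wire ⊕ₚ add) ⨾ add)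
  | add_comm : IHEq (swap ⨾ add : GeqCirc k 2 1) add
  | add_unit : IHEq ((zero ⊕ₚ wire) ⨾ add : GeqCirc k 1 1) wire
  | co_add_assoc : IHEq (coAdd ⨾ (coAdd ⊕ₚ wire) : GeqCirc k 1 3) (coAdd ⨾ (wire ⊕ₚ coAdd))
  | co_add_comm : IHEq (coAdd ⨾ swap : GeqCirc k 1 2) coAdd
  | co_add_unit : IHEq (coAdd ⨾ (coZero ⊕ₚ wire) : GeqCirc k 1 1) wire
  | copy_assoc : IHEq (copy ⨾ (copy ⊕ₚ wire) : GeqCirc k 1 3) (copy ⨾ (wire ⊕ₚ copy))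
  | copy_comm : IHEq (copy ⨾ swap : GeqCirc k 1 2) copy
  | copy_unit : IHEq (copy ⨾ (delete ⊕ₚ wire) : GeqCirc k 1 1) wire
  | co_copy_assoc : IHEq ((coCopy ⊕ₚ wire) ⨾ coCopy : GeqCirc k 3 1) ((wire ⊕ₚ coCopy) ⨾ coCopy)
  | co_copy_comm : IHEq (swap ⨾ coCopy : GeqCirc k 2 1) coCopy
  | co_copy_unit : IHEq ((coDelete ⊕ₚ wire) ⨾ coCopy : GeqCirc k 1 1) wire
  | bimonoid : IHEq (add ⨾ copy : GeqCirc k 2 2)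
      ((copy ⊕ₚ copy : GeqCirc k 2 4) ⨾ (wire ⊕ₚ swap ⊕ₚ wire : GeqCirc k 4 4) ⨾ (add ⊕ₚ add))
  | co_bimonoid : IHEq (coCopy ⨾ coAdd : GeqCirc k 2 2)
      ((coAdd ⊕ₚ coAdd : GeqCirc k 2 4) ⨾ (wire ⊕ₚ swap ⊕ₚ wire : GeqCirc k 4 4) ⨾
        (coCopy ⊕ₚ coCopy))
  | bimonoid_unit : IHEq (zero ⨾ copy : GeqCirc k 0 2) (zero ⊕ₚ zero)
  | co_bimonoid_unit : IHEq (coCopy ⨾ coZero : GeqCirc k 2 0) (coZero ⊕ₚ coZero)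
  | bimonoid_counit : IHEq (add ⨾ delete : GeqCirc k 2 0) (delete ⊕ₚ delete)
  | co_bimonoid_counit : IHEq (coDelete ⨾ coAdd : GeqCirc k 0 2) (coDelete ⊕ₚ coDelete)
  | bone : IHEq (zero ⨾ delete : GeqCirc k 0 0) empty
  | co_bone : IHEq (coDelete ⨾ coZero : GeqCirc k 0 0) empty
  | scalar_add (a : k) : IHEq (add ⨾ scalar a : GeqCirc k 2 1) ((scalar a ⊕ₚ scalar a) ⨾ add)
  | co_scalar_add (a : k) :
      IHEq (coScalar a ⨾ coAdd : GeqCirc k 1 2) (coAdd ⨾ (coScalar a ⊕ₚ coScalar a))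
  | scalar_zero (a : k) : IHEq (zero : GeqCirc k 0 1) (zero ⨾ scalar a)
  | co_scalar_zero (a : k) : IHEq (coZero : GeqCirc k 1 0) (coScalar a ⨾ coZero)
  | scalar_copy (a : k) : IHEq (scalar a ⨾ copy : GeqCirc k 1 2) (copy ⨾ (scalar a ⊕ₚ scalar a))
  | co_scalar_copy (a : k) :
      IHEq (coCopy ⨾ coScalar a : GeqCirc k 2 1) ((coScalar a ⊕ₚ coScalar a) ⨾ coCopy)
  | scalar_delete (a : k) : IHEq (scalar a ⨾ delete : GeqCirc k 1 0) delete
  | co_scalar_delete (a : k) : IHEq (coDelete ⨾ coScalar a : GeqCirc k 0 1) coDelete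
  | scalar_mul (a b : k) : IHEq (scalar a ⨾ scalar b : GeqCirc k 1 1) (scalar (a * b))
  | co_scalar_mul (a b : k) : IHEq (coScalar b ⨾ coScalar a : GeqCirc k 1 1) (coScalar (a * b))
  | scalar_sum (a b : k) :
      IHEq (copy ⨾ (scalar a ⊕ₚ scalar b) ⨾ add : GeqCirc k 1 1) (scalar (a + b))
  | co_scalar_sum (a b : k) :
      IHEq (coAdd ⨾ (coScalar a ⊕ₚ coScalar b) ⨾ coCopy : GeqCirc k 1 1) (coScalar (a + b))
  | zero_scalar : IHEq (scalar 0 : GeqCirc k 1 1) (delete ⨾ zero)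
  | co_zero_scalar : IHEq (coScalar 0 : GeqCirc k 1 1) (coZero ⨾ coDelete)
  | scalar_inv (a : k) : a ≠ 0 → IHEq (scalar a ⨾ coScalar a : GeqCirc k 1 1) wire
  | scalar_coinv (a : k) : a ≠ 0 → IHEq (wire : GeqCirc k 1 1) (coScalar a ⨾ scalar a)
  | copy_frobenius_left :
      IHEq ((copy ⊕ₚ wire : GeqCirc k 2 3) ⨾ (wire ⊕ₚ coCopy : GeqCirc k 3 2) : GeqCirc k 2 2)
      (coCopy ⨾ copy : GeqCirc k 2 2)
  | copy_frobenius_right :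
      IHEq (coCopy ⨾ copy : GeqCirc k 2 2)
      ((wire ⊕ₚ copy : GeqCirc k 2 3) ⨾ (coCopy ⊕ₚ wire : GeqCirc k 3 2) : GeqCirc k 2 2)
  | copy_special : IHEq (copy ⨾ coCopy : GeqCirc k 1 1) wire
  | copy_bone : IHEq (coDelete ⨾ delete : GeqCirc k 0 0) empty
  | add_frobenius_left :
      IHEq ((coAdd ⊕ₚ wire : GeqCirc k 2 3) ⨾ (wire ⊕ₚ add : GeqCirc k 3 2) : GeqCirc k 2 2)
      (add ⨾ coAdd : GeqCirc k 2 2)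
  | add_frobenius_right :
      IHEq (add ⨾ coAdd : GeqCirc k 2 2)
      ((wire ⊕ₚ coAdd : GeqCirc k 2 3) ⨾ (add ⊕ₚ wire : GeqCirc k 3 2) : GeqCirc k 2 2)
  | add_special : IHEq (coAdd ⨾ add : GeqCirc k 1 1) wire
  | add_bone : IHEq (zero ⨾ coZero : GeqCirc k 0 0) empty
  | cap_white : IHEq (add ⨾ coZero : GeqCirc k 2 0) ((scalar (-1) ⊕ₚ wire) ⨾ cap)
  | cup_white : IHEq (zero ⨾ coAdd : GeqCirc k 0 2) (cup ⨾ (scalar (-1) ⊕ₚ wire))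

/-- The inequational axiom of interacting Hopf algebras, with its mirror image. -/
inductive IHIneq : {n m : ℕ} → GeqCirc k n m → GeqCirc k n m → Prop
  | coZero_delete : IHIneq (coZero : GeqCirc k 1 0) delete
  | co_coZero_delete : IHIneq (zero : GeqCirc k 0 1) coDelete

/-- The equational axioms on `geq`. -/
inductive OrdEq [Field k] [LinearOrder k] :
    {n m : ℕ} → GeqCirc k n m → GeqCirc k n m → Prop
  | geq_add : OrdEq (add ⨾ geq : GeqCirc k 2 1) ((geq ⊕ₚ geq) ⨾ add)
  | geq_delete : OrdEq (geq ⨾ delete : GeqCirc k 1 0) delete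
  | geq_scalar_pos (a : k) : 0 < a → OrdEq (scalar a ⨾ geq : GeqCirc k 1 1) (geq ⨾ scalar a)
  | geq_scalar_neg (a : k) : a < 0 → OrdEq (scalar a ⨾ geq : GeqCirc k 1 1) (leq ⨾ scalar a)
  | spider :
      OrdEq ((geq ⊕ₚ geq : GeqCirc k 2 2) ⨾ coCopy ⨾ copy ⨾ (geq ⊕ₚ geq : GeqCirc k 2 2))
        ((copy ⊕ₚ copy : GeqCirc k 2 4) ⨾ (geq ⊕ₚ geq ⊕ₚ geq ⊕ₚ geq : GeqCirc k 4 4) ⨾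
          (wire ⊕ₚ swap ⊕ₚ wire : GeqCirc k 4 4) ⨾ (coCopy ⊕ₚ coCopy : GeqCirc k 4 2))
  | direction : OrdEq (leq ⨾ geq : GeqCirc k 1 1) (delete ⨾ coDelete)

/-- The inequational axioms on `geq`. -/
inductive OrdIneq : {n m : ℕ} → GeqCirc k n m → GeqCirc k n m → Prop
  | geq_copy : OrdIneq (geq ⨾ copy : GeqCirc k 1 2) (copy ⨾ (geq ⊕ₚ geq))
  | geq_zero : OrdIneq (coZero : GeqCirc k 1 0) (geq ⨾ coZero)
  | antisymm : OrdIneq (copy ⨾ (geq ⊕ₚ leq) ⨾ coCopy : GeqCirc k 1 1) wire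

/-- All axioms of the theory, as inequations; an equation is read in both directions. -/
inductive IHPAx [Field k] [LinearOrder k] {n m : ℕ} (c d : GeqCirc k n m) : Prop
  | ihEq : IHEq c d → IHPAx c d
  | ihEq_symm : IHEq d c → IHPAx c d
  | ihIneq : IHIneq c d → IHPAx c d
  | ordEq : OrdEq c d → IHPAx c d
  | ordEq_symm : OrdEq d c → IHPAx c d
  | ordIneq : OrdIneq c d → IHPAx c d

/-- Derivable inclusion. -/
def IHPSub [Field k] [LinearOrder k] {n m : ℕ} (c d : GeqCirc k n m) : Prop :=
  FreeProp.Precong (S := GeqGen k) IHPAx c d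

/-- Derivable equality: the equivalence induced by derivable inclusion. -/
def IHPEq [Field k] [LinearOrder k] {n m : ℕ} (c d : GeqCirc k n m) : Prop :=
  IHPSub c d ∧ IHPSub d c

/-! ### The polar operator -/

/-- The polar operator on generators. -/
def polarGen : {n m : ℕ} → GeqGen k n m → GeqCirc k n m
  | _, _, .fwd .copy => coAdd
  | _, _, .fwd .delete => coZero
  | _, _, .fwd (.scalar a) => coScalar a
  | _, _, .fwd .add => coCopy
  | _, _, .fwd .zero => coDelete
  | _, _, .bwd .coCopy => add
  | _, _, .bwd .coDelete => zero
  | _, _, .bwd (.coScalar a) => scalar a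
  | _, _, .bwd .coAdd => copy
  | _, _, .bwd .coZero => delete
  | _, _, .geq => copy ⨾ (geq ⊕ₚ wire : GeqCirc k 2 2) ⨾ (coZero ⊕ₚ wire : GeqCirc k 2 1)

/-- The polar functor. -/
def polar {n m : ℕ} (c : GeqCirc k n m) : GeqCirc k n m :=
  FreeProp.lift polarGen c

end GeqCirc

/-! ### Functoriality of the polar operator -/

namespace FreeProp

variable {S T : MonSig.{u}}

/-! The third claim is an induction on terms, since each forward generator goes to a backward one.
For the first, polarity is functorial, so it suffices that it sends every axiom to a derivable
inclusion in the opposite direction; for the second, only generators matter. The axioms not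
involving ≥ are essentially permuted by polarity (`polar_ihEq`), so the content lies in the axioms
for ≥. All calculations take place in the quotient `IHP`, where derivable equality is equality and
inclusion is a partial order.

The polar of ≥ is the guard ρ, the identity restricted to x ≥ 0 (`cls_polar_geq`), and that of ≤ is
the guard for x ≤ 0 (`cls_polar_leq`). The bridge between order and cone is x ≥ y ⟺ x − y ≥ 0
(`geq_eq`), which also gives involutivity at ≥. It needs translation invariance (`add_geq`),
obtained from reflexivity and transitivity; these in turn come out of the axioms by bending wires
along x + y = 0.

The polars of the order axioms are then facts about nonnegative values: closure under sums,
invariance under positive scalars, and x = 0 when x and −x are both nonnegative. Antisymmetry and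
directedness are exchanged. The spider becomes the Riesz refinement property (`spider_polar`): if x
+ y = u + w with nonnegative terms, both sides split into a 2 × 2 array of nonnegative summands. It
follows from Riesz interpolation (`interpolation`), a specialization of the spider axiom itself.

Diagram chases between forward circuits are avoided by a completeness result: such circuits are
equal as soon as the linear functions they denote agree (`lin_ext`). Circuits with relations are
brought to the form "bound variables, linear map, conditions", and only the linear maps are
compared. -/

theorem lift_comp (f : ∀ {n m : ℕ}, S n m → FreeProp T n m) {n m l : ℕ} (c : FreeProp S n m)
    (d : FreeProp S m l) : lift f (c ⨾ d) = lift f c ⨾ lift f d := by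
  obtain ⟨s, rfl⟩ := exists_mk c
  obtain ⟨t, rfl⟩ := exists_mk d
  rfl

theorem lift_tensor (f : ∀ {n m : ℕ}, S n m → FreeProp T n m) {n m n' m' : ℕ}
    (c : FreeProp S n m) (d : FreeProp S n' m') :
    lift f (c ⊕ₚ d) = lift f c ⊕ₚ lift f d := by
  obtain ⟨s, rfl⟩ := exists_mk c
  obtain ⟨t, rfl⟩ := exists_mk d
  rfl

end FreeProp

namespace GeqCirc

variable {k : Type u}

theorem polar_comp {n m l : ℕ} (c : GeqCirc k n m) (d : GeqCirc k m l) :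
    polar (c ⨾ d) = polar c ⨾ polar d := FreeProp.lift_comp _ c d

theorem polar_tensor {n m n' m' : ℕ} (c : GeqCirc k n m) (d : GeqCirc k n' m') :
    polar (c ⊕ₚ d) = polar c ⊕ₚ polar d := FreeProp.lift_tensor _ c d

theorem exists_incl_eq_polar {n m : ℕ} (a : FwdCirc k n m) :
    ∃ b : BwdCirc k n m, b.incl = polar a.incl := by
  obtain ⟨t, rfl⟩ := FreeProp.exists_mk a
  induction t with
  | gen g =>
    cases g with
    | copy => exact ⟨.gen .coAdd, rfl⟩
    | delete => exact ⟨.gen .coZero, rfl⟩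
    | scalar a => exact ⟨.gen (.coScalar a), rfl⟩
    | add => exact ⟨.gen .coCopy, rfl⟩
    | zero => exact ⟨.gen .coDelete, rfl⟩
  | id n => exact ⟨.id n, rfl⟩
  | sym n m => exact ⟨.sym n m, rfl⟩
  | comp s t ihs iht =>
    obtain ⟨b, hb⟩ := ihs
    obtain ⟨b', hb'⟩ := iht
    refine ⟨b ⨾ b', ?_⟩
    calc _ = b.incl ⨾ b'.incl := FreeProp.lift_comp _ b b'
      _ = _ := by rw [hb, hb', ← polar_comp]; rfl
  | tensor s t ihs iht =>
    obtain ⟨b, hb⟩ := ihs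
    obtain ⟨b', hb'⟩ := iht
    refine ⟨b ⊕ₚ b', ?_⟩
    calc _ = b.incl ⊕ₚ b'.incl := FreeProp.lift_tensor _ b b'
      _ = _ := by rw [hb, hb', ← polar_tensor]; rfl

end GeqCirc

/-! ### Derivable equality classes of circuits -/

namespace GeqCirc

/-- Circuits up to derivable equality, ordered by derivable inclusion. -/
def ihpSetoid (k : Type u) [Field k] [LinearOrder k] (n m : ℕ) : Setoid (GeqCirc k n m) where
  r := IHPEq
  iseqv := ⟨fun c => ⟨.refl c, .refl c⟩, fun h => ⟨h.2, h.1⟩,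
    fun h h' => ⟨.trans h.1 h'.1, .trans h'.2 h.2⟩⟩

end GeqCirc

/-- Arrows of the ordered prop presented by the theory of polyhedral cones. -/
def IHP (k : Type u) [Field k] [LinearOrder k] (n m : ℕ) : Type u :=
  Quotient (GeqCirc.ihpSetoid k n m)

namespace IHP

variable {k : Type u} [Field k] [LinearOrder k]

/-- The class of a circuit. -/
def cls {n m : ℕ} (c : GeqCirc k n m) : IHP k n m := Quotient.mk _ c

def id (n : ℕ) : IHP k n n := cls (FreeProp.id n)

def sym (n m : ℕ) : IHP k (n + m) (m + n) := cls (FreeProp.sym n m)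

def comp {n m l : ℕ} (c : IHP k n m) (d : IHP k m l) : IHP k n l :=
  Quotient.map₂ FreeProp.comp
    (fun _ _ (h : GeqCirc.IHPEq _ _) _ _ (h' : GeqCirc.IHPEq _ _) =>
      ⟨.comp h.1 h'.1, .comp h.2 h'.2⟩) c d

def tensor {n m n' m' : ℕ} (c : IHP k n m) (d : IHP k n' m') : IHP k (n + n') (m + m') :=
  Quotient.map₂ FreeProp.tensor
    (fun _ _ (h : GeqCirc.IHPEq _ _) _ _ (h' : GeqCirc.IHPEq _ _) =>
      ⟨.tensor h.1 h'.1, .tensor h.2 h'.2⟩) c d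

instance {n m : ℕ} : PartialOrder (IHP k n m) where
  le := Quotient.lift₂ GeqCirc.IHPSub (fun _ _ _ _ h h' => propext
    ⟨fun e => .trans h.2 (.trans e h'.1), fun e => .trans h.1 (.trans e h'.2)⟩)
  le_refl := by rintro ⟨c⟩; exact .refl c
  le_trans := by rintro ⟨c⟩ ⟨d⟩ ⟨e⟩ h h'; exact .trans h h'
  le_antisymm := by rintro ⟨c⟩ ⟨d⟩ h h'; exact Quotient.sound ⟨h, h'⟩

end IHP

infixr:60 " ⨾ₕ " => IHP.comp
notation:70 c:71 " ⊕ₕ " d:70 => (IHP.tensor c d :)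

namespace IHP

variable {k : Type u} [Field k] [LinearOrder k]

theorem cls_le {n m : ℕ} {c d : GeqCirc k n m} : cls c ≤ cls d ↔ GeqCirc.IHPSub c d := Iff.rfl

theorem cls_eq {n m : ℕ} {c d : GeqCirc k n m} : cls c = cls d ↔ GeqCirc.IHPEq c d :=
  Quotient.eq (r := GeqCirc.ihpSetoid k n m)

theorem cls_comp {n m l : ℕ} (c : GeqCirc k n m) (d : GeqCirc k m l) :
    cls (c ⨾ d) = cls c ⨾ₕ cls d := rfl

theorem cls_tensor {n m n' m' : ℕ} (c : GeqCirc k n m) (d : GeqCirc k n' m') :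
    cls (c ⊕ₚ d) = cls c ⊕ₕ cls d := rfl

theorem exists_term {n m : ℕ} (c : IHP k n m) :
    ∃ t : MonTerm (GeqGen k) n m, cls (FreeProp.mk t) = c := by
  obtain ⟨c⟩ := c
  obtain ⟨t, rfl⟩ := FreeProp.exists_mk c
  exact ⟨t, rfl⟩

theorem sound {n m : ℕ} {s t : MonTerm (GeqGen k) n m} (h : MonTerm.Rel s t) :
    cls (FreeProp.mk s) = cls (FreeProp.mk t) := by rw [FreeProp.sound h]

/-! ### The ordered symmetric monoidal structure on classes -/

theorem comp_mono {n m l : ℕ} {c c' : IHP k n m} {d d' : IHP k m l} (h : c ≤ c') (h' : d ≤ d') :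
    c ⨾ₕ d ≤ c' ⨾ₕ d' := by
  obtain ⟨c⟩ := c; obtain ⟨c'⟩ := c'; obtain ⟨d⟩ := d; obtain ⟨d'⟩ := d'
  exact FreeProp.Precong.comp h h'

theorem tensor_mono {n m n' m' : ℕ} {c c' : IHP k n m} {d d' : IHP k n' m'} (h : c ≤ c')
    (h' : d ≤ d') : c ⊕ₕ d ≤ c' ⊕ₕ d' := by
  obtain ⟨c⟩ := c; obtain ⟨c'⟩ := c'; obtain ⟨d⟩ := d; obtain ⟨d'⟩ := d'
  exact FreeProp.Precong.tensor h h'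

theorem id_comp {n m : ℕ} (c : IHP k n m) : id n ⨾ₕ c = c := by
  obtain ⟨t, rfl⟩ := exists_term c
  exact sound (.id_comp t)

theorem comp_id {n m : ℕ} (c : IHP k n m) : c ⨾ₕ id m = c := by
  obtain ⟨t, rfl⟩ := exists_term c
  exact sound (.comp_id t)

theorem comp_assoc {n m l p : ℕ} (c : IHP k n m) (d : IHP k m l) (e : IHP k l p) :
    (c ⨾ₕ d) ⨾ₕ e = c ⨾ₕ d ⨾ₕ e := by
  obtain ⟨t, rfl⟩ := exists_term c
  obtain ⟨s, rfl⟩ := exists_term d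
  obtain ⟨r, rfl⟩ := exists_term e
  exact sound (.comp_assoc t s r)

theorem tensor_id (n m : ℕ) :
    (id n : IHP k n n) ⊕ₕ (id m : IHP k m m) = id (n + m) :=
  sound (.tensor_id n m)

theorem interchange {n m l n' m' l' : ℕ} (c : IHP k n m) (d : IHP k m l) (c' : IHP k n' m')
    (d' : IHP k m' l') : (c ⨾ₕ d) ⊕ₕ (c' ⨾ₕ d') = (c ⊕ₕ c') ⨾ₕ (d ⊕ₕ d') := by
  obtain ⟨t, rfl⟩ := exists_term c
  obtain ⟨s, rfl⟩ := exists_term d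
  obtain ⟨t', rfl⟩ := exists_term c'
  obtain ⟨s', rfl⟩ := exists_term d'
  exact sound (.interchange t s t' s')

theorem heq_cast {n m n' m' : ℕ} (hn : n = n') (hm : m = m') (t : MonTerm (GeqGen k) n m) :
    HEq (cls (FreeProp.mk (t.cast hn hm))) (cls (FreeProp.mk t)) := by
  subst hn hm; rfl

theorem tensor_assoc {n₁ m₁ n₂ m₂ n₃ m₃ : ℕ} (c : IHP k n₁ m₁) (d : IHP k n₂ m₂)
    (e : IHP k n₃ m₃) : HEq ((c ⊕ₕ d) ⊕ₕ e) (c ⊕ₕ d ⊕ₕ e) := by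
  obtain ⟨t, rfl⟩ := exists_term c
  obtain ⟨s, rfl⟩ := exists_term d
  obtain ⟨r, rfl⟩ := exists_term e
  exact (heq_cast _ _ ((t.tensor s).tensor r)).symm.trans (heq_of_eq (sound (.tensor_assoc t s r)))

theorem id_zero_tensor {n m : ℕ} (c : IHP k n m) : HEq ((id 0 : IHP k 0 0) ⊕ₕ c) c := by
  obtain ⟨t, rfl⟩ := exists_term c
  exact (heq_cast _ _ ((MonTerm.id 0).tensor t)).symm.trans
    (heq_of_eq (sound (.id_zero_tensor t)))

theorem tensor_id_zero {n m : ℕ} (c : IHP k n m) : c ⊕ₕ id 0 = c := by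
  obtain ⟨t, rfl⟩ := exists_term c
  exact sound (.tensor_id_zero t)

theorem sym_sym (n m : ℕ) : (sym n m ⨾ₕ sym m n : IHP k _ _) = id (n + m) :=
  sound (.sym_sym n m)

theorem sym_natural {n m n' m' : ℕ} (c : IHP k n m) (d : IHP k n' m') :
    (c ⊕ₕ d) ⨾ₕ sym m m' = sym n n' ⨾ₕ (d ⊕ₕ c) := by
  obtain ⟨t, rfl⟩ := exists_term c
  obtain ⟨s, rfl⟩ := exists_term d
  exact sound (.sym_natural t s)

/-- The identity wire. -/
abbrev wire : IHP k 1 1 := id 1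

/-- The crossing of two wires. -/
abbrev swap : IHP k 2 2 := sym 1 1

local notation "𝟙ₕ" => IHP.wire (k := k)
local notation "σₕ" => IHP.swap (k := k)
local notation "Iₕ" => IHP.id (k := k)

theorem sym_one_two : sym 1 2 = (σₕ ⊕ₕ 𝟙ₕ) ⨾ₕ (𝟙ₕ ⊕ₕ σₕ) :=
  sound (.hexagon 1 1 1)

theorem swap_swap : σₕ ⨾ₕ σₕ = Iₕ 2 := sym_sym 1 1

theorem sym_two_one : sym 2 1 = (𝟙ₕ ⊕ₕ σₕ) ⨾ₕ (σₕ ⊕ₕ 𝟙ₕ) := by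
  have h : ((σₕ ⊕ₕ 𝟙ₕ) ⨾ₕ (𝟙ₕ ⊕ₕ σₕ)) ⨾ₕ ((𝟙ₕ ⊕ₕ σₕ) ⨾ₕ (σₕ ⊕ₕ 𝟙ₕ)) = Iₕ 3 := by
    have h₁ : (𝟙ₕ ⊕ₕ σₕ) ⨾ₕ (𝟙ₕ ⊕ₕ σₕ) = Iₕ 3 := by
      rw [← interchange, id_comp, swap_swap, tensor_id]
    have h₂ : (σₕ ⊕ₕ 𝟙ₕ) ⨾ₕ (σₕ ⊕ₕ 𝟙ₕ) = Iₕ 3 := by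
      rw [← interchange, id_comp, swap_swap, tensor_id]
    rw [comp_assoc, ← comp_assoc (𝟙ₕ ⊕ₕ σₕ), h₁, id_comp, h₂]
  rw [← sym_one_two] at h
  calc sym 2 1 = sym 2 1 ⨾ₕ sym 1 2 ⨾ₕ ((𝟙ₕ ⊕ₕ σₕ) ⨾ₕ (σₕ ⊕ₕ 𝟙ₕ)) := by
        rw [h, comp_id]
    _ = _ := by rw [← comp_assoc, sym_sym 2 1, id_comp]

/-- The hexagon with two zero arguments makes this symmetry idempotent, and an invertible idempotent
is the identity. -/
theorem sym_one_zero : (sym 1 0 : IHP k 1 1) = 𝟙ₕ := by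
  have h : (sym 1 0 : IHP k 1 1) = sym 1 0 ⨾ₕ sym 1 0 := by
    have h : (sym 1 0 : IHP k 1 1)
        = ((sym 1 0 : IHP k 1 1) ⊕ₕ Iₕ 0) ⨾ₕ (Iₕ 0 ⊕ₕ (sym 1 0 : IHP k 1 1)) :=
      sound (.hexagon 1 0 0)
    rw [tensor_id_zero] at h
    exact h.trans (congrArg _ (eq_of_heq (id_zero_tensor _)))
  have h' : (sym 1 0 : IHP k 1 1) ⨾ₕ sym 0 1 = 𝟙ₕ := sym_sym 1 0
  calc (sym 1 0 : IHP k 1 1) = sym 1 0 ⨾ₕ (sym 1 0 ⨾ₕ sym 0 1) := by rw [h', comp_id]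
    _ = 𝟙ₕ := by rw [← comp_assoc, ← h, h']

theorem sym_zero_one : (sym 0 1 : IHP k 1 1) = 𝟙ₕ := by
  have h' : (sym 1 0 : IHP k 1 1) ⨾ₕ sym 0 1 = 𝟙ₕ := sym_sym 1 0
  rwa [sym_one_zero, id_comp] at h'

/-! ### The generators as classes -/

def copy : IHP k 1 2 := cls GeqCirc.copy
def delete : IHP k 1 0 := cls GeqCirc.delete
def scalar (a : k) : IHP k 1 1 := cls (GeqCirc.scalar a)
def add : IHP k 2 1 := cls GeqCirc.add
def zero : IHP k 0 1 := cls GeqCirc.zero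
def coCopy : IHP k 2 1 := cls GeqCirc.coCopy
def coDelete : IHP k 0 1 := cls GeqCirc.coDelete
def coScalar (a : k) : IHP k 1 1 := cls (GeqCirc.coScalar a)
def coAdd : IHP k 1 2 := cls GeqCirc.coAdd
def coZero : IHP k 1 0 := cls GeqCirc.coZero
def geq : IHP k 1 1 := cls GeqCirc.geq

theorem of_ihEq {n m : ℕ} {c d : GeqCirc k n m} (h : GeqCirc.IHEq c d) : cls c = cls d :=
  cls_eq.2 ⟨.ax (.ihEq h), .ax (.ihEq_symm h)⟩

theorem of_ordEq {n m : ℕ} {c d : GeqCirc k n m} (h : GeqCirc.OrdEq c d) : cls c = cls d :=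
  cls_eq.2 ⟨.ax (.ordEq h), .ax (.ordEq_symm h)⟩

local notation "Δₕ" => IHP.copy (k := k)
local notation "εₕ" => IHP.delete (k := k)
local notation "∇ₕ" => IHP.add (k := k)
local notation "ηₕ" => IHP.zero (k := k)

/-! ### Reassociation at fixed arities -/

theorem tensor_comp {n m l n' m' l' : ℕ} (c : IHP k n m) (d : IHP k m l) (c' : IHP k n' m')
    (d' : IHP k m' l') : (c ⊕ₕ c') ⨾ₕ (d ⊕ₕ d') = (c ⨾ₕ d) ⊕ₕ (c' ⨾ₕ d') :=
  (interchange c d c' d').symm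

theorem comp_tensor_id {n m l : ℕ} (c : IHP k n m) (d : IHP k m l) (p : ℕ) :
    (c ⨾ₕ d) ⊕ₕ Iₕ p = (c ⊕ₕ Iₕ p) ⨾ₕ (d ⊕ₕ Iₕ p) := by rw [tensor_comp, id_comp]

theorem id_tensor_comp {n m l : ℕ} (c : IHP k n m) (d : IHP k m l) (p : ℕ) :
    Iₕ p ⊕ₕ (c ⨾ₕ d) = (Iₕ p ⊕ₕ c) ⨾ₕ (Iₕ p ⊕ₕ d) := by rw [tensor_comp, id_comp]

theorem tensor_split {n m n' m' : ℕ} (c : IHP k n m) (d : IHP k n' m') :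
    c ⊕ₕ d = (c ⊕ₕ Iₕ n') ⨾ₕ (Iₕ m ⊕ₕ d) := by rw [tensor_comp, id_comp, comp_id]

theorem tensor_split' {n m n' m' : ℕ} (c : IHP k n m) (d : IHP k n' m') :
    c ⊕ₕ d = (Iₕ n ⊕ₕ d) ⨾ₕ (c ⊕ₕ Iₕ m') := by rw [tensor_comp, id_comp, comp_id]

theorem slide {n m n' m' : ℕ} (c : IHP k n m) (d : IHP k n' m') :
    (c ⊕ₕ Iₕ n') ⨾ₕ (Iₕ m ⊕ₕ d) = (Iₕ n ⊕ₕ d) ⨾ₕ (c ⊕ₕ Iₕ m') := by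
  rw [← tensor_split, ← tensor_split']

/-! ### Axioms -/

theorem add_assoc : (∇ₕ ⊕ₕ 𝟙ₕ) ⨾ₕ ∇ₕ = (𝟙ₕ ⊕ₕ ∇ₕ) ⨾ₕ ∇ₕ := of_ihEq .add_assoc
theorem add_comm : σₕ ⨾ₕ ∇ₕ = ∇ₕ := of_ihEq .add_comm
theorem zero_add : (ηₕ ⊕ₕ 𝟙ₕ) ⨾ₕ ∇ₕ = 𝟙ₕ := of_ihEq .add_unit
theorem copy_assoc : Δₕ ⨾ₕ (Δₕ ⊕ₕ 𝟙ₕ) = Δₕ ⨾ₕ (𝟙ₕ ⊕ₕ Δₕ) := of_ihEq .copy_assoc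
theorem copy_comm : Δₕ ⨾ₕ σₕ = Δₕ := of_ihEq .copy_comm
theorem copy_delete_left : Δₕ ⨾ₕ (εₕ ⊕ₕ 𝟙ₕ) = 𝟙ₕ := of_ihEq .copy_unit
theorem add_copy : ∇ₕ ⨾ₕ Δₕ = (Δₕ ⊕ₕ Δₕ) ⨾ₕ (𝟙ₕ ⊕ₕ σₕ ⊕ₕ 𝟙ₕ) ⨾ₕ (∇ₕ ⊕ₕ ∇ₕ) := of_ihEq .bimonoid
theorem zero_copy : ηₕ ⨾ₕ Δₕ = ηₕ ⊕ₕ ηₕ := of_ihEq .bimonoid_unit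
theorem add_delete : ∇ₕ ⨾ₕ εₕ = εₕ ⊕ₕ εₕ := of_ihEq .bimonoid_counit
theorem zero_delete : ηₕ ⨾ₕ εₕ = Iₕ 0 := of_ihEq .bone
theorem add_scalar (a : k) : ∇ₕ ⨾ₕ scalar a = (scalar a ⊕ₕ scalar a) ⨾ₕ ∇ₕ :=
  of_ihEq (.scalar_add a)
theorem zero_scalar (a : k) : ηₕ ⨾ₕ scalar a = ηₕ := (of_ihEq (.scalar_zero a)).symm
theorem scalar_copy (a : k) : scalar a ⨾ₕ Δₕ = Δₕ ⨾ₕ (scalar a ⊕ₕ scalar a) :=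
  of_ihEq (.scalar_copy a)
theorem scalar_delete (a : k) : scalar a ⨾ₕ εₕ = εₕ := of_ihEq (.scalar_delete a)
theorem scalar_scalar (a b : k) : scalar a ⨾ₕ scalar b = scalar (a * b) :=
  of_ihEq (.scalar_mul a b)
theorem copy_scalar_add (a b : k) : Δₕ ⨾ₕ (scalar a ⊕ₕ scalar b) ⨾ₕ ∇ₕ = scalar (a + b) :=
  of_ihEq (.scalar_sum a b)
theorem scalar_zero : (scalar 0 : IHP k 1 1) = εₕ ⨾ₕ ηₕ := of_ihEq .zero_scalar

/-! ### Adding a multiple of a wire to another one -/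

/-- `(t, y) ↦ a t + y` -/
def axpy (a : k) : IHP k 2 1 := (scalar a ⊕ₕ 𝟙ₕ) ⨾ₕ ∇ₕ

/-- `(t, y, y') ↦ (a t + y, b t + y')` -/
def axpy₂ (a b : k) : IHP k 3 2 :=
  (Δₕ ⊕ₕ Iₕ 2) ⨾ₕ (𝟙ₕ ⊕ₕ (σₕ ⊕ₕ 𝟙ₕ)) ⨾ₕ (axpy a ⊕ₕ axpy b)

/-- `(y, t) ↦ (t, a t + y)` -/
def shear (a : k) : IHP k 2 2 := σₕ ⨾ₕ (Δₕ ⊕ₕ 𝟙ₕ) ⨾ₕ (𝟙ₕ ⊕ₕ axpy a)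

/-- When the last factor has literal arities, both bracketings of the sums of arities agree by
computation, so associativity is an honest equality that can be used for rewriting. The subscripts
record the arities of that factor. -/
theorem tensor_assoc₁₁ {n m n' m' : ℕ} (c : IHP k n m) (d : IHP k n' m') (e : IHP k 1 1) :
    (c ⊕ₕ d) ⊕ₕ e = c ⊕ₕ (d ⊕ₕ e) := eq_of_heq (tensor_assoc c d e)

theorem tensor_assoc₂₂ {n m n' m' : ℕ} (c : IHP k n m) (d : IHP k n' m') (e : IHP k 2 2) :
    (c ⊕ₕ d) ⊕ₕ e = c ⊕ₕ (d ⊕ₕ e) := eq_of_heq (tensor_assoc c d e)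

theorem id_two : Iₕ 2 = 𝟙ₕ ⊕ₕ 𝟙ₕ := (tensor_id 1 1).symm

theorem swap_scalar (a : k) : σₕ ⨾ₕ (𝟙ₕ ⊕ₕ scalar a) = (scalar a ⊕ₕ 𝟙ₕ) ⨾ₕ σₕ :=
  (sym_natural _ _).symm

theorem tensor_assoc₁₂ {n m n' m' : ℕ} (c : IHP k n m) (d : IHP k n' m') (e : IHP k 1 2) :
    (c ⊕ₕ d) ⊕ₕ e = c ⊕ₕ (d ⊕ₕ e) := eq_of_heq (tensor_assoc c d e)

theorem tensor_assoc₂₁ {n m n' m' : ℕ} (c : IHP k n m) (d : IHP k n' m') (e : IHP k 2 1) :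
    (c ⊕ₕ d) ⊕ₕ e = c ⊕ₕ (d ⊕ₕ e) := eq_of_heq (tensor_assoc c d e)

theorem tensor_assoc₁₀ {n m n' m' : ℕ} (c : IHP k n m) (d : IHP k n' m') (e : IHP k 1 0) :
    (c ⊕ₕ d) ⊕ₕ e = c ⊕ₕ (d ⊕ₕ e) := eq_of_heq (tensor_assoc c d e)

theorem tensor_assoc₀₁ {n m n' m' : ℕ} (c : IHP k n m) (d : IHP k n' m') (e : IHP k 0 1) :
    (c ⊕ₕ d) ⊕ₕ e = c ⊕ₕ (d ⊕ₕ e) := eq_of_heq (tensor_assoc c d e)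

theorem copy_delete_right : Δₕ ⨾ₕ (𝟙ₕ ⊕ₕ εₕ) = 𝟙ₕ := by
  have h : σₕ ⨾ₕ (𝟙ₕ ⊕ₕ εₕ) = (εₕ ⊕ₕ 𝟙ₕ) := by
    have := sym_natural εₕ 𝟙ₕ
    rw [sym_zero_one] at this
    exact this.symm.trans (comp_id _)
  rw [← copy_comm, comp_assoc, h, copy_delete_left]

theorem add_zero : (𝟙ₕ ⊕ₕ ηₕ) ⨾ₕ ∇ₕ = 𝟙ₕ := by
  have h : (𝟙ₕ ⊕ₕ ηₕ) ⨾ₕ σₕ = (ηₕ ⊕ₕ 𝟙ₕ) := by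
    have := sym_natural 𝟙ₕ ηₕ
    rw [sym_one_zero] at this
    exact this.trans (id_comp _)
  rw [← add_comm, ← comp_assoc, h, zero_add]

theorem middle_swap_add : (𝟙ₕ ⊕ₕ (σₕ ⊕ₕ 𝟙ₕ)) ⨾ₕ (∇ₕ ⊕ₕ ∇ₕ) ⨾ₕ ∇ₕ = (∇ₕ ⊕ₕ ∇ₕ) ⨾ₕ ∇ₕ := by
  have h₁ : (∇ₕ ⊕ₕ ∇ₕ) ⨾ₕ ∇ₕ = (𝟙ₕ ⊕ₕ ((∇ₕ ⊕ₕ 𝟙ₕ) ⨾ₕ ∇ₕ)) ⨾ₕ ∇ₕ := by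
    rw [tensor_split, comp_assoc, ← add_assoc, id_two, ← tensor_assoc₁₁, ← comp_assoc, tensor_comp,
      id_comp, add_assoc, comp_tensor_id, tensor_assoc₁₁, comp_assoc, add_assoc, ← comp_assoc,
      tensor_comp, id_comp, ← add_assoc]
  rw [h₁, ← comp_assoc, tensor_comp, ← comp_assoc (σₕ ⊕ₕ 𝟙ₕ), tensor_comp, add_comm,
    id_comp]

theorem axpy_tensor_axpy (a b : k) :
    axpy a ⊕ₕ axpy b = (scalar a ⊕ₕ (𝟙ₕ ⊕ₕ (scalar b ⊕ₕ 𝟙ₕ))) ⨾ₕ (∇ₕ ⊕ₕ ∇ₕ) := by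
  rw [axpy, axpy, interchange, tensor_assoc₂₂]

theorem middle_swap_scalar (a b : k) :
    (𝟙ₕ ⊕ₕ (σₕ ⊕ₕ 𝟙ₕ)) ⨾ₕ (scalar a ⊕ₕ (𝟙ₕ ⊕ₕ (scalar b ⊕ₕ 𝟙ₕ)))
      = ((scalar a ⊕ₕ scalar b) ⊕ₕ Iₕ 2) ⨾ₕ (𝟙ₕ ⊕ₕ (σₕ ⊕ₕ 𝟙ₕ)) := by
  rw [tensor_assoc₂₂, id_two, ← tensor_assoc₁₁ 𝟙ₕ (scalar b), ← tensor_assoc₁₁ (scalar b)]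
  simp only [tensor_comp, id_comp, comp_id, swap_scalar]

theorem middle_swap_sym : (𝟙ₕ ⊕ₕ (σₕ ⊕ₕ 𝟙ₕ)) ⨾ₕ sym 2 2 = (σₕ ⊕ₕ σₕ) ⨾ₕ (𝟙ₕ ⊕ₕ (σₕ ⊕ₕ 𝟙ₕ)) := by
  have h : (sym 2 2 : IHP k 4 4) = ((sym 2 1 : IHP k 3 3) ⊕ₕ 𝟙ₕ) ⨾ₕ (𝟙ₕ ⊕ₕ (sym 2 1 : IHP k 3 3)) :=
    sound (.hexagon 2 1 1)
  have h' : (𝟙ₕ ⊕ₕ (σₕ ⊕ₕ 𝟙ₕ)) ⨾ₕ (𝟙ₕ ⊕ₕ (σₕ ⊕ₕ 𝟙ₕ)) = Iₕ 4 := by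
    simp only [tensor_comp, id_comp, swap_swap, tensor_id]
  have h'' : ((σₕ ⊕ₕ 𝟙ₕ) ⊕ₕ 𝟙ₕ) ⨾ₕ (𝟙ₕ ⊕ₕ (𝟙ₕ ⊕ₕ σₕ)) = σₕ ⊕ₕ σₕ := by
    rw [← tensor_assoc₂₂, tensor_assoc₁₁, tensor_comp, tensor_id, comp_id]
    exact congrArg _ (id_comp _)
  rw [h, sym_two_one, comp_tensor_id, id_tensor_comp, comp_assoc,
    ← comp_assoc ((σₕ ⊕ₕ 𝟙ₕ) ⊕ₕ 𝟙ₕ), h'', tensor_assoc₁₁, ← comp_assoc, h', id_comp]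

theorem axpy₂_add (a b : k) : axpy₂ a b ⨾ₕ ∇ₕ = (𝟙ₕ ⊕ₕ ∇ₕ) ⨾ₕ axpy (a + b) := by
  rw [axpy₂, axpy_tensor_axpy, comp_assoc, comp_assoc, comp_assoc,
    ← comp_assoc (𝟙ₕ ⊕ₕ (σₕ ⊕ₕ 𝟙ₕ)), middle_swap_scalar, comp_assoc, middle_swap_add,
    ← comp_assoc, tensor_comp, ← comp_assoc, tensor_comp, comp_assoc, copy_scalar_add, id_comp,
    id_comp, axpy, ← comp_assoc, tensor_comp, comp_id, id_comp]

theorem axpy_copy (a : k) : axpy a ⨾ₕ Δₕ = (𝟙ₕ ⊕ₕ Δₕ) ⨾ₕ axpy₂ a a := by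
  have h : (𝟙ₕ ⊕ₕ Δₕ) ⨾ₕ (Δₕ ⊕ₕ Iₕ 2) ⨾ₕ ((scalar a ⊕ₕ scalar a) ⊕ₕ Iₕ 2)
      = (scalar a ⊕ₕ 𝟙ₕ) ⨾ₕ (Δₕ ⊕ₕ Δₕ) := by
    simp only [tensor_comp, id_comp, comp_id, scalar_copy]
  rw [axpy₂, axpy_tensor_axpy, ← comp_assoc (𝟙ₕ ⊕ₕ (σₕ ⊕ₕ 𝟙ₕ)), middle_swap_scalar, axpy,
    comp_assoc, add_copy]
  simp only [← comp_assoc] at h ⊢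
  rw [h]

theorem axpy₂_swap (a b : k) : axpy₂ a b ⨾ₕ σₕ = (𝟙ₕ ⊕ₕ σₕ) ⨾ₕ axpy₂ b a := by
  rw [axpy₂, axpy₂, comp_assoc, comp_assoc, sym_natural, ← comp_assoc (𝟙ₕ ⊕ₕ (σₕ ⊕ₕ 𝟙ₕ)),
    middle_swap_sym, comp_assoc]
  simp only [← comp_assoc, tensor_comp, copy_comm, id_comp, comp_id]

theorem copy_cross : (𝟙ₕ ⊕ₕ Δₕ) ⨾ₕ (σₕ ⊕ₕ 𝟙ₕ) = σₕ ⨾ₕ (Δₕ ⊕ₕ 𝟙ₕ) ⨾ₕ (𝟙ₕ ⊕ₕ σₕ) := by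
  have h : (𝟙ₕ ⊕ₕ Δₕ) ⨾ₕ (σₕ ⊕ₕ 𝟙ₕ) ⨾ₕ (𝟙ₕ ⊕ₕ σₕ) = σₕ ⨾ₕ (Δₕ ⊕ₕ 𝟙ₕ) := by
    rw [← sym_one_two]; exact sym_natural _ _
  rw [← comp_assoc σₕ, ← h]
  simp only [comp_assoc, tensor_comp, swap_swap, id_comp, tensor_id]
  rw [comp_id]

theorem copy_shear (a : k) : (𝟙ₕ ⊕ₕ Δₕ) ⨾ₕ (shear a ⊕ₕ 𝟙ₕ)
    = σₕ ⨾ₕ (Δₕ ⊕ₕ 𝟙ₕ) ⨾ₕ (𝟙ₕ ⊕ₕ ((Δₕ ⊕ₕ 𝟙ₕ) ⨾ₕ (𝟙ₕ ⊕ₕ σₕ) ⨾ₕ (axpy a ⊕ₕ 𝟙ₕ))) := by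
  have h₁ : (𝟙ₕ ⊕ₕ σₕ) ⨾ₕ (Δₕ ⊕ₕ Iₕ 2) = (Δₕ ⊕ₕ Iₕ 2) ⨾ₕ (𝟙ₕ ⊕ₕ (𝟙ₕ ⊕ₕ σₕ)) := by
    rw [← tensor_assoc₂₂, tensor_comp, tensor_comp, tensor_id, id_comp, id_comp, comp_id, comp_id]
  have h₂ : (Δₕ ⊕ₕ 𝟙ₕ) ⨾ₕ (Δₕ ⊕ₕ Iₕ 2) = (Δₕ ⊕ₕ 𝟙ₕ) ⨾ₕ (𝟙ₕ ⊕ₕ (Δₕ ⊕ₕ 𝟙ₕ)) := by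
    rw [id_two, ← tensor_assoc₁₁, tensor_comp, copy_assoc, ← tensor_assoc₁₁, tensor_comp]
  rw [shear, comp_tensor_id, comp_tensor_id, tensor_assoc₁₁, tensor_assoc₁₁, tensor_id,
    ← comp_assoc, copy_cross, comp_assoc, comp_assoc, ← comp_assoc (𝟙ₕ ⊕ₕ σₕ), h₁, comp_assoc,
    ← comp_assoc (Δₕ ⊕ₕ 𝟙ₕ), h₂, id_tensor_comp, id_tensor_comp, comp_assoc]

/-- Carrying t leftwards past two wires amounts to bringing it to the front, copying it once, and
adding its multiples to both wires in parallel. This reduces the next lemmas to the corresponding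
facts about `axpy₂`. -/
theorem shear_shear (a b : k) : (𝟙ₕ ⊕ₕ shear b) ⨾ₕ (shear a ⊕ₕ 𝟙ₕ)
    = (sym 2 1 : IHP k 3 3) ⨾ₕ (Δₕ ⊕ₕ Iₕ 2) ⨾ₕ (𝟙ₕ ⊕ₕ axpy₂ a b) := by
  have h₁ : (𝟙ₕ ⊕ₕ (𝟙ₕ ⊕ₕ axpy b)) ⨾ₕ (shear a ⊕ₕ 𝟙ₕ)
      = (shear a ⊕ₕ Iₕ 2) ⨾ₕ (𝟙ₕ ⊕ₕ (𝟙ₕ ⊕ₕ axpy b)) := by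
    rw [← tensor_assoc₂₁, tensor_comp, tensor_comp, tensor_id, id_comp, comp_id, id_comp, comp_id]
  have h₂ : (𝟙ₕ ⊕ₕ (Δₕ ⊕ₕ 𝟙ₕ)) ⨾ₕ (shear a ⊕ₕ Iₕ 2) = ((𝟙ₕ ⊕ₕ Δₕ) ⨾ₕ (shear a ⊕ₕ 𝟙ₕ)) ⊕ₕ 𝟙ₕ := by
    rw [comp_tensor_id, tensor_assoc₁₁, id_two, tensor_assoc₁₁]
  rw [shear, id_tensor_comp, id_tensor_comp, comp_assoc, comp_assoc, h₁,
    ← comp_assoc (𝟙ₕ ⊕ₕ (Δₕ ⊕ₕ 𝟙ₕ)), h₂, copy_shear, sym_two_one, axpy₂]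
  simp only [comp_tensor_id, id_tensor_comp, comp_assoc, tensor_assoc₁₁]
  rw [id_two]
  congr 5
  simp only [tensor_comp]
  rw [id_comp, comp_id, tensor_id, id_comp]

theorem shear_copy (a : k) :
    shear a ⨾ₕ (𝟙ₕ ⊕ₕ Δₕ) = (Δₕ ⊕ₕ 𝟙ₕ) ⨾ₕ (𝟙ₕ ⊕ₕ shear a) ⨾ₕ (shear a ⊕ₕ 𝟙ₕ) := by
  have h : (Δₕ ⊕ₕ 𝟙ₕ) ⨾ₕ sym 2 1 = σₕ ⨾ₕ (𝟙ₕ ⊕ₕ Δₕ) := sym_natural _ _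
  have h' : (Δₕ ⊕ₕ 𝟙ₕ) ⨾ₕ (𝟙ₕ ⊕ₕ (𝟙ₕ ⊕ₕ Δₕ)) = (𝟙ₕ ⊕ₕ Δₕ) ⨾ₕ (Δₕ ⊕ₕ Iₕ 2) := by
    rw [← tensor_assoc₁₂, tensor_id, slide]
  rw [shear_shear, ← comp_assoc (Δₕ ⊕ₕ 𝟙ₕ), h, shear, comp_assoc, comp_assoc, comp_assoc,
    tensor_comp, id_comp, axpy_copy, ← comp_assoc (𝟙ₕ ⊕ₕ Δₕ), ← h', id_tensor_comp, comp_assoc]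

theorem shear_add (a b : k) : (𝟙ₕ ⊕ₕ shear b) ⨾ₕ (shear a ⊕ₕ 𝟙ₕ) ⨾ₕ (𝟙ₕ ⊕ₕ ∇ₕ)
    = (∇ₕ ⊕ₕ 𝟙ₕ) ⨾ₕ shear (a + b) := by
  have h : (∇ₕ ⊕ₕ 𝟙ₕ) ⨾ₕ σₕ = sym 2 1 ⨾ₕ (𝟙ₕ ⊕ₕ ∇ₕ) := sym_natural _ _
  have h' : (Δₕ ⊕ₕ Iₕ 2) ⨾ₕ (𝟙ₕ ⊕ₕ (𝟙ₕ ⊕ₕ ∇ₕ)) = (𝟙ₕ ⊕ₕ ∇ₕ) ⨾ₕ (Δₕ ⊕ₕ 𝟙ₕ) := by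
    rw [← tensor_assoc₂₁, tensor_id, slide]
  rw [← comp_assoc, shear_shear, comp_assoc, comp_assoc, tensor_comp, id_comp, axpy₂_add, id_tensor_comp,
    ← comp_assoc (Δₕ ⊕ₕ Iₕ 2), h', shear, ← comp_assoc (∇ₕ ⊕ₕ 𝟙ₕ), h]
  simp only [comp_assoc]

theorem shear_swap (a b : k) : (𝟙ₕ ⊕ₕ shear b) ⨾ₕ (shear a ⊕ₕ 𝟙ₕ) ⨾ₕ (𝟙ₕ ⊕ₕ σₕ)
    = (σₕ ⊕ₕ 𝟙ₕ) ⨾ₕ (𝟙ₕ ⊕ₕ shear a) ⨾ₕ (shear b ⊕ₕ 𝟙ₕ) := by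
  have h : (σₕ ⊕ₕ 𝟙ₕ) ⨾ₕ sym 2 1 = sym 2 1 ⨾ₕ (𝟙ₕ ⊕ₕ σₕ) := sym_natural _ _
  have h' : (Δₕ ⊕ₕ Iₕ 2) ⨾ₕ (𝟙ₕ ⊕ₕ (𝟙ₕ ⊕ₕ σₕ)) = (𝟙ₕ ⊕ₕ σₕ) ⨾ₕ (Δₕ ⊕ₕ Iₕ 2) := by
    rw [← tensor_assoc₂₂, tensor_id, slide]
  rw [← comp_assoc, shear_shear, shear_shear, comp_assoc, comp_assoc, tensor_comp, id_comp, axpy₂_swap,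
    id_tensor_comp, ← comp_assoc (Δₕ ⊕ₕ Iₕ 2), h', ← comp_assoc (σₕ ⊕ₕ 𝟙ₕ), h]
  simp only [comp_assoc]

theorem shear_scalar (a b : k) :
    shear a ⨾ₕ (𝟙ₕ ⊕ₕ scalar b) = (scalar b ⊕ₕ 𝟙ₕ) ⨾ₕ shear (a * b) := by
  have h : axpy a ⨾ₕ scalar b = (𝟙ₕ ⊕ₕ scalar b) ⨾ₕ axpy (a * b) := by
    rw [axpy, axpy, comp_assoc, add_scalar, ← comp_assoc, ← comp_assoc, tensor_comp, tensor_comp,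
      scalar_scalar, id_comp, id_comp, comp_id]
  rw [shear, shear, comp_assoc, comp_assoc, tensor_comp, id_comp, h, ← comp_assoc (scalar b ⊕ₕ 𝟙ₕ),
    ← swap_scalar, id_tensor_comp, ← comp_assoc (Δₕ ⊕ₕ 𝟙ₕ), ← tensor_assoc₁₁, tensor_id, slide]
  simp only [comp_assoc]

theorem zero_shear (a : k) : (ηₕ ⊕ₕ 𝟙ₕ) ⨾ₕ shear a = Δₕ ⨾ₕ (𝟙ₕ ⊕ₕ scalar a) := by
  have h : (ηₕ ⊕ₕ 𝟙ₕ) ⨾ₕ σₕ = (𝟙ₕ ⊕ₕ ηₕ) := by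
    have := sym_natural ηₕ 𝟙ₕ
    rw [sym_zero_one] at this
    exact this.trans (id_comp _)
  have h₁ : (𝟙ₕ ⊕ₕ ηₕ) ⨾ₕ axpy a = scalar a := by
    rw [axpy, ← comp_assoc, ← slide, comp_assoc, add_zero, comp_id]
    exact tensor_id_zero _
  have h₂ : (𝟙ₕ ⊕ₕ ηₕ) ⨾ₕ (Δₕ ⊕ₕ 𝟙ₕ) = Δₕ ⨾ₕ (𝟙ₕ ⊕ₕ (𝟙ₕ ⊕ₕ ηₕ)) := by
    rw [← slide, tensor_id_zero, ← tensor_assoc₀₁, tensor_id]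
  rw [shear, ← comp_assoc, h, ← comp_assoc, h₂, comp_assoc, tensor_comp, h₁, id_comp]

theorem zero_shear_zero : (ηₕ ⊕ₕ 𝟙ₕ) ⨾ₕ shear 0 = 𝟙ₕ ⊕ₕ ηₕ := by
  rw [zero_shear, scalar_zero, id_tensor_comp, ← comp_assoc, copy_delete_right]
  exact id_comp _

/-! ### Completeness for forward circuits -/

theorem scalar_coScalar {a : k} (ha : a ≠ 0) : scalar a ⨾ₕ coScalar a = 𝟙ₕ :=
  of_ihEq (.scalar_inv a ha)

theorem coScalar_scalar {a : k} (ha : a ≠ 0) : coScalar a ⨾ₕ scalar a = 𝟙ₕ :=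
  (of_ihEq (.scalar_coinv a ha)).symm

/-- Multiplicativity makes this scalar idempotent, and a nonzero scalar is invertible. -/
theorem scalar_one : (scalar 1 : IHP k 1 1) = 𝟙ₕ := by
  have h : scalar (1 : k) ⨾ₕ coScalar 1 = 𝟙ₕ := scalar_coScalar one_ne_zero
  calc (scalar 1 : IHP k 1 1) = scalar 1 ⨾ₕ scalar 1 ⨾ₕ coScalar 1 := by rw [h, comp_id]
    _ = 𝟙ₕ := by rw [← comp_assoc, scalar_scalar, mul_one, h]

/-- `(y, t) ↦ y + t v` on `n + 1` wires. -/
def shift : (n : ℕ) → (ℕ → k) → IHP k (n + 1) n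
  | 0, _ => εₕ
  | n + 1, v => (Iₕ n ⊕ₕ shear (v n)) ⨾ₕ (shift n v ⊕ₕ 𝟙ₕ)

/-- The origin of `n` wires. -/
def zeros : (n : ℕ) → IHP k 0 n
  | 0 => Iₕ 0
  | n + 1 => zeros n ⊕ₕ ηₕ

theorem shift_congr {n : ℕ} {v w : ℕ → k} (h : ∀ i < n, v i = w i) : shift n v = shift n w := by
  induction n with
  | zero => rfl
  | succ n ih => rw [shift, shift, h n n.lt_succ_self, ih fun i hi => h i (by omega)]

/-- The arrow `f` commutes with shifts through the function `F`. -/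
def Shifts {n m : ℕ} (f : IHP k n m) (F : (ℕ → k) → ℕ → k) : Prop :=
  ∀ v, shift n v ⨾ₕ f = (f ⊕ₕ 𝟙ₕ) ⨾ₕ shift m (F v)

theorem Shifts.congr {n m : ℕ} {f : IHP k n m} {F G : (ℕ → k) → ℕ → k} (h : Shifts f F)
    (hFG : ∀ v, ∀ i < m, F v i = G v i) : Shifts f G := fun v => by
  rw [h v, shift_congr (hFG v)]

theorem Shifts.of_heq {n m n' m' : ℕ} {f : IHP k n m} {f' : IHP k n' m'}
    {F : (ℕ → k) → ℕ → k} (h : Shifts f F) (hn : n = n') (hm : m = m') (hf : HEq f f') :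
    Shifts f' F := by
  subst hn hm; cases hf; exact h

theorem Shifts.id (n : ℕ) : Shifts (Iₕ n) fun v => v := fun v => by
  rw [comp_id, tensor_id, id_comp]

theorem Shifts.comp {n m l : ℕ} {f : IHP k n m} {g : IHP k m l} {F G : (ℕ → k) → ℕ → k}
    (hf : Shifts f F) (hg : Shifts g G) : Shifts (f ⨾ₕ g) fun v => G (F v) := fun v => by
  rw [← comp_assoc, hf, comp_assoc, hg, comp_tensor_id, comp_assoc]

/-- The parameter enters on the right, so it crosses an extra right-hand wire by a shear before it
reaches `f`, and that shear slides past `f`. There is no such argument for wires on the left; hence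
`IsLin` asks for them outright. -/
theorem Shifts.tensor_wire {n m : ℕ} {f : IHP k n m} {F : (ℕ → k) → ℕ → k} (hf : Shifts f F) :
    Shifts (f ⊕ₕ 𝟙ₕ) fun v i => if i < m then F v i else v (i - m + n) := fun v => by
  have h : (Iₕ n ⊕ₕ shear (v n)) ⨾ₕ ((f ⊕ₕ 𝟙ₕ) ⊕ₕ 𝟙ₕ)
      = ((f ⊕ₕ 𝟙ₕ) ⊕ₕ 𝟙ₕ) ⨾ₕ (Iₕ m ⊕ₕ shear (v n)) := by
    rw [tensor_assoc₁₁, tensor_id, tensor_comp, tensor_comp, id_comp, comp_id, comp_id, id_comp]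
  have h' : (if m < m then F v m else v (m - m + n)) = v n := by simp
  rw [shift, shift]
  beta_reduce
  rw [h', shift_congr (v := fun i => if i < m then F v i else v (i - m + n))
    (w := F v) fun i hi => if_pos hi, comp_assoc, tensor_comp, hf, comp_id, ← comp_assoc, ← h,
    comp_assoc, tensor_comp, id_comp]

theorem Shifts.tensor_id {n m : ℕ} {f : IHP k n m} {F : (ℕ → k) → ℕ → k} (hf : Shifts f F)
    (c : ℕ) : Shifts (f ⊕ₕ Iₕ c) fun v i => if i < m then F v i else v (i - m + n) := by
  induction c with
  | zero =>
    rw [tensor_id_zero]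
    exact hf.congr fun v i hi => (if_pos hi).symm
  | succ c ih =>
    rw [← IHP.tensor_id c 1, ← tensor_assoc₁₁]
    refine ih.tensor_wire.congr fun v i hi => ?_
    by_cases h : i < m + c
    · simp only [h, if_true]
    · obtain rfl : i = m + c := by omega
      simp only [lt_irrefl, if_false, Nat.not_lt.2 (Nat.le_add_right m c)]
      congr 1; omega

/-- The function acting as `F` after the first `b` entries. -/
def liftFun (b : ℕ) (F : (ℕ → k) → ℕ → k) (v : ℕ → k) (i : ℕ) : k :=
  if i < b then v i else F (fun j => v (b + j)) (i - b)

/-- The function acting as `F` on the first entries and as `G` on the other ones. -/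
def tensorFun (n m : ℕ) (F G : (ℕ → k) → ℕ → k) (v : ℕ → k) (i : ℕ) : k :=
  if i < m then F v i else G (fun j => v (n + j)) (i - m)

/-- The arrow `f` acts as the linear function `F`. -/
class IsLin {n m : ℕ} (f : IHP k n m) (F : outParam ((ℕ → k) → ℕ → k)) : Prop where
  shifts : ∀ b, Shifts (Iₕ b ⊕ₕ f) (liftFun b F)
  zeros : zeros n ⨾ₕ f = zeros m

theorem IsLin.shifts_self {n m : ℕ} {f : IHP k n m} {F : (ℕ → k) → ℕ → k} (hf : IsLin f F) :
    Shifts f F :=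
  ((hf.shifts 0).of_heq (Nat.zero_add _) (Nat.zero_add _) (id_zero_tensor f)).congr
    fun v i _ => by simp [liftFun]

theorem zeros_tensor (n m : ℕ) : (zeros n : IHP k 0 n) ⊕ₕ (zeros m : IHP k 0 m) = zeros (n + m) := by
  induction m with
  | zero => exact tensor_id_zero _
  | succ m ih =>
    exact (tensor_assoc₀₁ _ _ _).symm.trans (congrArg (fun c : IHP k 0 (n + m) => c ⊕ₕ ηₕ) ih)

instance (n : ℕ) : IsLin (Iₕ n) fun v => v where
  shifts b := by
    rw [tensor_id]
    refine (Shifts.id _).congr fun v i _ => ?_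
    rw [liftFun]; split_ifs
    · rfl
    · congr 1; omega
  zeros := comp_id _

instance {n m l : ℕ} (f : IHP k n m) (g : IHP k m l) (F G : (ℕ → k) → ℕ → k) [hf : IsLin f F]
    [hg : IsLin g G] : IsLin (f ⨾ₕ g) fun v => G (F v) where
  shifts b := by
    rw [id_tensor_comp]
    refine ((hf.shifts b).comp (hg.shifts b)).congr fun v i _ => ?_
    by_cases h : i < b <;> simp [liftFun, h]
  zeros := by rw [← comp_assoc, hf.zeros, hg.zeros]

/-- Apply `f` first, with wires padded on the right, and then `g` behind `b + m` wires; the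
remaining work is to match indices. -/
instance {n m n' m' : ℕ} (f : IHP k n m) (g : IHP k n' m') (F G : (ℕ → k) → ℕ → k)
    [hf : IsLin f F] [hg : IsLin g G] : IsLin (f ⊕ₕ g) (tensorFun n m F G) where
  shifts b := by
    have h : HEq ((Iₕ b ⊕ₕ f) ⊕ₕ g) (Iₕ b ⊕ₕ (f ⊕ₕ g)) := tensor_assoc _ _ _
    rw [tensor_split (Iₕ b ⊕ₕ f) g] at h
    refine ((((hf.shifts b).tensor_id n').comp (hg.shifts (b + m))).of_heq (Nat.add_assoc ..)
      (Nat.add_assoc ..) h).congr fun v i _ => ?_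
    simp only [liftFun, tensorFun]
    by_cases h₁ : i < b
    · simp [h₁, Nat.lt_add_right m h₁]
    · by_cases h₂ : i < b + m
      · have h₃ : i - b < m := by omega
        simp [h₁, h₂, h₃]
      · have h₃ : ¬ i - b < m := by omega
        simp only [h₁, h₂, h₃, if_false]
        rw [Nat.sub_sub]
        congr 1
        funext j
        have h₄ : ¬ b + m + j < b + m := by omega
        simp only [h₄, if_false]
        congr 1; omega
  zeros := by
    rw [← zeros_tensor, ← zeros_tensor, ← hf.zeros, ← hg.zeros, ← interchange]

/-! ### Shifts along the zero vector and along a basis vector -/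

theorem shear_delete_left (a : k) : shear a ⨾ₕ (εₕ ⊕ₕ 𝟙ₕ) = σₕ ⨾ₕ axpy a := by
  have h : (𝟙ₕ ⊕ₕ axpy a) ⨾ₕ (εₕ ⊕ₕ 𝟙ₕ) = (εₕ ⊕ₕ Iₕ 2) ⨾ₕ axpy a := by
    rw [← slide]
    exact congrArg _ (eq_of_heq (id_zero_tensor (axpy a)))
  rw [shear, comp_assoc, comp_assoc, h, id_two, ← tensor_assoc₁₁, ← comp_assoc (Δₕ ⊕ₕ 𝟙ₕ),
    tensor_comp, copy_delete_left, id_comp, tensor_id, id_comp]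

theorem axpy_zero : (axpy 0 : IHP k 2 1) = εₕ ⊕ₕ 𝟙ₕ := by
  rw [axpy, scalar_zero, comp_tensor_id, comp_assoc, zero_add]
  exact comp_id _

theorem swap_delete : σₕ ⨾ₕ (εₕ ⊕ₕ 𝟙ₕ) = 𝟙ₕ ⊕ₕ εₕ := by
  have := sym_natural 𝟙ₕ εₕ
  rw [sym_one_zero] at this
  exact this.symm.trans (comp_id _)

theorem shift_zero {n : ℕ} {v : ℕ → k} (h : ∀ i < n, v i = 0) : shift n v = Iₕ n ⊕ₕ εₕ := by
  induction n with
  | zero => exact (eq_of_heq (id_zero_tensor _)).symm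
  | succ n ih =>
    rw [shift, h n n.lt_succ_self, ih fun i hi => h i (by omega), tensor_assoc₁₁, tensor_comp,
      shear_delete_left, axpy_zero, swap_delete, id_comp, ← tensor_assoc₁₀, tensor_id]

/-- Every point is recovered by setting its last coordinate to zero and shifting back along the last
basis vector; this drives the induction in `eq_of_shifts`. -/
theorem shift_basis {n : ℕ} {v : ℕ → k} (h : ∀ i < n, v i = 0) (h' : v n = 1) :
    ((Iₕ n ⊕ₕ ηₕ) ⊕ₕ 𝟙ₕ) ⨾ₕ shift (n + 1) v = Iₕ (n + 1) := by
  rw [shift, shift_zero h, h', tensor_assoc₁₁, tensor_assoc₁₁, tensor_comp, tensor_comp,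
    ← comp_assoc (ηₕ ⊕ₕ 𝟙ₕ), zero_shear, scalar_one, comp_assoc, tensor_comp, id_comp,
    id_comp, id_comp, id_comp, copy_delete_left, tensor_id]

/-! ### The forward generators as linear maps -/

theorem shift_succ_succ (b : ℕ) (v : ℕ → k) : shift (b + 2) v
    = (Iₕ b ⊕ₕ ((𝟙ₕ ⊕ₕ shear (v (b + 1))) ⨾ₕ (shear (v b) ⊕ₕ 𝟙ₕ))) ⨾ₕ (shift b v ⊕ₕ Iₕ 2) := by
  rw [shift, shift, ← tensor_id b 1, tensor_assoc₂₂, comp_tensor_id, tensor_assoc₁₁,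
    tensor_assoc₁₁, ← comp_assoc, tensor_comp, id_comp, tensor_id]

theorem zeros_one : (zeros 1 : IHP k 0 1) = ηₕ := eq_of_heq (id_zero_tensor _)

theorem zeros_two : (zeros 2 : IHP k 0 2) = ηₕ ⊕ₕ ηₕ :=
  congrArg (fun c : IHP k 0 1 => c ⊕ₕ ηₕ) zeros_one

theorem shift_liftFun (b : ℕ) (F : (ℕ → k) → ℕ → k) (v : ℕ → k) :
    shift b (liftFun b F v) = shift b v := shift_congr fun _ hi => if_pos hi

theorem liftFun_add {R : Type u} (b j : ℕ) (F : (ℕ → R) → ℕ → R) (v : ℕ → R) :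
    liftFun b F v (b + j) = F (fun j => v (b + j)) j := by simp [liftFun]

theorem liftFun_self {R : Type u} (b : ℕ) (F : (ℕ → R) → ℕ → R) (v : ℕ → R) :
    liftFun b F v b = F (fun j => v (b + j)) 0 := liftFun_add b 0 F v

/-- The shift of the `b` untouched wires slides past the generator, leaving a single shear identity,
here `shear_copy`. The other generators and the crossing follow the same pattern. -/
instance : IsLin Δₕ fun v _ => v 0 where
  shifts b v := by
    have h : (shift b v ⊕ₕ 𝟙ₕ) ⨾ₕ (Iₕ b ⊕ₕ Δₕ) = (Iₕ b ⊕ₕ (𝟙ₕ ⊕ₕ Δₕ)) ⨾ₕ (shift b v ⊕ₕ Iₕ 2) := by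
      rw [slide, ← tensor_id b 1, tensor_assoc₁₂]
    rw [shift_succ_succ, liftFun_self, liftFun_add, shift_liftFun, shift, comp_assoc, h,
      ← comp_assoc, tensor_comp, shear_copy, tensor_assoc₁₁,
      ← comp_assoc (Iₕ b ⊕ₕ (Δₕ ⊕ₕ 𝟙ₕ)), tensor_comp]
    rfl
  zeros := by rw [zeros_one, zero_copy, zeros_two]

instance (a : k) : IsLin (scalar a) fun v _ => v 0 * a where
  shifts b v := by
    have h : (shift b v ⊕ₕ 𝟙ₕ) ⨾ₕ (Iₕ b ⊕ₕ scalar a)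
        = (Iₕ b ⊕ₕ (𝟙ₕ ⊕ₕ scalar a)) ⨾ₕ (shift b v ⊕ₕ 𝟙ₕ) := by
      rw [slide, ← tensor_id b 1, tensor_assoc₁₁]
    rw [shift, shift, liftFun_self, shift_liftFun, comp_assoc, h, ← comp_assoc, tensor_comp,
      shear_scalar, tensor_assoc₁₁, ← comp_assoc, tensor_comp]
    rfl
  zeros := by rw [zeros_one, zero_scalar]

instance : IsLin ∇ₕ fun v _ => v 0 + v 1 where
  shifts b v := by
    have h : (shift b v ⊕ₕ Iₕ 2) ⨾ₕ (Iₕ b ⊕ₕ ∇ₕ) = (Iₕ b ⊕ₕ (𝟙ₕ ⊕ₕ ∇ₕ)) ⨾ₕ (shift b v ⊕ₕ 𝟙ₕ) := by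
      rw [slide, ← tensor_id b 1, tensor_assoc₂₁]
    rw [shift_succ_succ, shift, liftFun_self, shift_liftFun, comp_assoc, h, ← comp_assoc,
      tensor_comp, comp_assoc, shear_add, id_comp, tensor_assoc₁₁, ← comp_assoc, tensor_comp,
      id_comp]
    rfl
  zeros := by
    rw [zeros_two, zeros_one, tensor_split', comp_assoc, zero_add, comp_id]
    exact eq_of_heq (id_zero_tensor _)

instance : IsLin ηₕ fun _ _ => 0 where
  shifts b v := by
    have h : shift b v ⨾ₕ (Iₕ b ⊕ₕ ηₕ) = (Iₕ b ⊕ₕ (𝟙ₕ ⊕ₕ ηₕ)) ⨾ₕ (shift b v ⊕ₕ 𝟙ₕ) := by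
      rw [← tensor_assoc₀₁, tensor_id, ← slide]
      exact congrArg (fun c => c ⨾ₕ _) (tensor_id_zero _).symm
    rw [shift, liftFun_self, shift_liftFun, ← comp_assoc, tensor_assoc₁₁, tensor_comp,
      zero_shear_zero, id_comp, ← h]
    rfl
  zeros := by rw [zeros_one]; exact id_comp _

instance : IsLin σₕ fun v i => v (1 - i) where
  shifts b v := by
    have h : (shift b v ⊕ₕ Iₕ 2) ⨾ₕ (Iₕ b ⊕ₕ σₕ) = (Iₕ b ⊕ₕ (𝟙ₕ ⊕ₕ σₕ)) ⨾ₕ (shift b v ⊕ₕ Iₕ 2) := by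
      rw [slide, ← tensor_id b 1, tensor_assoc₂₂]
    rw [shift_succ_succ, shift_succ_succ, liftFun_self, liftFun_add, shift_liftFun, comp_assoc,
      h, ← comp_assoc, tensor_comp, comp_assoc, shear_swap, id_comp, tensor_assoc₁₁,
      ← comp_assoc (Iₕ b ⊕ₕ (σₕ ⊕ₕ 𝟙ₕ)), tensor_comp, id_comp]
    rfl
  zeros := by rw [zeros_two, ← zero_copy, comp_assoc, copy_comm]

theorem tensor_eq_comp {n m m' : ℕ} (c : IHP k n m) (d : IHP k 0 m') :
    c ⊕ₕ d = c ⨾ₕ (Iₕ m ⊕ₕ d) := by rw [tensor_split, tensor_id_zero]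

/-- Write the last input as a multiple of the last basis vector, using `shift_basis`, and pull the
shift through both arrows. What is left is their restriction to last input zero, which has one input
fewer; with no inputs the values at the origin decide. -/
theorem eq_of_shifts {n m : ℕ} {f g : IHP k n m} {F G : (ℕ → k) → ℕ → k} (hf : Shifts f F)
    (hg : Shifts g G) (hf₀ : zeros n ⨾ₕ f = zeros m) (hg₀ : zeros n ⨾ₕ g = zeros m)
    (h : ∀ v, ∀ i < m, F v i = G v i) : f = g := by
  induction n generalizing F G with
  | zero => rw [← id_comp f, ← id_comp g]; exact hf₀.trans hg₀.symm
  | succ n ih =>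
    have hη : Shifts (Iₕ n ⊕ₕ ηₕ) (liftFun n fun _ _ => 0) := IsLin.shifts n
    have hb := shift_basis (k := k) (n := n) (v := fun i => if i = n then 1 else 0)
      (fun i hi => if_neg hi.ne) (if_pos rfl)
    have key : (Iₕ n ⊕ₕ ηₕ) ⨾ₕ f = (Iₕ n ⊕ₕ ηₕ) ⨾ₕ g := by
      have h₀ : zeros n ⨾ₕ (Iₕ n ⊕ₕ ηₕ) = (zeros (n + 1) : IHP k 0 (n + 1)) :=
        (tensor_eq_comp _ _).symm
      refine ih (hη.comp hf) (hη.comp hg) ?_ ?_ fun v => h _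
      · rw [← comp_assoc, h₀, hf₀]
      · rw [← comp_assoc, h₀, hg₀]
    rw [← id_comp f, ← id_comp g, ← hb, comp_assoc, comp_assoc, hf, hg, shift_congr (h _),
      ← comp_assoc, ← comp_assoc, tensor_comp, tensor_comp, key]

/-- Forward circuits are determined by the linear functions that they denote. -/
theorem lin_ext {n m : ℕ} {f g : IHP k n m} {F G : (ℕ → k) → ℕ → k} [hf : IsLin f F]
    [hg : IsLin g G] (h : ∀ v, ∀ i < m, F v i = G v i) : f = g :=
  eq_of_shifts hf.shifts_self hg.shifts_self hf.zeros hg.zeros h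

local notation "Δ°ₕ" => IHP.coCopy (k := k)
local notation "ε°ₕ" => IHP.coDelete (k := k)
local notation "∇°ₕ" => IHP.coAdd (k := k)
local notation "η°ₕ" => IHP.coZero (k := k)
local notation "sₕ" => IHP.scalar (k := k) (-1)
local notation "Gₕ" => IHP.geq (k := k)

/-! ### Linear relations -/

theorem cond_swap (c : IHP k 1 0) : σₕ ⨾ₕ (c ⊕ₕ 𝟙ₕ) = 𝟙ₕ ⊕ₕ c := by
  have := sym_natural 𝟙ₕ c
  rw [sym_one_zero] at this
  exact this.symm.trans (comp_id _)

theorem swap_cond (c : IHP k 1 0) : σₕ ⨾ₕ (𝟙ₕ ⊕ₕ c) = c ⊕ₕ 𝟙ₕ := by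
  rw [← cond_swap, ← comp_assoc, swap_swap, id_comp]

theorem state_swap (c : IHP k 0 1) : (c ⊕ₕ 𝟙ₕ) ⨾ₕ σₕ = 𝟙ₕ ⊕ₕ c := by
  have := sym_natural c 𝟙ₕ
  rw [sym_zero_one] at this
  exact this.trans (id_comp _)

theorem swap_state (c : IHP k 0 1) : (𝟙ₕ ⊕ₕ c) ⨾ₕ σₕ = c ⊕ₕ 𝟙ₕ := by
  rw [← state_swap, comp_assoc, swap_swap, comp_id]

theorem coCopy_comm : σₕ ⨾ₕ Δ°ₕ = Δ°ₕ := of_ihEq .co_copy_comm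
theorem coDelete_coCopy_left : (ε°ₕ ⊕ₕ 𝟙ₕ) ⨾ₕ Δ°ₕ = 𝟙ₕ := of_ihEq .co_copy_unit
theorem coDelete_coCopy_right : (𝟙ₕ ⊕ₕ ε°ₕ) ⨾ₕ Δ°ₕ = 𝟙ₕ := by
  rw [← coCopy_comm, ← comp_assoc, swap_state, coDelete_coCopy_left]
theorem coAdd_comm : ∇°ₕ ⨾ₕ σₕ = ∇°ₕ := of_ihEq .co_add_comm
theorem coAdd_coZero_left : ∇°ₕ ⨾ₕ (η°ₕ ⊕ₕ 𝟙ₕ) = 𝟙ₕ := of_ihEq .co_add_unit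
theorem coDelete_delete : ε°ₕ ⨾ₕ εₕ = Iₕ 0 := of_ihEq .copy_bone
theorem coDelete_coZero : ε°ₕ ⨾ₕ η°ₕ = Iₕ 0 := of_ihEq .co_bone
theorem zero_coZero : ηₕ ⨾ₕ η°ₕ = Iₕ 0 := of_ihEq .add_bone
theorem coCopy_coZero : Δ°ₕ ⨾ₕ η°ₕ = η°ₕ ⊕ₕ η°ₕ := of_ihEq .co_bimonoid_unit
theorem coDelete_coAdd : ε°ₕ ⨾ₕ ∇°ₕ = ε°ₕ ⊕ₕ ε°ₕ := of_ihEq .co_bimonoid_counit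
theorem copy_frobenius_left : (Δₕ ⊕ₕ 𝟙ₕ) ⨾ₕ (𝟙ₕ ⊕ₕ Δ°ₕ) = Δ°ₕ ⨾ₕ Δₕ := of_ihEq .copy_frobenius_left
theorem copy_frobenius_right : Δ°ₕ ⨾ₕ Δₕ = (𝟙ₕ ⊕ₕ Δₕ) ⨾ₕ (Δ°ₕ ⊕ₕ 𝟙ₕ) :=
  of_ihEq .copy_frobenius_right
theorem add_frobenius_left : (∇°ₕ ⊕ₕ 𝟙ₕ) ⨾ₕ (𝟙ₕ ⊕ₕ ∇ₕ) = ∇ₕ ⨾ₕ ∇°ₕ := of_ihEq .add_frobenius_left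
theorem add_frobenius_right : ∇ₕ ⨾ₕ ∇°ₕ = (𝟙ₕ ⊕ₕ ∇°ₕ) ⨾ₕ (∇ₕ ⊕ₕ 𝟙ₕ) :=
  of_ihEq .add_frobenius_right
theorem coZero_le_delete : η°ₕ ≤ εₕ := cls_le.2 (.ax (.ihIneq .coZero_delete))
theorem zero_le_coDelete : ηₕ ≤ ε°ₕ := cls_le.2 (.ax (.ihIneq .co_coZero_delete))

theorem coScalar_eq {a : k} (ha : a ≠ 0) : coScalar a = scalar a⁻¹ := by
  calc coScalar a = coScalar a ⨾ₕ scalar a ⨾ₕ scalar a⁻¹ := by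
        rw [scalar_scalar, mul_inv_cancel₀ ha, scalar_one, comp_id]
    _ = scalar a⁻¹ := by rw [← comp_assoc, coScalar_scalar ha, id_comp]

theorem coDelete_scalar {a : k} (ha : a ≠ 0) : ε°ₕ ⨾ₕ scalar a = ε°ₕ := by
  have h : ε°ₕ ⨾ₕ coScalar a⁻¹ = ε°ₕ := of_ihEq (.co_scalar_delete _)
  rwa [coScalar_eq (inv_ne_zero ha), inv_inv] at h

theorem scalar_coZero {a : k} (ha : a ≠ 0) : scalar a ⨾ₕ η°ₕ = η°ₕ := by
  have h : η°ₕ = coScalar a⁻¹ ⨾ₕ η°ₕ := of_ihEq (.co_scalar_zero _)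
  rwa [coScalar_eq (inv_ne_zero ha), inv_inv, eq_comm] at h

theorem neg_neg : sₕ ⨾ₕ sₕ = 𝟙ₕ := by
  rw [scalar_scalar, ← scalar_one]; norm_num

/-- The relation `x + y = 0`. -/
def sumZero : IHP k 2 0 := add ⨾ₕ coZero

local notation "αₕ" => IHP.sumZero (k := k)

theorem sumZero_eq : αₕ = (sₕ ⊕ₕ 𝟙ₕ) ⨾ₕ Δ°ₕ ⨾ₕ εₕ := of_ihEq .cap_white

theorem neg_sumZero : (sₕ ⊕ₕ sₕ) ⨾ₕ αₕ = αₕ := by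
  rw [sumZero, ← comp_assoc, ← add_scalar, comp_assoc, scalar_coZero (by norm_num)]

theorem cap_eq_left : Δ°ₕ ⨾ₕ εₕ = (sₕ ⊕ₕ 𝟙ₕ) ⨾ₕ αₕ := by
  rw [sumZero_eq, ← comp_assoc, tensor_comp, neg_neg, id_comp, tensor_id, id_comp]

theorem cap_eq_right : Δ°ₕ ⨾ₕ εₕ = (𝟙ₕ ⊕ₕ sₕ) ⨾ₕ αₕ := by
  conv_rhs => rw [← neg_sumZero]
  rw [cap_eq_left, ← comp_assoc, tensor_comp, neg_neg, id_comp]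

/-- Frobenius for addition, fed with a zero: splitting x means choosing t and returning (x − t, t).
-/
theorem coAdd_eq' : ∇°ₕ = (𝟙ₕ ⊕ₕ (ε°ₕ ⨾ₕ Δₕ ⨾ₕ (sₕ ⊕ₕ 𝟙ₕ))) ⨾ₕ (∇ₕ ⊕ₕ 𝟙ₕ) := by
  have h : ηₕ ⨾ₕ ∇°ₕ = (ε°ₕ ⨾ₕ Δₕ) ⨾ₕ (sₕ ⊕ₕ 𝟙ₕ) := of_ihEq .cup_white
  rw [← comp_assoc ε°ₕ, ← h, id_tensor_comp, comp_assoc, ← add_frobenius_right, ← comp_assoc,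
    add_zero, id_comp]

theorem coAdd_eq {f : IHP k 2 2} {F : (ℕ → k) → ℕ → k} [IsLin f F] (h₀ : ∀ v, F v 0 = v 0 - v 1)
    (h₁ : ∀ v, F v 1 = v 1) : ∇°ₕ = (𝟙ₕ ⊕ₕ ε°ₕ) ⨾ₕ f := by
  rw [coAdd_eq', id_tensor_comp, comp_assoc]
  congr 1
  refine lin_ext fun v i hi => ?_
  interval_cases i <;> simp [tensorFun, h₀, h₁]; ring

/-- An arbitrary value stays arbitrary after translation. If c is the left side, Frobenius gives c ⨾
∇° = c ⊕ ε°, and bending gives c ⨾ η° = ε; the counit law for ∇° then recovers c from these two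
facts. -/
theorem coDelete_add : (𝟙ₕ ⊕ₕ ε°ₕ) ⨾ₕ ∇ₕ = εₕ ⨾ₕ ε°ₕ := by
  have h₁ : ((𝟙ₕ ⊕ₕ ε°ₕ) ⨾ₕ ∇ₕ) ⨾ₕ ∇°ₕ = ((𝟙ₕ ⊕ₕ ε°ₕ) ⨾ₕ ∇ₕ) ⊕ₕ ε°ₕ := by
    rw [comp_assoc, add_frobenius_right, ← comp_assoc, tensor_comp, coDelete_coAdd,
      ← tensor_assoc₀₁, tensor_comp, comp_id (_ : IHP k 0 1), id_comp]
  have h₂ : ((𝟙ₕ ⊕ₕ ε°ₕ) ⨾ₕ ∇ₕ) ⨾ₕ η°ₕ = εₕ := by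
    have h : αₕ = (𝟙ₕ ⊕ₕ sₕ) ⨾ₕ Δ°ₕ ⨾ₕ εₕ := by
      rw [cap_eq_right, ← comp_assoc, tensor_comp, neg_neg, id_comp, tensor_id, id_comp]
    rw [comp_assoc, show ∇ₕ ⨾ₕ η°ₕ = _ from h, ← comp_assoc, tensor_comp,
      coDelete_scalar (by norm_num), id_comp, ← comp_assoc, coDelete_coCopy_right, id_comp]
  have h₃ : (𝟙ₕ ⊕ₕ ε°ₕ) ⨾ₕ ∇ₕ = (((𝟙ₕ ⊕ₕ ε°ₕ) ⨾ₕ ∇ₕ) ⨾ₕ ∇°ₕ) ⨾ₕ (η°ₕ ⊕ₕ 𝟙ₕ) := by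
    rw [comp_assoc _ ∇°ₕ, coAdd_coZero_left, comp_id]
  rw [h₃, h₁, tensor_comp, h₂, comp_id, tensor_eq_comp]
  exact congrArg _ (eq_of_heq (id_zero_tensor _))

/-- The argument of `coDelete_add` with the two Frobenius structures exchanged and read backwards.
-/
theorem copy_coZero : Δₕ ⨾ₕ (𝟙ₕ ⊕ₕ η°ₕ) = η°ₕ ⨾ₕ ηₕ := by
  have h₁ : Δ°ₕ ⨾ₕ Δₕ ⨾ₕ (𝟙ₕ ⊕ₕ η°ₕ) = (Δₕ ⨾ₕ (𝟙ₕ ⊕ₕ η°ₕ)) ⊕ₕ η°ₕ := by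
    rw [← comp_assoc, ← copy_frobenius_left, comp_assoc, tensor_comp, coCopy_coZero,
      ← tensor_assoc₁₀, tensor_comp, id_comp, id_comp]
  have h₂ : ε°ₕ ⨾ₕ Δₕ ⨾ₕ (𝟙ₕ ⊕ₕ η°ₕ) = ηₕ := by
    have h : ηₕ ⨾ₕ ∇°ₕ = (ε°ₕ ⨾ₕ Δₕ) ⨾ₕ (sₕ ⊕ₕ 𝟙ₕ) := of_ihEq .cup_white
    have h' : (ε°ₕ ⨾ₕ Δₕ ⨾ₕ (𝟙ₕ ⊕ₕ η°ₕ)) ⨾ₕ sₕ = ηₕ := by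
      have e : (𝟙ₕ ⊕ₕ η°ₕ) ⨾ₕ sₕ = (sₕ ⊕ₕ 𝟙ₕ) ⨾ₕ (𝟙ₕ ⊕ₕ η°ₕ) := by
        rw [slide, tensor_id_zero]
      rw [comp_assoc, comp_assoc, e, ← comp_assoc Δₕ, ← comp_assoc ε°ₕ, ← comp_assoc ε°ₕ, ← h,
        comp_assoc, ← coAdd_comm, comp_assoc, swap_cond, coAdd_coZero_left, comp_id]
    have h₃ : ε°ₕ ⨾ₕ Δₕ ⨾ₕ (𝟙ₕ ⊕ₕ η°ₕ) = ((ε°ₕ ⨾ₕ Δₕ ⨾ₕ (𝟙ₕ ⊕ₕ η°ₕ)) ⨾ₕ sₕ) ⨾ₕ sₕ := by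
      rw [comp_assoc _ sₕ, neg_neg, comp_id]
    rw [h₃, h', zero_scalar]
  have h₃ : Δₕ ⨾ₕ (𝟙ₕ ⊕ₕ η°ₕ) = (ε°ₕ ⊕ₕ 𝟙ₕ) ⨾ₕ Δ°ₕ ⨾ₕ Δₕ ⨾ₕ (𝟙ₕ ⊕ₕ η°ₕ) := by
    rw [← comp_assoc (ε°ₕ ⊕ₕ 𝟙ₕ), coDelete_coCopy_left, id_comp]
  rw [h₃, h₁, tensor_comp, h₂, id_comp, tensor_split', tensor_id_zero]
  exact congrArg (fun c => c ⨾ₕ ηₕ) (eq_of_heq (id_zero_tensor _))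

/-- A bound wire may be translated by a function of the other wires. -/
theorem exists_translate {n : ℕ} (g : IHP k n (n + 1)) (hg : g ⨾ₕ (Iₕ n ⊕ₕ εₕ) = Iₕ n) :
    (Iₕ n ⊕ₕ ε°ₕ) ⨾ₕ (g ⊕ₕ 𝟙ₕ) ⨾ₕ (Iₕ n ⊕ₕ ∇ₕ) = Iₕ n ⊕ₕ ε°ₕ := by
  have h : (Iₕ n ⊕ₕ ε°ₕ) ⨾ₕ (g ⊕ₕ 𝟙ₕ) = g ⨾ₕ (Iₕ n ⊕ₕ (𝟙ₕ ⊕ₕ ε°ₕ)) := by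
    rw [← slide, tensor_id_zero, ← tensor_assoc₀₁, tensor_id]
  rw [← comp_assoc, h, comp_assoc, tensor_comp, coDelete_add, id_comp, id_tensor_comp,
    ← comp_assoc, hg]
  exact id_comp _

/-! ### The order -/

/-- The class of the opposite of the order. -/
def leq : IHP k 1 1 := cls GeqCirc.leq

theorem tensor_assoc₂₀ {n m n' m' : ℕ} (c : IHP k n m) (d : IHP k n' m') (e : IHP k 2 0) :
    (c ⊕ₕ d) ⊕ₕ e = c ⊕ₕ (d ⊕ₕ e) := eq_of_heq (tensor_assoc c d e)

theorem tensor_assoc₀₂ {n m n' m' : ℕ} (c : IHP k n m) (d : IHP k n' m') (e : IHP k 0 2) :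
    (c ⊕ₕ d) ⊕ₕ e = c ⊕ₕ (d ⊕ₕ e) := eq_of_heq (tensor_assoc c d e)

theorem comp_neg_neg {n : ℕ} (c : IHP k n 1) : (c ⨾ₕ sₕ) ⨾ₕ sₕ = c := by
  rw [comp_assoc, neg_neg, comp_id]

theorem neg_neg_comp {n : ℕ} (c : IHP k 1 n) : sₕ ⨾ₕ sₕ ⨾ₕ c = c := by
  rw [← comp_assoc, neg_neg, id_comp]

theorem geq_delete : Gₕ ⨾ₕ εₕ = εₕ := of_ordEq .geq_delete

theorem coZero_le_geq : η°ₕ ≤ Gₕ ⨾ₕ η°ₕ := cls_le.2 (.ax (.ordIneq .geq_zero))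

theorem copy_snake : (𝟙ₕ ⊕ₕ (ε°ₕ ⨾ₕ Δₕ)) ⨾ₕ ((Δ°ₕ ⨾ₕ εₕ) ⊕ₕ 𝟙ₕ) = 𝟙ₕ := by
  rw [comp_tensor_id, id_tensor_comp, comp_assoc, ← comp_assoc (𝟙ₕ ⊕ₕ Δₕ), ← copy_frobenius_right,
    comp_assoc, copy_delete_left, comp_id, coDelete_coCopy_right]

/-- Moving the summands of a vanishing sum to the other side. -/
theorem coAdd_bend {n : ℕ} (c : IHP k n 1) :
    (Iₕ n ⊕ₕ (ε°ₕ ⨾ₕ Δₕ ⨾ₕ (sₕ ⊕ₕ 𝟙ₕ))) ⨾ₕ (((c ⊕ₕ 𝟙ₕ) ⨾ₕ αₕ) ⊕ₕ 𝟙ₕ) = c := by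
  have h : ((c ⊕ₕ 𝟙ₕ) ⊕ₕ 𝟙ₕ) = c ⊕ₕ Iₕ 2 := by rw [tensor_assoc₁₁, tensor_id]
  rw [comp_tensor_id, ← comp_assoc, h, ← slide, tensor_id_zero, sumZero, comp_tensor_id,
    comp_assoc, ← comp_assoc (𝟙ₕ ⊕ₕ _), ← coAdd_eq', coAdd_coZero_left, comp_id]

/-- Bending the output along x + y = 0 is reversible by `coAdd_bend`, so inclusions may be checked
on conditions without outputs. -/
theorem le_of_sumZero {n : ℕ} {c d : IHP k n 1}
    (h : (c ⊕ₕ 𝟙ₕ) ⨾ₕ αₕ ≤ (d ⊕ₕ 𝟙ₕ) ⨾ₕ αₕ) : c ≤ d := by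
  rw [← coAdd_bend c, ← coAdd_bend d]
  exact comp_mono le_rfl (tensor_mono h le_rfl)

theorem eq_of_sumZero {n : ℕ} {c d : IHP k n 1}
    (h : (c ⊕ₕ 𝟙ₕ) ⨾ₕ αₕ = (d ⊕ₕ 𝟙ₕ) ⨾ₕ αₕ) : c = d :=
  le_antisymm (le_of_sumZero h.le) (le_of_sumZero h.ge)

/-- Since ≤ is ≥ with both wires bent, the cap straightens one of the bends by `copy_snake`. -/
theorem leq_bend : (𝟙ₕ ⊕ₕ leq) ⨾ₕ Δ°ₕ ⨾ₕ εₕ = (Gₕ ⊕ₕ 𝟙ₕ) ⨾ₕ Δ°ₕ ⨾ₕ εₕ := by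
  have e : (leq : IHP k 1 1) = ((ε°ₕ ⨾ₕ Δₕ) ⊕ₕ 𝟙ₕ) ⨾ₕ (𝟙ₕ ⊕ₕ (Gₕ ⊕ₕ 𝟙ₕ)) ⨾ₕ (𝟙ₕ ⊕ₕ (Δ°ₕ ⨾ₕ εₕ)) :=
    rfl
  have h : (𝟙ₕ ⊕ₕ (𝟙ₕ ⊕ₕ ((Gₕ ⊕ₕ 𝟙ₕ) ⨾ₕ Δ°ₕ ⨾ₕ εₕ))) ⨾ₕ Δ°ₕ ⨾ₕ εₕ
      = ((Δ°ₕ ⨾ₕ εₕ) ⊕ₕ Iₕ 2) ⨾ₕ (Gₕ ⊕ₕ 𝟙ₕ) ⨾ₕ Δ°ₕ ⨾ₕ εₕ := by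
    have hc : (Δ°ₕ ⨾ₕ εₕ) ⊕ₕ Iₕ 0 = Δ°ₕ ⨾ₕ εₕ := tensor_id_zero _
    have hd : Iₕ 0 ⊕ₕ ((Gₕ ⊕ₕ 𝟙ₕ) ⨾ₕ Δ°ₕ ⨾ₕ εₕ) = (Gₕ ⊕ₕ 𝟙ₕ) ⨾ₕ Δ°ₕ ⨾ₕ εₕ :=
      eq_of_heq (id_zero_tensor _)
    have hs := slide (Δ°ₕ ⨾ₕ εₕ) ((Gₕ ⊕ₕ 𝟙ₕ) ⨾ₕ Δ°ₕ ⨾ₕ εₕ)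
    rw [hc, hd] at hs
    rw [← tensor_assoc₂₀, tensor_id]
    exact hs.symm
  rw [e, tensor_comp, id_comp, id_tensor_comp, comp_assoc, h, ← tensor_assoc₁₁, id_two,
    ← tensor_assoc₁₁, ← comp_assoc, tensor_comp, copy_snake, id_comp, tensor_id, id_comp]

theorem cap_le : Δ°ₕ ⨾ₕ εₕ ≤ εₕ ⊕ₕ εₕ := by
  rw [cap_eq_left, sumZero]
  refine (comp_mono le_rfl (comp_mono le_rfl coZero_le_delete)).trans ?_
  rw [add_delete, tensor_comp, scalar_delete, id_comp]

section Ordered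

variable [IsStrictOrderedRing k]

theorem leq_eq : (leq : IHP k 1 1) = sₕ ⨾ₕ Gₕ ⨾ₕ sₕ := by
  have h : sₕ ⨾ₕ Gₕ = leq ⨾ₕ sₕ := of_ordEq (.geq_scalar_neg (-1) (by norm_num))
  rw [← comp_assoc, h, comp_assoc, neg_neg, comp_id]

/-- The relation ≤ is both the transpose of ≥ and its conjugate by −1. Comparing the two makes ≥
self-adjoint for x + y = 0. -/
theorem geq_sumZero : (Gₕ ⊕ₕ 𝟙ₕ) ⨾ₕ αₕ = (𝟙ₕ ⊕ₕ Gₕ) ⨾ₕ αₕ := by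
  have h := leq_bend (k := k)
  rw [cap_eq_right, leq_eq, ← comp_assoc, tensor_comp, id_comp, comp_assoc, comp_assoc, neg_neg,
    comp_id, ← comp_assoc, slide, comp_assoc, id_tensor_comp, comp_assoc] at h
  have h' := congrArg (fun c => (𝟙ₕ ⊕ₕ sₕ) ⨾ₕ c) h
  beta_reduce at h'
  rw [← comp_assoc, ← comp_assoc (𝟙ₕ ⊕ₕ sₕ), tensor_comp, neg_neg, id_comp, tensor_id, id_comp] at h'
  rw [h', id_comp]

/-- Transposing the axiom on ≥ and deletion gives the statement for ≤; conjugation by −1 transfers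
it to ≥. -/
theorem coDelete_geq : ε°ₕ ⨾ₕ Gₕ = ε°ₕ := by
  have h : ε°ₕ ⨾ₕ leq = ε°ₕ := by
    have e : (leq : IHP k 1 1) = ((ε°ₕ ⨾ₕ Δₕ) ⊕ₕ 𝟙ₕ) ⨾ₕ (𝟙ₕ ⊕ₕ (Gₕ ⊕ₕ 𝟙ₕ)) ⨾ₕ
        (𝟙ₕ ⊕ₕ (Δ°ₕ ⨾ₕ εₕ)) := rfl
    have e₁ : ε°ₕ ⨾ₕ ((ε°ₕ ⨾ₕ Δₕ) ⊕ₕ 𝟙ₕ) = (ε°ₕ ⨾ₕ Δₕ) ⨾ₕ (𝟙ₕ ⊕ₕ (𝟙ₕ ⊕ₕ ε°ₕ)) := by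
      have hc : Iₕ 0 ⊕ₕ ε°ₕ = ε°ₕ := eq_of_heq (id_zero_tensor _)
      rw [← tensor_assoc₀₁, tensor_id, ← tensor_eq_comp]
      calc _ = (Iₕ 0 ⊕ₕ ε°ₕ) ⨾ₕ ((ε°ₕ ⨾ₕ Δₕ) ⊕ₕ 𝟙ₕ) := by rw [hc]
        _ = _ := by rw [tensor_comp, id_comp, comp_id]
    have e₂ : (𝟙ₕ ⊕ₕ ε°ₕ) ⨾ₕ (Gₕ ⊕ₕ 𝟙ₕ) = Gₕ ⨾ₕ (𝟙ₕ ⊕ₕ ε°ₕ) := by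
      rw [← slide, tensor_id_zero]
    rw [e, ← comp_assoc, e₁, comp_assoc, tensor_comp, tensor_comp, id_comp, id_comp, ← comp_assoc,
      e₂, comp_assoc Gₕ, ← comp_assoc _ Δ°ₕ, coDelete_coCopy_right, id_comp, geq_delete, comp_assoc,
      copy_delete_right, comp_id]
  rw [leq_eq, ← comp_assoc, coDelete_scalar (by norm_num)] at h
  rw [← comp_neg_neg (ε°ₕ ⨾ₕ Gₕ), comp_assoc ε°ₕ, h, coDelete_scalar (by norm_num)]

theorem cup_le : ε°ₕ ⨾ₕ Δₕ ≤ ε°ₕ ⊕ₕ ε°ₕ := by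
  have h : ηₕ ⨾ₕ ∇°ₕ = (ε°ₕ ⨾ₕ Δₕ) ⨾ₕ (sₕ ⊕ₕ 𝟙ₕ) := of_ihEq .cup_white
  have h' : ε°ₕ ⨾ₕ Δₕ = (ηₕ ⨾ₕ ∇°ₕ) ⨾ₕ (sₕ ⊕ₕ 𝟙ₕ) := by
    rw [h, comp_assoc, tensor_comp, neg_neg, id_comp, tensor_id, comp_id]
  rw [h']
  refine (comp_mono (comp_mono zero_le_coDelete le_rfl) le_rfl).trans ?_
  rw [coDelete_coAdd, tensor_comp, coDelete_scalar (by norm_num), comp_id]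

/-- Leave the second input of the spider axiom arbitrary and discard its second output. One side
collapses to ≥ ⨾ ≥; on the other, the leftover cup and cap may be weakened to unrelated ends
(`cup_le`, `cap_le`), and a single ≥ survives. -/
theorem geq_geq_le : Gₕ ⨾ₕ Gₕ ≤ Gₕ := by
  have h : (Gₕ ⊕ₕ Gₕ) ⨾ₕ Δ°ₕ ⨾ₕ Δₕ ⨾ₕ (Gₕ ⊕ₕ Gₕ) = (Δₕ ⊕ₕ Δₕ) ⨾ₕ (Gₕ ⊕ₕ (Gₕ ⊕ₕ (Gₕ ⊕ₕ Gₕ))) ⨾ₕ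
      (𝟙ₕ ⊕ₕ (σₕ ⊕ₕ 𝟙ₕ)) ⨾ₕ (Δ°ₕ ⊕ₕ Δ°ₕ) := of_ordEq .spider
  have h₁ : Gₕ ⨾ₕ Gₕ
      = (𝟙ₕ ⊕ₕ ε°ₕ) ⨾ₕ ((Gₕ ⊕ₕ Gₕ) ⨾ₕ Δ°ₕ ⨾ₕ Δₕ ⨾ₕ (Gₕ ⊕ₕ Gₕ)) ⨾ₕ (𝟙ₕ ⊕ₕ εₕ) := by
    have e₁ : (𝟙ₕ ⊕ₕ ε°ₕ) ⨾ₕ (Gₕ ⊕ₕ Gₕ) = Gₕ ⨾ₕ (𝟙ₕ ⊕ₕ ε°ₕ) := by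
      rw [tensor_comp, coDelete_geq, id_comp, tensor_eq_comp]
    have e₂ : (Gₕ ⊕ₕ Gₕ) ⨾ₕ (𝟙ₕ ⊕ₕ εₕ) = (𝟙ₕ ⊕ₕ εₕ) ⨾ₕ Gₕ := by
      rw [tensor_comp, geq_delete, comp_id, tensor_split', tensor_id_zero]
    rw [comp_assoc, ← comp_assoc (𝟙ₕ ⊕ₕ ε°ₕ), e₁]
    simp only [comp_assoc]
    rw [e₂, ← comp_assoc (𝟙ₕ ⊕ₕ ε°ₕ), coDelete_coCopy_right, id_comp, ← comp_assoc Δₕ,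
      copy_delete_right, id_comp]
  have h₂ : ((Δₕ ⨾ₕ (Gₕ ⊕ₕ Gₕ)) ⊕ₕ (ε°ₕ ⊕ₕ ε°ₕ)) ⨾ₕ (𝟙ₕ ⊕ₕ (σₕ ⊕ₕ 𝟙ₕ))
      = (Δₕ ⨾ₕ (Gₕ ⊕ₕ Gₕ)) ⨾ₕ ((𝟙ₕ ⊕ₕ ε°ₕ) ⊕ₕ (𝟙ₕ ⊕ₕ ε°ₕ)) := by
    have e₁ : Iₕ 2 ⊕ₕ (ε°ₕ ⊕ₕ ε°ₕ) = 𝟙ₕ ⊕ₕ ((𝟙ₕ ⊕ₕ ε°ₕ) ⊕ₕ ε°ₕ) := by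
      rw [tensor_assoc₀₁, ← tensor_assoc₀₂, tensor_id]
    have e₂ : (𝟙ₕ ⊕ₕ ε°ₕ) ⊕ₕ (𝟙ₕ ⊕ₕ ε°ₕ) = 𝟙ₕ ⊕ₕ ((ε°ₕ ⊕ₕ 𝟙ₕ) ⊕ₕ ε°ₕ) := by
      rw [tensor_assoc₁₂, tensor_assoc₀₁]
    have e₃ : ((𝟙ₕ ⊕ₕ ε°ₕ) ⊕ₕ ε°ₕ) ⨾ₕ (σₕ ⊕ₕ 𝟙ₕ) = (ε°ₕ ⊕ₕ 𝟙ₕ) ⊕ₕ ε°ₕ := by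
      rw [tensor_comp, swap_state, comp_id]
    rw [tensor_eq_comp, comp_assoc, e₁, tensor_comp, e₃, id_comp, e₂]
  rw [h₁, h]
  refine (le_trans (b := (((Δₕ ⨾ₕ (Gₕ ⊕ₕ Gₕ)) ⊕ₕ (ε°ₕ ⊕ₕ ε°ₕ)) ⨾ₕ (𝟙ₕ ⊕ₕ (σₕ ⊕ₕ 𝟙ₕ))) ⨾ₕ
    (Δ°ₕ ⊕ₕ (εₕ ⊕ₕ εₕ))) ?_ ?_)
  · have e : (Gₕ ⊕ₕ (Gₕ ⊕ₕ (Gₕ ⊕ₕ Gₕ))) = (Gₕ ⊕ₕ Gₕ) ⊕ₕ (Gₕ ⊕ₕ Gₕ) := (tensor_assoc₂₂ _ _ _).symm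
    have e' : (Δ°ₕ ⊕ₕ Δ°ₕ) ⨾ₕ (𝟙ₕ ⊕ₕ εₕ) = Δ°ₕ ⊕ₕ (Δ°ₕ ⨾ₕ εₕ) := by rw [tensor_comp, comp_id]
    simp only [comp_assoc]
    rw [e, e', ← comp_assoc (Δₕ ⊕ₕ Δₕ), tensor_comp, ← comp_assoc (𝟙ₕ ⊕ₕ ε°ₕ), tensor_comp,
      ← comp_assoc ε°ₕ, id_comp]
    refine comp_mono (tensor_mono le_rfl ((comp_mono cup_le le_rfl).trans ?_))
      (comp_mono le_rfl (tensor_mono le_rfl cap_le))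
    rw [tensor_comp, coDelete_geq]
  · rw [h₂, comp_assoc, tensor_comp, coDelete_coCopy_right, tensor_comp, coDelete_delete, id_comp,
      tensor_id_zero, comp_assoc, tensor_comp, geq_delete, comp_id]
    rw [tensor_split', tensor_id_zero, ← comp_assoc, copy_delete_right, id_comp]

theorem id_le_geq : 𝟙ₕ ≤ Gₕ := by
  refine le_trans ?_ geq_geq_le
  refine le_of_sumZero ?_
  have h : ∇ₕ ⨾ₕ Gₕ = (Gₕ ⊕ₕ Gₕ) ⨾ₕ ∇ₕ := of_ordEq .geq_add
  -- Bent along x + y = 0, additivity of ≥ and `geq_sumZero` collect both copies of ≥ on one wire.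
  -- Since zero is nonnegative, the bent identity lies below this.
  have h' : ∇ₕ ⨾ₕ Gₕ ⨾ₕ η°ₕ = ((Gₕ ⨾ₕ Gₕ) ⊕ₕ 𝟙ₕ) ⨾ₕ αₕ := by
    rw [← comp_assoc, h, comp_assoc, ← sumZero, tensor_split, comp_assoc, ← geq_sumZero,
      comp_tensor_id, comp_assoc]
  rw [← h', tensor_id, id_comp]
  exact comp_mono le_rfl coZero_le_geq

theorem geq_geq : Gₕ ⨾ₕ Gₕ = Gₕ := by
  refine le_antisymm geq_geq_le ?_
  conv_lhs => rw [← comp_id Gₕ]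
  exact comp_mono le_rfl id_le_geq

/-- The order is compatible with translations. -/
theorem add_geq : (𝟙ₕ ⊕ₕ Gₕ) ⨾ₕ ∇ₕ = ∇ₕ ⨾ₕ Gₕ := by
  have h : ∇ₕ ⨾ₕ Gₕ = (Gₕ ⊕ₕ Gₕ) ⨾ₕ ∇ₕ := of_ordEq .geq_add
  have hτ : (∇ₕ ⊕ₕ 𝟙ₕ) ⨾ₕ αₕ = (𝟙ₕ ⊕ₕ ∇ₕ) ⨾ₕ αₕ := by
    rw [sumZero, ← comp_assoc, ← comp_assoc, add_assoc]
  -- On the relation x + y + z = 0, which is symmetric, ≥ applied to two of the wires equals ≥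
  -- applied to the third; `h₁`, `h₂` and `h₃` are the three instances.
  have h₁ : ((Gₕ ⊕ₕ Gₕ) ⊕ₕ 𝟙ₕ) ⨾ₕ (∇ₕ ⊕ₕ 𝟙ₕ) ⨾ₕ αₕ = (Iₕ 2 ⊕ₕ Gₕ) ⨾ₕ (∇ₕ ⊕ₕ 𝟙ₕ) ⨾ₕ αₕ := by
    rw [← comp_assoc, tensor_comp, ← h, id_comp, comp_tensor_id, comp_assoc, geq_sumZero, ← comp_assoc,
      slide, comp_assoc]
  have h₂ : (𝟙ₕ ⊕ₕ (Gₕ ⊕ₕ Gₕ)) ⨾ₕ (∇ₕ ⊕ₕ 𝟙ₕ) ⨾ₕ αₕ = (Gₕ ⊕ₕ Iₕ 2) ⨾ₕ (∇ₕ ⊕ₕ 𝟙ₕ) ⨾ₕ αₕ := by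
    rw [hτ, ← comp_assoc, tensor_comp, ← h, id_comp, id_tensor_comp, comp_assoc, ← geq_sumZero,
      ← comp_assoc, ← slide, comp_assoc]
  have h₃ : ((𝟙ₕ ⊕ₕ Gₕ) ⊕ₕ 𝟙ₕ) ⨾ₕ (∇ₕ ⊕ₕ 𝟙ₕ) ⨾ₕ αₕ
      = ((Gₕ ⊕ₕ 𝟙ₕ) ⊕ₕ Gₕ) ⨾ₕ (∇ₕ ⊕ₕ 𝟙ₕ) ⨾ₕ αₕ := by
    have e : (σₕ ⊕ₕ 𝟙ₕ) ⨾ₕ (∇ₕ ⊕ₕ 𝟙ₕ) ⨾ₕ αₕ = (∇ₕ ⊕ₕ 𝟙ₕ) ⨾ₕ αₕ := by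
      rw [← comp_assoc, tensor_comp, add_comm, id_comp]
    calc ((𝟙ₕ ⊕ₕ Gₕ) ⊕ₕ 𝟙ₕ) ⨾ₕ (∇ₕ ⊕ₕ 𝟙ₕ) ⨾ₕ αₕ
        = (((𝟙ₕ ⊕ₕ Gₕ) ⊕ₕ 𝟙ₕ) ⨾ₕ (σₕ ⊕ₕ 𝟙ₕ)) ⨾ₕ (∇ₕ ⊕ₕ 𝟙ₕ) ⨾ₕ αₕ := by rw [comp_assoc, e]
      _ = (σₕ ⊕ₕ 𝟙ₕ) ⨾ₕ (Gₕ ⊕ₕ Iₕ 2) ⨾ₕ (∇ₕ ⊕ₕ 𝟙ₕ) ⨾ₕ αₕ := by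
        have e₁ : ((𝟙ₕ ⊕ₕ Gₕ) ⊕ₕ 𝟙ₕ) ⨾ₕ (σₕ ⊕ₕ 𝟙ₕ) = (σₕ ⊕ₕ 𝟙ₕ) ⨾ₕ ((Gₕ ⊕ₕ 𝟙ₕ) ⊕ₕ 𝟙ₕ) := by
          rw [tensor_comp, tensor_comp, sym_natural]
        rw [e₁, id_two, ← tensor_assoc₁₁, comp_assoc]
      _ = (((σₕ ⨾ₕ (𝟙ₕ ⊕ₕ Gₕ)) ⊕ₕ Gₕ)) ⨾ₕ (∇ₕ ⊕ₕ 𝟙ₕ) ⨾ₕ αₕ := by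
        rw [← h₂, ← comp_assoc, ← tensor_assoc₁₁, tensor_comp, id_comp]
      _ = (((Gₕ ⊕ₕ 𝟙ₕ) ⊕ₕ Gₕ) ⨾ₕ (σₕ ⊕ₕ 𝟙ₕ)) ⨾ₕ (∇ₕ ⊕ₕ 𝟙ₕ) ⨾ₕ αₕ := by
        rw [tensor_comp, sym_natural, comp_id]
      _ = _ := by rw [comp_assoc, e]
  -- Wire 2 becomes wires 1 and 3; trading wire 3 for wires 1 and 2 puts ≥ twice on wire 1, where it
  -- is idempotent.
  have h₄ : ((𝟙ₕ ⊕ₕ Gₕ) ⊕ₕ 𝟙ₕ) ⨾ₕ (∇ₕ ⊕ₕ 𝟙ₕ) ⨾ₕ αₕ = ((Gₕ ⊕ₕ Gₕ) ⊕ₕ 𝟙ₕ) ⨾ₕ (∇ₕ ⊕ₕ 𝟙ₕ) ⨾ₕ αₕ := by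
    calc _ = ((Gₕ ⊕ₕ 𝟙ₕ) ⊕ₕ 𝟙ₕ) ⨾ₕ (Iₕ 2 ⊕ₕ Gₕ) ⨾ₕ (∇ₕ ⊕ₕ 𝟙ₕ) ⨾ₕ αₕ := by
          rw [h₃, ← comp_assoc ((Gₕ ⊕ₕ 𝟙ₕ) ⊕ₕ 𝟙ₕ), tensor_comp, id_comp, comp_id]
      _ = _ := by rw [← h₁, ← comp_assoc, tensor_comp, tensor_comp, geq_geq, id_comp, id_comp]
  refine eq_of_sumZero ?_
  rw [h, comp_tensor_id, comp_tensor_id, comp_assoc, comp_assoc, h₄]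

end Ordered

/-! ### Guards -/

/-- With `state_slide`, this postpones conditions and advances bound variables, so that a circuit
acquires a linear map as its middle part. -/
theorem cond_slide {n m c : ℕ} (f : IHP k n m) (κ : IHP k c 0) :
    (Iₕ n ⊕ₕ κ) ⨾ₕ f = (f ⊕ₕ Iₕ c) ⨾ₕ (Iₕ m ⊕ₕ κ) := by
  rw [slide, tensor_id_zero]

theorem state_slide {n m c : ℕ} (f : IHP k n m) (e : IHP k 0 c) :
    f ⨾ₕ (Iₕ m ⊕ₕ e) = (Iₕ n ⊕ₕ e) ⨾ₕ (f ⊕ₕ Iₕ c) := by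
  rw [← slide, tensor_id_zero]

theorem id_tensor_cond {n c : ℕ} (κ : IHP k n 0) (κ' : IHP k c 0) :
    (Iₕ n ⊕ₕ κ') ⨾ₕ κ = κ ⊕ₕ κ' := by
  rw [tensor_split' κ κ', tensor_id_zero]

/-- The identity restricted by a condition. -/
def guard (κ : IHP k 1 0) : IHP k 1 1 := copy ⨾ₕ (wire ⊕ₕ κ)

/-- The pairs `(x, y, x, y)`. -/
abbrev copy₂ : IHP k 2 4 :=
  (Δₕ ⊕ₕ Δₕ) ⨾ₕ (𝟙ₕ ⊕ₕ (σₕ ⊕ₕ 𝟙ₕ))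

theorem guard_left (κ : IHP k 1 0) : Δₕ ⨾ₕ (κ ⊕ₕ 𝟙ₕ) = guard κ := by
  rw [guard, ← swap_cond, ← comp_assoc, copy_comm]

theorem guard_guard (κ κ' : IHP k 1 0) : guard κ ⨾ₕ guard κ' = guard (Δₕ ⨾ₕ (κ' ⊕ₕ κ)) := by
  rw [guard, guard, guard, comp_assoc, ← comp_assoc (𝟙ₕ ⊕ₕ κ), cond_slide, comp_assoc, ← comp_assoc,
    copy_assoc, ← tensor_id 1 1, tensor_assoc₁₀, tensor_comp, id_comp, id_tensor_cond, comp_assoc,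
    tensor_comp, id_comp]

theorem guard_coCopy_right (κ : IHP k 1 0) : (𝟙ₕ ⊕ₕ guard κ) ⨾ₕ Δ°ₕ = Δ°ₕ ⨾ₕ guard κ := by
  rw [guard, ← comp_assoc, copy_frobenius_right, comp_assoc, ← cond_slide, ← tensor_id 1 1,
    tensor_assoc₁₀, ← comp_assoc, tensor_comp, id_comp]

theorem guard_coCopy_left (κ : IHP k 1 0) : (guard κ ⊕ₕ 𝟙ₕ) ⨾ₕ Δ°ₕ = Δ°ₕ ⨾ₕ guard κ := by
  rw [← guard_coCopy_right]
  conv_lhs => rw [← coCopy_comm]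
  rw [← comp_assoc, sym_natural, comp_assoc, guard_coCopy_right, ← comp_assoc, coCopy_comm]

theorem scalar_guard (a : k) (κ : IHP k 1 0) :
    scalar a ⨾ₕ guard κ = guard (scalar a ⨾ₕ κ) ⨾ₕ scalar a := by
  rw [guard, guard, ← comp_assoc, scalar_copy, comp_assoc, tensor_comp, comp_id, comp_assoc,
    cond_slide, tensor_comp, id_comp, comp_id]

theorem guard_delete (κ : IHP k 1 0) : guard κ ⨾ₕ εₕ = κ := by
  rw [guard, comp_assoc, id_tensor_cond, tensor_split, ← comp_assoc, copy_delete_left, id_comp]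
  exact eq_of_heq (id_zero_tensor κ)

theorem guard_tensor (κ κ' : IHP k 1 0) :
    guard κ ⊕ₕ guard κ' = copy₂ ⨾ₕ (Iₕ 2 ⊕ₕ (κ ⊕ₕ κ')) := by
  have h : (𝟙ₕ ⊕ₕ κ) ⊕ₕ (𝟙ₕ ⊕ₕ κ') = (𝟙ₕ ⊕ₕ (σₕ ⊕ₕ 𝟙ₕ)) ⨾ₕ (Iₕ 2 ⊕ₕ (κ ⊕ₕ κ')) := by
    have h₁ : (𝟙ₕ ⊕ₕ κ) ⊕ₕ (𝟙ₕ ⊕ₕ κ') = (𝟙ₕ ⊕ₕ (σₕ ⨾ₕ (𝟙ₕ ⊕ₕ κ))) ⊕ₕ κ' := by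
      rw [← tensor_assoc₁₀, tensor_assoc₁₁, swap_cond]
    have h₂ : Iₕ 2 ⊕ₕ (κ ⊕ₕ κ') = (𝟙ₕ ⊕ₕ (𝟙ₕ ⊕ₕ κ)) ⊕ₕ κ' := by
      rw [← tensor_assoc₁₀, ← tensor_assoc₁₀, tensor_id]
    rw [h₁, h₂, ← tensor_assoc₁₁, tensor_comp, tensor_comp, id_comp, id_comp]
  rw [copy₂, comp_assoc, ← h, tensor_comp, guard, guard]

theorem coAdd_shear : ∇°ₕ = (𝟙ₕ ⊕ₕ ε°ₕ) ⨾ₕ (𝟙ₕ ⊕ₕ Δₕ) ⨾ₕ ((𝟙ₕ ⊕ₕ sₕ) ⊕ₕ 𝟙ₕ) ⨾ₕ (∇ₕ ⊕ₕ 𝟙ₕ) :=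
  coAdd_eq (fun v => by simp [tensorFun]; ring) (fun v => by simp [tensorFun])

/-- In the form (x − t, t) the two parts add up to x, so a condition on x can be imposed on their
sum after the split. Once ∇° is opened, the difference between the two sides is a forward identity.
-/
theorem guard_coAdd (κ : IHP k 1 0) :
    guard κ ⨾ₕ ∇°ₕ = ∇°ₕ ⨾ₕ copy₂ ⨾ₕ (Iₕ 2 ⊕ₕ (∇ₕ ⨾ₕ κ)) := by
  have h : (𝟙ₕ ⊕ₕ κ) ⊕ₕ 𝟙ₕ = (𝟙ₕ ⊕ₕ σₕ) ⨾ₕ (Iₕ 2 ⊕ₕ κ) := by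
    rw [tensor_assoc₁₁, ← swap_cond, id_tensor_comp, ← tensor_id 1 1, tensor_assoc₁₀]
  rw [coAdd_shear, ← comp_assoc, state_slide, comp_assoc, comp_assoc]
  congr 1
  rw [guard, comp_tensor_id, h, comp_assoc, comp_assoc, cond_slide, id_tensor_comp ∇ₕ κ 2]
  simp only [← comp_assoc]
  congr 1
  refine lin_ext fun v i hi => ?_
  interval_cases i <;> simp [tensorFun]

theorem coAdd_guard_add (κ κ' : IHP k 1 0) :
    ∇°ₕ ⨾ₕ (guard κ ⊕ₕ guard κ') ⨾ₕ ∇ₕ = guard (∇°ₕ ⨾ₕ (κ ⊕ₕ κ')) := by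
  have h : ((𝟙ₕ ⊕ₕ ε°ₕ) ⨾ₕ (𝟙ₕ ⊕ₕ Δₕ) ⨾ₕ ((𝟙ₕ ⊕ₕ sₕ) ⊕ₕ 𝟙ₕ) ⨾ₕ (∇ₕ ⊕ₕ 𝟙ₕ)) ⨾ₕ copy₂ ⨾ₕ (∇ₕ ⊕ₕ Iₕ 2)
      = Δₕ ⨾ₕ (𝟙ₕ ⊕ₕ ((𝟙ₕ ⊕ₕ ε°ₕ) ⨾ₕ (𝟙ₕ ⊕ₕ Δₕ) ⨾ₕ ((𝟙ₕ ⊕ₕ sₕ) ⊕ₕ 𝟙ₕ) ⨾ₕ (∇ₕ ⊕ₕ 𝟙ₕ))) := by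
    rw [id_tensor_comp, ← tensor_assoc₀₁, tensor_id, ← comp_assoc Δₕ, state_slide, comp_assoc,
      comp_assoc, comp_assoc (𝟙ₕ ⊕ₕ ε°ₕ)]
    refine congrArg (fun c => (𝟙ₕ ⊕ₕ ε°ₕ) ⨾ₕ c) (lin_ext fun v i hi => ?_)
    interval_cases i <;> simp [tensorFun]
  rw [guard_tensor, comp_assoc, cond_slide, ← comp_assoc copy₂, ← comp_assoc, coAdd_shear, h,
    ← coAdd_shear, guard, comp_assoc, tensor_comp, id_comp]

/-! ### Nonnegativity -/

theorem coCopy_guard (κ : IHP k 1 0) (h : Δₕ ⨾ₕ (κ ⊕ₕ κ) = κ) :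
    Δ°ₕ ⨾ₕ guard κ = (guard κ ⊕ₕ guard κ) ⨾ₕ Δ°ₕ := by
  rw [tensor_split, comp_assoc, guard_coCopy_right, ← comp_assoc, guard_coCopy_left, comp_assoc,
    guard_guard, h]

/-- The condition that a value is nonnegative. -/
def nonneg : IHP k 1 0 := geq ⨾ₕ coZero

local notation "πₕ" => IHP.nonneg (k := k)

theorem coZero_le_nonneg : η°ₕ ≤ πₕ := coZero_le_geq

theorem nonneg_le_delete : πₕ ≤ εₕ := by
  rw [nonneg, ← geq_delete]
  exact comp_mono le_rfl coZero_le_delete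

theorem scalar_nonneg {a : k} (ha : 0 < a) : scalar a ⨾ₕ πₕ = πₕ := by
  have h : scalar a ⨾ₕ Gₕ = Gₕ ⨾ₕ scalar a := of_ordEq (.geq_scalar_pos a ha)
  rw [nonneg, ← comp_assoc, h, comp_assoc, scalar_coZero ha.ne']

/-- Nonnegativity lies between "is zero" and "no condition", and both hold at zero. -/
theorem zero_nonneg : ηₕ ⨾ₕ πₕ = Iₕ 0 := by
  refine le_antisymm ?_ ?_
  · rw [← zero_delete]; exact comp_mono le_rfl nonneg_le_delete
  · rw [← zero_coZero]; exact comp_mono le_rfl coZero_le_nonneg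

theorem copy_coZero_left : Δₕ ⨾ₕ (η°ₕ ⊕ₕ 𝟙ₕ) = η°ₕ ⨾ₕ ηₕ := by
  rw [← copy_coZero, ← swap_cond, ← comp_assoc, copy_comm]

theorem copy_coZero_coZero : Δₕ ⨾ₕ (η°ₕ ⊕ₕ η°ₕ) = η°ₕ := by
  rw [← id_tensor_cond, ← comp_assoc, copy_coZero, comp_assoc, zero_coZero, comp_id]

/-- Dropping one of the two conditions gives one inclusion; duplicating is the lax copy axiom for ≥,
evaluated at zero. -/
theorem copy_nonneg : Δₕ ⨾ₕ (πₕ ⊕ₕ πₕ) = πₕ := by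
  refine le_antisymm ?_ ?_
  · refine le_trans (b := Δₕ ⨾ₕ (εₕ ⊕ₕ πₕ))
      (comp_mono le_rfl (tensor_mono nonneg_le_delete le_rfl)) (le_of_eq ?_)
    rw [tensor_split, ← comp_assoc, copy_delete_left, id_comp]
    exact eq_of_heq (id_zero_tensor _)
  · have h : Gₕ ⨾ₕ Δₕ ≤ Δₕ ⨾ₕ (Gₕ ⊕ₕ Gₕ) := cls_le.2 (.ax (.ordIneq .geq_copy))
    calc πₕ = (Gₕ ⨾ₕ Δₕ) ⨾ₕ (η°ₕ ⊕ₕ η°ₕ) := by rw [comp_assoc, copy_coZero_coZero, nonneg]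
      _ ≤ (Δₕ ⨾ₕ (Gₕ ⊕ₕ Gₕ)) ⨾ₕ (η°ₕ ⊕ₕ η°ₕ) := comp_mono h le_rfl
      _ = _ := by rw [comp_assoc, tensor_comp, nonneg]

theorem tensor_coZero_le_sumZero : η°ₕ ⊕ₕ η°ₕ ≤ αₕ := by
  calc (η°ₕ ⊕ₕ η°ₕ : IHP k 2 0) = (sₕ ⊕ₕ 𝟙ₕ) ⨾ₕ Δ°ₕ ⨾ₕ η°ₕ := by
        rw [coCopy_coZero, tensor_comp, scalar_coZero (by simp), id_comp]
    _ ≤ (sₕ ⊕ₕ 𝟙ₕ) ⨾ₕ Δ°ₕ ⨾ₕ εₕ := comp_mono le_rfl (comp_mono le_rfl coZero_le_delete)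
    _ = _ := sumZero_eq.symm

theorem nonneg_tensor_nonneg_le : πₕ ⊕ₕ πₕ ≤ ∇ₕ ⨾ₕ πₕ := by
  have h : ∇ₕ ⨾ₕ Gₕ = (Gₕ ⊕ₕ Gₕ) ⨾ₕ ∇ₕ := of_ordEq .geq_add
  calc πₕ ⊕ₕ πₕ = (Gₕ ⊕ₕ Gₕ) ⨾ₕ (η°ₕ ⊕ₕ η°ₕ) := by rw [tensor_comp, nonneg]
    _ ≤ (Gₕ ⊕ₕ Gₕ) ⨾ₕ αₕ := comp_mono le_rfl tensor_coZero_le_sumZero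
    _ = _ := by rw [nonneg, sumZero, ← comp_assoc, ← h, comp_assoc]

/-! ### The polars of the axioms for the order -/

local notation "ρₕ" => IHP.guard πₕ
local notation "λₕ" => IHP.guard (sₕ ⨾ₕ πₕ)

theorem guard_sumZero : (ρₕ ⊕ₕ 𝟙ₕ) ⨾ₕ αₕ = (𝟙ₕ ⊕ₕ λₕ) ⨾ₕ αₕ := by
  have h' : ρₕ ⨾ₕ sₕ = sₕ ⨾ₕ λₕ := by rw [scalar_guard, neg_neg_comp]
  rw [sumZero_eq, ← comp_assoc, tensor_comp, h', id_comp, ← comp_assoc (𝟙ₕ ⊕ₕ λₕ), ← slide,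
    comp_tensor_id, comp_assoc, comp_assoc, ← comp_assoc _ Δ°ₕ,
    ← comp_assoc _ Δ°ₕ, guard_coCopy_left, guard_coCopy_right]

theorem guard_nonneg_coZero : ρₕ ⨾ₕ η°ₕ = η°ₕ := by
  have h : Iₕ 0 ⊕ₕ πₕ = πₕ := eq_of_heq (id_zero_tensor _)
  rw [guard, comp_assoc, id_tensor_cond, tensor_split, h, ← comp_assoc, copy_coZero_left,
    comp_assoc, zero_nonneg, comp_id]

theorem guard_coAdd_le : ∇°ₕ ⨾ₕ (ρₕ ⊕ₕ ρₕ) ≤ ρₕ ⨾ₕ ∇°ₕ := by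
  rw [guard_coAdd, guard_tensor]
  exact comp_mono le_rfl (comp_mono le_rfl (tensor_mono le_rfl nonneg_tensor_nonneg_le))

section Ordered

variable [IsStrictOrderedRing k]

theorem geq_add_left : (Gₕ ⊕ₕ 𝟙ₕ) ⨾ₕ ∇ₕ = ∇ₕ ⨾ₕ Gₕ := by
  conv_lhs => rw [← add_comm]
  rw [← comp_assoc, sym_natural, comp_assoc, add_geq, ← comp_assoc, add_comm]

theorem geq_sumZero_eq : (Gₕ ⊕ₕ 𝟙ₕ) ⨾ₕ αₕ = ∇ₕ ⨾ₕ πₕ := by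
  rw [sumZero, ← comp_assoc, geq_add_left, comp_assoc, nonneg]

/-- `x ≥ y` if and only if `x - y` is nonnegative. -/
theorem geq_eq : ∇°ₕ ⨾ₕ (πₕ ⊕ₕ 𝟙ₕ) = Gₕ := by
  rw [← coAdd_bend Gₕ, geq_sumZero_eq, comp_tensor_id, ← comp_assoc, ← coAdd_eq']

theorem leq_coZero : (leq : IHP k 1 1) ⨾ₕ η°ₕ = sₕ ⨾ₕ πₕ := by
  rw [leq_eq, comp_assoc, comp_assoc, scalar_coZero (by simp), nonneg]

theorem scalar_nonneg_of_neg {a : k} (ha : a < 0) : scalar a ⨾ₕ πₕ = sₕ ⨾ₕ πₕ := by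
  have h : a = -1 * -a := by ring
  rw [h, ← scalar_scalar, comp_assoc, scalar_nonneg (neg_pos.2 ha)]

/-- Antisymmetry, compared with zero. -/
theorem copy_nonneg_neg : Δₕ ⨾ₕ (πₕ ⊕ₕ (sₕ ⨾ₕ πₕ)) = η°ₕ := by
  refine le_antisymm ?_ ?_
  · have h : Δₕ ⨾ₕ (Gₕ ⊕ₕ leq) ⨾ₕ Δ°ₕ ≤ 𝟙ₕ := cls_le.2 (.ax (.ordIneq .antisymm))
    calc Δₕ ⨾ₕ (πₕ ⊕ₕ (sₕ ⨾ₕ πₕ)) = (Δₕ ⨾ₕ (Gₕ ⊕ₕ leq) ⨾ₕ Δ°ₕ) ⨾ₕ η°ₕ := by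
          rw [comp_assoc, comp_assoc, coCopy_coZero, tensor_comp, leq_coZero, nonneg]
      _ ≤ 𝟙ₕ ⨾ₕ η°ₕ := comp_mono h le_rfl
      _ = η°ₕ := id_comp _
  · calc η°ₕ = Δₕ ⨾ₕ (η°ₕ ⊕ₕ (sₕ ⨾ₕ η°ₕ)) := by
          rw [scalar_coZero (by simp), copy_coZero_coZero]
      _ ≤ _ := comp_mono le_rfl (tensor_mono coZero_le_nonneg (comp_mono le_rfl coZero_le_nonneg))

/-- Directedness: the left side unfolds by `geq_eq` to ≤ ⨾ ≥ up to a sign, compared with zero. -/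
theorem coAdd_nonneg_neg : ∇°ₕ ⨾ₕ (πₕ ⊕ₕ (sₕ ⨾ₕ πₕ)) = εₕ := by
  have h : (leq : IHP k 1 1) ⨾ₕ Gₕ = εₕ ⨾ₕ ε°ₕ := of_ordEq .direction
  have h' : Gₕ ⨾ₕ sₕ = sₕ ⨾ₕ leq := by rw [leq_eq, neg_neg_comp]
  calc ∇°ₕ ⨾ₕ (πₕ ⊕ₕ (sₕ ⨾ₕ πₕ)) = ∇°ₕ ⨾ₕ (πₕ ⊕ₕ 𝟙ₕ) ⨾ₕ (sₕ ⨾ₕ πₕ) := by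
        rw [tensor_split]
        exact congrArg (fun c => ∇°ₕ ⨾ₕ (πₕ ⊕ₕ 𝟙ₕ) ⨾ₕ c) (eq_of_heq (id_zero_tensor _))
    _ = (Gₕ ⨾ₕ sₕ) ⨾ₕ Gₕ ⨾ₕ η°ₕ := by rw [← comp_assoc, geq_eq, comp_assoc, nonneg]
    _ = sₕ ⨾ₕ (leq ⨾ₕ Gₕ) ⨾ₕ η°ₕ := by rw [h', comp_assoc, comp_assoc]
    _ = εₕ := by rw [h, comp_assoc, coDelete_coZero, comp_id, scalar_delete]

/-- The polar of antisymmetry, a consequence of directedness; conversely `guard_neg_guard`, the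
polar of directedness, rests on antisymmetry. -/
theorem id_le_coAdd_guard : 𝟙ₕ ≤ ∇°ₕ ⨾ₕ (ρₕ ⊕ₕ λₕ) ⨾ₕ ∇ₕ := by
  rw [coAdd_guard_add, coAdd_nonneg_neg, guard, copy_delete_right]

theorem guard_neg_guard : λₕ ⨾ₕ ρₕ = η°ₕ ⨾ₕ ηₕ := by
  rw [guard_guard, copy_nonneg_neg, guard, copy_coZero]

theorem coAdd_guard_bend : ∇°ₕ ⨾ₕ (ρₕ ⊕ₕ 𝟙ₕ) ⨾ₕ (εₕ ⊕ₕ 𝟙ₕ) = Gₕ := by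
  rw [tensor_comp, guard_delete, id_comp, geq_eq]

end Ordered

/-! ### The polar of the spider -/

local notation "π₂ₕ" => (πₕ ⊕ₕ πₕ)
local notation "π₄ₕ" => (π₂ₕ ⊕ₕ π₂ₕ)

/-- `(x, t) ↦ (t, x - t)` -/
def subLeft : IHP k 2 2 :=
  (𝟙ₕ ⊕ₕ Δₕ) ⨾ₕ ((𝟙ₕ ⊕ₕ sₕ) ⊕ₕ 𝟙ₕ) ⨾ₕ (∇ₕ ⊕ₕ 𝟙ₕ) ⨾ₕ σₕ

theorem IsLin.congr {n m : ℕ} {f : IHP k n m} {F G : (ℕ → k) → ℕ → k} (hf : IsLin f F)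
    (h : ∀ v, ∀ i < m, F v i = G v i) : IsLin f G where
  shifts b := (hf.shifts b).congr fun v i hi => by
    by_cases hb : i < b
    · simp [liftFun, hb]
    · simp [liftFun, hb, h _ (i - b) (by omega)]
  zeros := hf.zeros

instance : IsLin (subLeft (k := k)) fun v i => if i = 0 then v 1 else v 0 - v 1 :=
  IsLin.congr (f := (𝟙ₕ ⊕ₕ Δₕ) ⨾ₕ ((𝟙ₕ ⊕ₕ sₕ) ⊕ₕ 𝟙ₕ) ⨾ₕ (∇ₕ ⊕ₕ 𝟙ₕ) ⨾ₕ σₕ) inferInstance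
    fun v i hi => by interval_cases i <;> simp [tensorFun]; ring

theorem cond_tensor_wire {n : ℕ} (κ : IHP k 1 0) :
    (Iₕ n ⊕ₕ κ) ⊕ₕ 𝟙ₕ = (Iₕ n ⊕ₕ σₕ) ⨾ₕ (Iₕ (n + 1) ⊕ₕ κ) := by
  rw [tensor_assoc₁₁, ← swap_cond, id_tensor_comp, ← tensor_id n 1, tensor_assoc₁₀]

theorem cond₂_tensor_wire {n : ℕ} (κ : IHP k 2 0) :
    (Iₕ n ⊕ₕ κ) ⊕ₕ 𝟙ₕ = (Iₕ n ⊕ₕ ((𝟙ₕ ⊕ₕ σₕ) ⨾ₕ (σₕ ⊕ₕ 𝟙ₕ))) ⨾ₕ (Iₕ (n + 1) ⊕ₕ κ) := by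
  have h : κ ⊕ₕ 𝟙ₕ = ((𝟙ₕ ⊕ₕ σₕ) ⨾ₕ (σₕ ⊕ₕ 𝟙ₕ)) ⨾ₕ (𝟙ₕ ⊕ₕ κ) := by
    have := sym_natural κ 𝟙ₕ
    rw [sym_zero_one, sym_two_one] at this
    exact (comp_id _).symm.trans this
  rw [tensor_assoc₁₁, h, id_tensor_comp, ← tensor_id n 1, tensor_assoc₂₀]

theorem cond₂_tensor_wire_comp {n m : ℕ} (κ : IHP k 2 0) (c : IHP k (n + 1) m) :
    (Iₕ n ⊕ₕ ((𝟙ₕ ⊕ₕ σₕ) ⨾ₕ (σₕ ⊕ₕ 𝟙ₕ))) ⨾ₕ (Iₕ (n + 1) ⊕ₕ κ) ⨾ₕ c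
      = ((Iₕ n ⊕ₕ κ) ⊕ₕ 𝟙ₕ) ⨾ₕ c := by
  rw [cond₂_tensor_wire, comp_assoc]

theorem state_tensor_wire {n : ℕ} (c : IHP k 0 1) :
    (Iₕ n ⊕ₕ c) ⊕ₕ 𝟙ₕ = (Iₕ (n + 1) ⊕ₕ c) ⨾ₕ (Iₕ n ⊕ₕ σₕ) := by
  rw [tensor_assoc₁₁, ← swap_state, id_tensor_comp, ← tensor_id n 1, tensor_assoc₀₁]

theorem cond_comm (κ κ' : IHP k 1 0) : σₕ ⨾ₕ (κ ⊕ₕ κ') = κ' ⊕ₕ κ := by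
  rw [← id_tensor_cond, ← comp_assoc, swap_cond, tensor_split κ' κ]
  exact congrArg _ (eq_of_heq (id_zero_tensor κ)).symm

theorem nonneg_swap₁ : (𝟙ₕ ⊕ₕ (σₕ ⊕ₕ 𝟙ₕ)) ⨾ₕ π₄ₕ = π₄ₕ := by
  have h : π₄ₕ = (πₕ ⊕ₕ π₂ₕ) ⊕ₕ πₕ := by
    rw [← tensor_assoc₁₀, ← tensor_assoc₁₀]
  rw [h, ← tensor_assoc₁₁, tensor_comp, tensor_comp, id_comp, cond_comm]

theorem nonneg_swap₂ : (Iₕ 2 ⊕ₕ σₕ) ⨾ₕ π₄ₕ = π₄ₕ := by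
  rw [tensor_comp, id_comp, cond_comm]

theorem nonneg_slide {n : ℕ} (f : IHP k n 2) :
    (Iₕ n ⊕ₕ π₂ₕ) ⨾ₕ f ⨾ₕ π₂ₕ = (f ⊕ₕ Iₕ 2) ⨾ₕ π₄ₕ := by
  rw [← comp_assoc, cond_slide, comp_assoc, id_tensor_cond]

/-- A value required to be zero may be added to the argument of any other condition. -/
theorem coZero_absorb (κ : IHP k 1 0) :
    (Δₕ ⊕ₕ 𝟙ₕ) ⨾ₕ (𝟙ₕ ⊕ₕ ∇ₕ) ⨾ₕ (η°ₕ ⊕ₕ κ) = η°ₕ ⊕ₕ κ := by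
  have h : Iₕ 0 ⊕ₕ κ = κ := eq_of_heq (id_zero_tensor κ)
  have h' : Iₕ 0 ⊕ₕ (∇ₕ ⨾ₕ κ) = ∇ₕ ⨾ₕ κ := eq_of_heq (id_zero_tensor _)
  rw [tensor_comp, id_comp, tensor_split η°ₕ (∇ₕ ⨾ₕ κ), h', id_two, ← tensor_assoc₁₁,
    ← comp_assoc, tensor_comp, id_comp, copy_coZero_left, comp_tensor_id, comp_assoc, ← comp_assoc _ ∇ₕ,
    zero_add, id_comp, tensor_split η°ₕ κ, h]

theorem nonneg_slide₂ {n : ℕ} (f : IHP k n 4) :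
    (Iₕ n ⊕ₕ π₂ₕ) ⨾ₕ f ⨾ₕ (Iₕ 2 ⊕ₕ π₂ₕ) = (f ⊕ₕ Iₕ 2) ⨾ₕ (Iₕ 2 ⊕ₕ π₄ₕ) := by
  rw [← comp_assoc, cond_slide, comp_assoc, ← id_tensor_cond (n := 2) π₂ₕ π₂ₕ, id_tensor_comp,
    ← tensor_assoc₂₀, tensor_id]

theorem coDelete_coDelete : (Iₕ 2 ⊕ₕ ε°ₕ) ⨾ₕ (Iₕ 3 ⊕ₕ ε°ₕ) = Iₕ 2 ⊕ₕ (ε°ₕ ⊕ₕ ε°ₕ) := by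
  rw [← tensor_eq_comp, tensor_assoc₀₁]

/-- Here v 2 is the bound second summand of the total v 0 + v 1. Only the function denoted by `L` is
prescribed, because `lin_ext` sees nothing else; `spider_polar` can therefore supply a composite to
which interpolation applies. -/
theorem guard_add_coAdd_guard {L : IHP k 3 6} {F : (ℕ → k) → ℕ → k} [IsLin L F]
    (h₀ : ∀ v, F v 0 = v 0 + v 1 - v 2) (h₁ : ∀ v, F v 1 = v 2)
    (h₂ : ∀ v, F v 2 = v 0 + v 1 - v 2) (h₃ : ∀ v, F v 3 = v 2) (h₄ : ∀ v, F v 4 = v 0)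
    (h₅ : ∀ v, F v 5 = v 1) :
    (ρₕ ⊕ₕ ρₕ) ⨾ₕ ∇ₕ ⨾ₕ ∇°ₕ ⨾ₕ (ρₕ ⊕ₕ ρₕ) = (Iₕ 2 ⊕ₕ ε°ₕ) ⨾ₕ L ⨾ₕ (Iₕ 2 ⊕ₕ π₄ₕ) := by
  have e : L = (copy₂ ⊕ₕ 𝟙ₕ) ⨾ₕ (Iₕ 2 ⊕ₕ ((𝟙ₕ ⊕ₕ σₕ) ⨾ₕ (σₕ ⊕ₕ 𝟙ₕ))) ⨾ₕ (((∇ₕ ⊕ₕ 𝟙ₕ) ⨾ₕ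
      ((𝟙ₕ ⊕ₕ Δₕ) ⨾ₕ ((𝟙ₕ ⊕ₕ sₕ) ⊕ₕ 𝟙ₕ) ⨾ₕ (∇ₕ ⊕ₕ 𝟙ₕ)) ⨾ₕ copy₂) ⊕ₕ Iₕ 2) := by
    refine lin_ext fun v i hi => ?_
    interval_cases i <;> simp [tensorFun, h₀, h₁, h₂, h₃, h₄, h₅] <;> ring
  rw [e, comp_assoc, comp_assoc, ← nonneg_slide₂, cond₂_tensor_wire_comp, ← comp_assoc (copy₂ ⊕ₕ 𝟙ₕ), ← comp_tensor_id, ← comp_assoc (Iₕ 2 ⊕ₕ ε°ₕ),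
    ← state_slide, guard_tensor, coAdd_shear]
  simp only [comp_assoc]
  rw [← comp_assoc ∇ₕ, state_slide]
  simp only [comp_assoc]

theorem coAdd_guard_guard : ∇°ₕ ⨾ₕ (ρₕ ⊕ₕ ρₕ) = (𝟙ₕ ⊕ₕ ε°ₕ) ⨾ₕ
    (((𝟙ₕ ⊕ₕ Δₕ) ⨾ₕ ((𝟙ₕ ⊕ₕ sₕ) ⊕ₕ 𝟙ₕ) ⨾ₕ (∇ₕ ⊕ₕ 𝟙ₕ)) ⨾ₕ copy₂) ⨾ₕ (Iₕ 2 ⊕ₕ π₂ₕ) := by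
  rw [guard_tensor, coAdd_shear]
  simp only [comp_assoc]

/-- The bound variables v 2 and v 3 are the second parts of the two inputs. Both are moved to the
front and all four conditions to the end; the linear maps in between agree by `lin_ext`. -/
theorem coAdd_guard_middle_swap_add {L : IHP k 4 6} {F : (ℕ → k) → ℕ → k} [IsLin L F]
    (h₀ : ∀ v, F v 0 = v 0 + v 1 - v 2 - v 3) (h₁ : ∀ v, F v 1 = v 2 + v 3)
    (h₂ : ∀ v, F v 2 = v 1 - v 3) (h₃ : ∀ v, F v 3 = v 3) (h₄ : ∀ v, F v 4 = v 0 - v 2)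
    (h₅ : ∀ v, F v 5 = v 2) :
    (∇°ₕ ⊕ₕ ∇°ₕ) ⨾ₕ (ρₕ ⊕ₕ (ρₕ ⊕ₕ (ρₕ ⊕ₕ ρₕ))) ⨾ₕ (𝟙ₕ ⊕ₕ (σₕ ⊕ₕ 𝟙ₕ)) ⨾ₕ (∇ₕ ⊕ₕ ∇ₕ)
      = (Iₕ 2 ⊕ₕ (ε°ₕ ⊕ₕ ε°ₕ)) ⨾ₕ L ⨾ₕ (Iₕ 2 ⊕ₕ π₄ₕ) := by
  have e : ∀ B : IHP k 2 4, ((𝟙ₕ ⊕ₕ ε°ₕ) ⨾ₕ B ⨾ₕ (Iₕ 2 ⊕ₕ π₂ₕ)) ⊕ₕ 𝟙ₕ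
      = (Iₕ 2 ⊕ₕ ε°ₕ) ⨾ₕ (𝟙ₕ ⊕ₕ σₕ) ⨾ₕ (B ⊕ₕ 𝟙ₕ) ⨾ₕ
        (Iₕ 2 ⊕ₕ ((𝟙ₕ ⊕ₕ σₕ) ⨾ₕ (σₕ ⊕ₕ 𝟙ₕ))) ⨾ₕ (Iₕ 3 ⊕ₕ π₂ₕ) := fun B => by
    rw [comp_tensor_id, comp_tensor_id, state_tensor_wire, cond₂_tensor_wire, comp_assoc]
  have e' : ∀ B : IHP k 2 4, Iₕ 2 ⊕ₕ ((𝟙ₕ ⊕ₕ ε°ₕ) ⨾ₕ B ⨾ₕ (Iₕ 2 ⊕ₕ π₂ₕ))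
      = (Iₕ 3 ⊕ₕ ε°ₕ) ⨾ₕ (Iₕ 2 ⊕ₕ B) ⨾ₕ (Iₕ 4 ⊕ₕ π₂ₕ) := fun B => by
    rw [id_tensor_comp, id_tensor_comp, ← tensor_assoc₀₁, ← tensor_assoc₂₀, tensor_id, tensor_id]
  have e'' : (ρₕ ⊕ₕ (ρₕ ⊕ₕ (ρₕ ⊕ₕ ρₕ))) = (ρₕ ⊕ₕ ρₕ) ⊕ₕ (ρₕ ⊕ₕ ρₕ) := (tensor_assoc₂₂ _ _ _).symm
  have e₃ : ∀ {n} (f : IHP k n 5) (g : IHP k 4 4), f ⨾ₕ (Iₕ 3 ⊕ₕ π₂ₕ) ⨾ₕ (Iₕ 3 ⊕ₕ ε°ₕ) ⨾ₕ g ⨾ₕ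
      (Iₕ 2 ⊕ₕ π₂ₕ) = (Iₕ n ⊕ₕ ε°ₕ) ⨾ₕ (f ⊕ₕ 𝟙ₕ) ⨾ₕ
        (Iₕ 3 ⊕ₕ ((𝟙ₕ ⊕ₕ σₕ) ⨾ₕ (σₕ ⊕ₕ 𝟙ₕ))) ⨾ₕ (g ⊕ₕ Iₕ 2) ⨾ₕ (Iₕ 2 ⊕ₕ π₄ₕ) := fun f g => by
    rw [← nonneg_slide₂, cond₂_tensor_wire_comp,
      ← comp_assoc (f ⊕ₕ 𝟙ₕ), ← comp_tensor_id,
      ← comp_assoc _ ((f ⨾ₕ (Iₕ 3 ⊕ₕ π₂ₕ)) ⊕ₕ 𝟙ₕ), ← state_slide]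
    simp only [comp_assoc]
  have e₄ : ∀ B : IHP k 2 4, (((𝟙ₕ ⊕ₕ ε°ₕ) ⨾ₕ B ⨾ₕ (Iₕ 2 ⊕ₕ π₂ₕ)) ⊕ₕ
      ((𝟙ₕ ⊕ₕ ε°ₕ) ⨾ₕ B ⨾ₕ (Iₕ 2 ⊕ₕ π₂ₕ))) ⨾ₕ (𝟙ₕ ⊕ₕ (σₕ ⊕ₕ 𝟙ₕ)) ⨾ₕ (∇ₕ ⊕ₕ ∇ₕ)
      = (Iₕ 2 ⊕ₕ (ε°ₕ ⊕ₕ ε°ₕ)) ⨾ₕ ((((𝟙ₕ ⊕ₕ σₕ) ⨾ₕ (B ⊕ₕ 𝟙ₕ) ⨾ₕ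
        (Iₕ 2 ⊕ₕ ((𝟙ₕ ⊕ₕ σₕ) ⨾ₕ (σₕ ⊕ₕ 𝟙ₕ)))) ⊕ₕ 𝟙ₕ) ⨾ₕ
        (Iₕ 3 ⊕ₕ ((𝟙ₕ ⊕ₕ σₕ) ⨾ₕ (σₕ ⊕ₕ 𝟙ₕ))) ⨾ₕ (((Iₕ 2 ⊕ₕ B) ⨾ₕ (((𝟙ₕ ⊕ₕ (σₕ ⊕ₕ 𝟙ₕ)) ⨾ₕ
        (∇ₕ ⊕ₕ ∇ₕ)) ⊕ₕ Iₕ 2)) ⊕ₕ Iₕ 2)) ⨾ₕ (Iₕ 2 ⊕ₕ π₄ₕ) := fun B => by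
    have h := e₃ ((𝟙ₕ ⊕ₕ σₕ) ⨾ₕ (B ⊕ₕ 𝟙ₕ) ⨾ₕ (Iₕ 2 ⊕ₕ ((𝟙ₕ ⊕ₕ σₕ) ⨾ₕ (σₕ ⊕ₕ 𝟙ₕ))))
      ((Iₕ 2 ⊕ₕ B) ⨾ₕ (((𝟙ₕ ⊕ₕ (σₕ ⊕ₕ 𝟙ₕ)) ⨾ₕ (∇ₕ ⊕ₕ ∇ₕ)) ⊕ₕ Iₕ 2))
    rw [comp_assoc (Iₕ 2 ⊕ₕ B), ← cond_slide] at h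
    rw [tensor_split ((𝟙ₕ ⊕ₕ ε°ₕ) ⨾ₕ B ⨾ₕ (Iₕ 2 ⊕ₕ π₂ₕ)), e, e', ← coDelete_coDelete]
    simp only [comp_assoc] at h ⊢
    rw [h]
  rw [e'', ← comp_assoc (∇°ₕ ⊕ₕ ∇°ₕ), tensor_comp, coAdd_guard_guard, e₄]
  congr 2
  refine lin_ext fun v i hi => ?_
  interval_cases i <;> simp [tensorFun, h₀, h₁, h₂, h₃, h₄, h₅] <;> ring

/-- The invertible substitution (s, t) ↦ (s + t, t) of bound variables: conjugated by a crossing, it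
is an instance of `exists_translate`. -/
theorem coDelete_coDelete_add :
    (ε°ₕ ⊕ₕ ε°ₕ) ⨾ₕ (𝟙ₕ ⊕ₕ Δₕ) ⨾ₕ (∇ₕ ⊕ₕ 𝟙ₕ) = ε°ₕ ⊕ₕ ε°ₕ := by
  have h : (𝟙ₕ ⊕ₕ Δₕ) ⨾ₕ (∇ₕ ⊕ₕ 𝟙ₕ) = σₕ ⨾ₕ ((Δₕ ⊕ₕ 𝟙ₕ) ⨾ₕ (𝟙ₕ ⊕ₕ ∇ₕ)) ⨾ₕ σₕ := by
    refine lin_ext fun v i hi => ?_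
    interval_cases i <;> simp [tensorFun]; ring
  have h₁ : (ε°ₕ ⊕ₕ ε°ₕ) ⨾ₕ σₕ = ε°ₕ ⊕ₕ ε°ₕ := by
    rw [← coDelete_coAdd, comp_assoc, coAdd_comm]
  have h₂ : (ε°ₕ ⊕ₕ ε°ₕ) ⨾ₕ (Δₕ ⊕ₕ 𝟙ₕ) ⨾ₕ (𝟙ₕ ⊕ₕ ∇ₕ) = ε°ₕ ⊕ₕ ε°ₕ := by
    rw [tensor_eq_comp, comp_assoc, exists_translate Δₕ copy_delete_right]
  rw [h, ← comp_assoc, h₁, ← comp_assoc, h₂, h₁]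

/-- The outputs and the bound variables of `interpolation` in terms of two sums and a summand. -/
theorem exists_interpolation_inputs : ∃ (L : IHP k 3 5) (F : (ℕ → k) → ℕ → k), IsLin L F ∧
    ∀ v, F v 0 = v 0 + v 1 - v 2 ∧ F v 1 = v 2 ∧ F v 2 = v 2 ∧ F v 3 = v 1 ∧
      F v 4 = v 0 - v 2 := by
  refine ⟨(𝟙ₕ ⊕ₕ σₕ) ⨾ₕ (subLeft ⊕ₕ 𝟙ₕ) ⨾ₕ (Δₕ ⊕ₕ copy₂) ⨾ₕ (Iₕ 2 ⊕ₕ (∇ₕ ⊕ₕ Iₕ 2)) ⨾ₕ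
    (((𝟙ₕ ⊕ₕ σₕ) ⨾ₕ (σₕ ⊕ₕ 𝟙ₕ)) ⊕ₕ σₕ), _, inferInstance, fun v => ?_⟩
  simp [tensorFun]
  ring

/-! ### From the spider axiom to Riesz interpolation and refinement -/

section Ordered

variable [IsStrictOrderedRing k]

/-- Frobenius writes Δ° as a copy of the second input followed by a cap, and ≥ against a cap is
nonnegativity of the difference. -/
theorem geq_coCopy : (Gₕ ⊕ₕ 𝟙ₕ) ⨾ₕ Δ°ₕ = subLeft ⨾ₕ (𝟙ₕ ⊕ₕ πₕ) := by
  have h : Δ°ₕ = (𝟙ₕ ⊕ₕ Δₕ) ⨾ₕ ((Δ°ₕ ⨾ₕ εₕ) ⊕ₕ 𝟙ₕ) := by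
    rw [comp_tensor_id, ← comp_assoc, ← copy_frobenius_right, comp_assoc, copy_delete_left,
      comp_id]
  have h' : (Gₕ ⊕ₕ 𝟙ₕ) ⨾ₕ Δ°ₕ ⨾ₕ εₕ = (𝟙ₕ ⊕ₕ sₕ) ⨾ₕ ∇ₕ ⨾ₕ πₕ := by
    rw [cap_eq_right, ← comp_assoc, slide, comp_assoc, geq_sumZero_eq]
  rw [h, ← comp_assoc, slide, comp_assoc, id_two, ← tensor_assoc₁₁, tensor_comp, h', id_comp,
    comp_tensor_id, comp_tensor_id, ← swap_cond, subLeft]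
  simp only [comp_assoc]

theorem geq_exists : Gₕ = (𝟙ₕ ⊕ₕ ε°ₕ) ⨾ₕ subLeft ⨾ₕ (𝟙ₕ ⊕ₕ πₕ) := by
  rw [← geq_eq, coAdd_shear, ← swap_cond, subLeft]
  simp only [comp_assoc]

theorem geq_geq_coCopy : (Gₕ ⊕ₕ Gₕ) ⨾ₕ Δ°ₕ
    = (Iₕ 2 ⊕ₕ ε°ₕ) ⨾ₕ ((𝟙ₕ ⊕ₕ subLeft) ⨾ₕ (subLeft ⊕ₕ 𝟙ₕ)) ⨾ₕ (𝟙ₕ ⊕ₕ π₂ₕ) := by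
  have h : 𝟙ₕ ⊕ₕ Gₕ = (Iₕ 2 ⊕ₕ ε°ₕ) ⨾ₕ (𝟙ₕ ⊕ₕ subLeft) ⨾ₕ (Iₕ 2 ⊕ₕ πₕ) := by
    conv_lhs => rw [geq_exists]
    rw [id_tensor_comp, id_tensor_comp, ← tensor_assoc₀₁, ← tensor_assoc₁₀, tensor_id]
  have h' : (Iₕ 2 ⊕ₕ πₕ) ⨾ₕ (𝟙ₕ ⊕ₕ πₕ) = 𝟙ₕ ⊕ₕ π₂ₕ := by
    rw [← id_tensor_cond, id_tensor_comp, ← tensor_assoc₁₀, tensor_id]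
  rw [tensor_split', comp_assoc, geq_coCopy, h, comp_assoc, comp_assoc, comp_assoc,
    ← comp_assoc (Iₕ 2 ⊕ₕ πₕ) subLeft, cond_slide subLeft πₕ, comp_assoc _ (Iₕ 2 ⊕ₕ πₕ), h']

/-- Let x and y dominate t with t + b = 0. Adding this zero to x − t turns its condition into x + b
≥ 0 (`coZero_absorb`); then t survives only in y ≥ t and is eliminated by `geq_sumZero_eq`. -/
theorem geq_coCopy_sumZero : (((Gₕ ⊕ₕ Gₕ) ⨾ₕ Δ°ₕ) ⊕ₕ 𝟙ₕ) ⨾ₕ αₕ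
    = ((σₕ ⊕ₕ 𝟙ₕ) ⨾ₕ (Iₕ 2 ⊕ₕ Δₕ) ⨾ₕ (𝟙ₕ ⊕ₕ (σₕ ⊕ₕ 𝟙ₕ)) ⨾ₕ (∇ₕ ⊕ₕ ∇ₕ)) ⨾ₕ (πₕ ⊕ₕ πₕ) := by
  have h₁ : (Iₕ 2 ⊕ₕ πₕ) ⨾ₕ αₕ = (∇ₕ ⊕ₕ 𝟙ₕ) ⨾ₕ (Δₕ ⊕ₕ 𝟙ₕ) ⨾ₕ (𝟙ₕ ⊕ₕ ∇ₕ) ⨾ₕ (η°ₕ ⊕ₕ πₕ) := by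
    rw [coZero_absorb, sumZero, ← comp_assoc, cond_slide, comp_assoc, id_tensor_cond]
  have h₂ : (subLeft ⊕ₕ 𝟙ₕ) ⨾ₕ (𝟙ₕ ⊕ₕ σₕ) ⨾ₕ (∇ₕ ⊕ₕ 𝟙ₕ) ⨾ₕ (Δₕ ⊕ₕ 𝟙ₕ) ⨾ₕ (𝟙ₕ ⊕ₕ ∇ₕ)
      = (σₕ ⊕ₕ 𝟙ₕ) ⨾ₕ (Iₕ 2 ⊕ₕ Δₕ) ⨾ₕ (𝟙ₕ ⊕ₕ (σₕ ⊕ₕ 𝟙ₕ)) ⨾ₕ (∇ₕ ⊕ₕ ∇ₕ) := by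
    refine lin_ext fun v i hi => ?_
    interval_cases i <;> simp [tensorFun]; ring
  have h₃ : (((𝟙ₕ ⊕ₕ Gₕ) ⊕ₕ 𝟙ₕ)) ⨾ₕ (σₕ ⊕ₕ 𝟙ₕ) = (σₕ ⊕ₕ 𝟙ₕ) ⨾ₕ (Gₕ ⊕ₕ Iₕ 2) := by
    rw [id_two, ← tensor_assoc₁₁, tensor_comp, tensor_comp, sym_natural]
  have h₄ : (Gₕ ⊕ₕ Iₕ 2) ⨾ₕ (Iₕ 2 ⊕ₕ Δₕ) = (Iₕ 2 ⊕ₕ Δₕ) ⨾ₕ (Gₕ ⊕ₕ Iₕ 3) := by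
    have e : Iₕ 2 ⊕ₕ Δₕ = 𝟙ₕ ⊕ₕ (𝟙ₕ ⊕ₕ Δₕ) := by rw [← tensor_assoc₁₂, tensor_id]
    rw [e, slide]
  have h₅ : (Gₕ ⊕ₕ Iₕ 3) ⨾ₕ (𝟙ₕ ⊕ₕ (σₕ ⊕ₕ 𝟙ₕ)) = (𝟙ₕ ⊕ₕ (σₕ ⊕ₕ 𝟙ₕ)) ⨾ₕ ((Gₕ ⊕ₕ 𝟙ₕ) ⊕ₕ Iₕ 2) := by
    rw [slide, tensor_assoc₂₂, tensor_id]
  have h₆ : ((Gₕ ⊕ₕ 𝟙ₕ) ⊕ₕ Iₕ 2) ⨾ₕ (∇ₕ ⊕ₕ ∇ₕ) ⨾ₕ (η°ₕ ⊕ₕ πₕ) = (∇ₕ ⊕ₕ ∇ₕ) ⨾ₕ π₂ₕ := by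
    rw [tensor_comp, tensor_comp, tensor_comp, id_comp, ← sumZero, geq_sumZero_eq]
  calc _ = ((𝟙ₕ ⊕ₕ Gₕ) ⊕ₕ 𝟙ₕ) ⨾ₕ (subLeft ⊕ₕ 𝟙ₕ) ⨾ₕ (𝟙ₕ ⊕ₕ σₕ) ⨾ₕ (Iₕ 2 ⊕ₕ πₕ) ⨾ₕ αₕ := by
        rw [tensor_split' Gₕ Gₕ, comp_assoc, geq_coCopy, comp_tensor_id, comp_tensor_id subLeft,
          cond_tensor_wire, comp_assoc, comp_assoc, comp_assoc]
    _ = ((𝟙ₕ ⊕ₕ Gₕ) ⊕ₕ 𝟙ₕ) ⨾ₕ ((subLeft ⊕ₕ 𝟙ₕ) ⨾ₕ (𝟙ₕ ⊕ₕ σₕ) ⨾ₕ (∇ₕ ⊕ₕ 𝟙ₕ) ⨾ₕ (Δₕ ⊕ₕ 𝟙ₕ) ⨾ₕ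
          (𝟙ₕ ⊕ₕ ∇ₕ)) ⨾ₕ (η°ₕ ⊕ₕ πₕ) := by
        rw [h₁]; simp only [comp_assoc]
    _ = (σₕ ⊕ₕ 𝟙ₕ) ⨾ₕ (Iₕ 2 ⊕ₕ Δₕ) ⨾ₕ (𝟙ₕ ⊕ₕ (σₕ ⊕ₕ 𝟙ₕ)) ⨾ₕ ((Gₕ ⊕ₕ 𝟙ₕ) ⊕ₕ Iₕ 2) ⨾ₕ (∇ₕ ⊕ₕ ∇ₕ) ⨾ₕ
          (η°ₕ ⊕ₕ πₕ) := by
        rw [h₂]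
        simp only [comp_assoc]
        rw [← comp_assoc ((𝟙ₕ ⊕ₕ Gₕ) ⊕ₕ 𝟙ₕ), h₃, comp_assoc, ← comp_assoc (Gₕ ⊕ₕ Iₕ 2), h₄,
          comp_assoc, ← comp_assoc (Gₕ ⊕ₕ Iₕ 3), h₅, comp_assoc]
    _ = _ := by rw [h₆]; simp only [comp_assoc]

theorem geq_copy_sumZero : ((Δₕ ⨾ₕ (Gₕ ⊕ₕ πₕ)) ⊕ₕ 𝟙ₕ) ⨾ₕ αₕ
    = ((Δₕ ⊕ₕ 𝟙ₕ) ⨾ₕ (𝟙ₕ ⊕ₕ σₕ) ⨾ₕ (∇ₕ ⊕ₕ 𝟙ₕ)) ⨾ₕ (πₕ ⊕ₕ πₕ) := by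
  have h : Gₕ ⊕ₕ πₕ = (𝟙ₕ ⊕ₕ πₕ) ⨾ₕ Gₕ := by rw [tensor_split', tensor_id_zero]
  have h' : (Iₕ 2 ⊕ₕ πₕ) ⨾ₕ ∇ₕ ⨾ₕ πₕ = (∇ₕ ⊕ₕ 𝟙ₕ) ⨾ₕ π₂ₕ := by
    rw [← comp_assoc, cond_slide, comp_assoc, id_tensor_cond]
  rw [h, comp_tensor_id, comp_tensor_id, comp_assoc, comp_assoc, geq_sumZero_eq, cond_tensor_wire,
    comp_assoc, h']
  simp only [comp_assoc]

theorem interpolation_left : (((copy₂ ⨾ₕ (Iₕ 2 ⊕ₕ π₂ₕ)) ⨾ₕ (Gₕ ⊕ₕ Gₕ) ⨾ₕ Δ°ₕ) ⊕ₕ 𝟙ₕ) ⨾ₕ αₕ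
    = (((copy₂ ⊕ₕ 𝟙ₕ) ⨾ₕ (Iₕ 2 ⊕ₕ ((𝟙ₕ ⊕ₕ σₕ) ⨾ₕ (σₕ ⊕ₕ 𝟙ₕ)))) ⨾ₕ
      (((σₕ ⊕ₕ 𝟙ₕ) ⨾ₕ (Iₕ 2 ⊕ₕ Δₕ) ⨾ₕ (𝟙ₕ ⊕ₕ (σₕ ⊕ₕ 𝟙ₕ)) ⨾ₕ (∇ₕ ⊕ₕ ∇ₕ)) ⊕ₕ Iₕ 2)) ⨾ₕ π₄ₕ := by
  rw [comp_tensor_id (copy₂ ⨾ₕ (Iₕ 2 ⊕ₕ π₂ₕ)) _ 1, comp_assoc, geq_coCopy_sumZero,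
    comp_tensor_id copy₂, comp_assoc, cond₂_tensor_wire, comp_assoc, nonneg_slide]
  simp only [comp_assoc]

theorem interpolation_right : ((((Gₕ ⊕ₕ Gₕ) ⨾ₕ Δ°ₕ) ⨾ₕ Δₕ ⨾ₕ (Gₕ ⊕ₕ πₕ)) ⊕ₕ 𝟙ₕ) ⨾ₕ αₕ
    = (Iₕ 3 ⊕ₕ ε°ₕ) ⨾ₕ
      ((Iₕ 2 ⊕ₕ σₕ) ⨾ₕ (((𝟙ₕ ⊕ₕ subLeft) ⨾ₕ (subLeft ⊕ₕ 𝟙ₕ)) ⊕ₕ 𝟙ₕ) ⨾ₕ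
        (𝟙ₕ ⊕ₕ ((𝟙ₕ ⊕ₕ σₕ) ⨾ₕ (σₕ ⊕ₕ 𝟙ₕ))) ⨾ₕ
        (((Δₕ ⊕ₕ 𝟙ₕ) ⨾ₕ (𝟙ₕ ⊕ₕ σₕ) ⨾ₕ (∇ₕ ⊕ₕ 𝟙ₕ)) ⊕ₕ Iₕ 2)) ⨾ₕ π₄ₕ := by
  rw [comp_tensor_id ((Gₕ ⊕ₕ Gₕ) ⨾ₕ Δ°ₕ) _ 1, comp_assoc, geq_copy_sumZero, geq_geq_coCopy,
    comp_tensor_id (Iₕ 2 ⊕ₕ ε°ₕ), state_tensor_wire, comp_tensor_id _ (𝟙ₕ ⊕ₕ π₂ₕ),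
    cond₂_tensor_wire, comp_assoc, comp_assoc, comp_assoc, comp_assoc, nonneg_slide]
  simp only [comp_assoc]

/-- The Riesz interpolation property: there is `z` with `0, -b ≤ z ≤ a, a'` if and only if
`0 ≤ a, a', a + b, a' + b`. -/
theorem interpolation : ∃ (N : IHP k 3 4) (F : (ℕ → k) → ℕ → k) (N' : IHP k 4 4)
    (F' : (ℕ → k) → ℕ → k), IsLin N F ∧ IsLin N' F' ∧
    (∀ v, F v 0 = v 1 + v 2 ∧ F v 1 = v 0 + v 2 ∧ F v 2 = v 0 ∧ F v 3 = v 1) ∧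
    (∀ v, F' v 0 = v 3 + v 2 ∧ F' v 1 = v 3 ∧ F' v 2 = v 0 - v 3 ∧ F' v 3 = v 1 - v 3) ∧
    N ⨾ₕ π₄ₕ = (Iₕ 3 ⊕ₕ ε°ₕ) ⨾ₕ N' ⨾ₕ π₄ₕ := by
  have h : (Gₕ ⊕ₕ Gₕ) ⨾ₕ Δ°ₕ ⨾ₕ Δₕ ⨾ₕ (Gₕ ⊕ₕ Gₕ) = (Δₕ ⊕ₕ Δₕ) ⨾ₕ (Gₕ ⊕ₕ (Gₕ ⊕ₕ (Gₕ ⊕ₕ Gₕ))) ⨾ₕ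
      (𝟙ₕ ⊕ₕ (σₕ ⊕ₕ 𝟙ₕ)) ⨾ₕ (Δ°ₕ ⊕ₕ Δ°ₕ) := of_ordEq .spider
  have h₁ : (Gₕ ⊕ₕ (Gₕ ⊕ₕ (Gₕ ⊕ₕ Gₕ))) ⨾ₕ (𝟙ₕ ⊕ₕ (σₕ ⊕ₕ 𝟙ₕ))
      = (𝟙ₕ ⊕ₕ (σₕ ⊕ₕ 𝟙ₕ)) ⨾ₕ ((Gₕ ⊕ₕ Gₕ) ⊕ₕ (Gₕ ⊕ₕ Gₕ)) := by
    rw [tensor_assoc₂₂, ← tensor_assoc₁₁ Gₕ Gₕ Gₕ, tensor_comp, tensor_comp, tensor_comp,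
      tensor_comp, sym_natural, comp_id, id_comp]
  -- The spider axiom with its second output forced to zero: a common z below both inputs, above the
  -- output and above 0, exists exactly when both inputs dominate the output and 0.
  have h' : ((Gₕ ⊕ₕ Gₕ) ⨾ₕ Δ°ₕ) ⨾ₕ Δₕ ⨾ₕ (Gₕ ⊕ₕ πₕ)
      = (copy₂ ⨾ₕ (Iₕ 2 ⊕ₕ π₂ₕ)) ⨾ₕ (Gₕ ⊕ₕ Gₕ) ⨾ₕ Δ°ₕ := by
    have h₂ : Gₕ ⊕ₕ πₕ = (Gₕ ⊕ₕ Gₕ) ⨾ₕ (𝟙ₕ ⊕ₕ η°ₕ) := by rw [tensor_comp, comp_id, nonneg]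
    have h₃ : (Δ°ₕ ⊕ₕ Δ°ₕ) ⨾ₕ (𝟙ₕ ⊕ₕ η°ₕ) = (Iₕ 2 ⊕ₕ (η°ₕ ⊕ₕ η°ₕ)) ⨾ₕ Δ°ₕ := by
      rw [tensor_comp, coCopy_coZero, comp_id, tensor_split', tensor_id_zero]
    have h₄ : ((Gₕ ⊕ₕ Gₕ) ⊕ₕ (Gₕ ⊕ₕ Gₕ)) ⨾ₕ (Iₕ 2 ⊕ₕ (η°ₕ ⊕ₕ η°ₕ)) = (Iₕ 2 ⊕ₕ π₂ₕ) ⨾ₕ (Gₕ ⊕ₕ Gₕ) := by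
      rw [tensor_comp, tensor_comp, comp_id, ← nonneg, tensor_split', tensor_id_zero]
    calc _ = ((Gₕ ⊕ₕ Gₕ) ⨾ₕ Δ°ₕ ⨾ₕ Δₕ ⨾ₕ (Gₕ ⊕ₕ Gₕ)) ⨾ₕ (𝟙ₕ ⊕ₕ η°ₕ) := by
          rw [h₂]; simp only [comp_assoc]
      _ = _ := by
        rw [h]
        simp only [comp_assoc]
        rw [h₃, ← comp_assoc (Gₕ ⊕ₕ _), h₁, comp_assoc, ← comp_assoc ((Gₕ ⊕ₕ Gₕ) ⊕ₕ _), h₄,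
          comp_assoc]
  -- Bending the remaining output along x + y = 0 replaces it by −b and leaves only nonnegativity
  -- conditions.
  refine ⟨_, _, _, _, inferInstance, inferInstance, ?_, ?_,
    interpolation_left.symm.trans ((congrArg (fun c => (c ⊕ₕ 𝟙ₕ) ⨾ₕ αₕ) h'.symm).trans
      interpolation_right)⟩
  · simp [tensorFun]
  · simp [tensorFun]

theorem spider_polar : (ρₕ ⊕ₕ ρₕ) ⨾ₕ ∇ₕ ⨾ₕ ∇°ₕ ⨾ₕ (ρₕ ⊕ₕ ρₕ)
    = (∇°ₕ ⊕ₕ ∇°ₕ) ⨾ₕ (ρₕ ⊕ₕ (ρₕ ⊕ₕ (ρₕ ⊕ₕ ρₕ))) ⨾ₕ (𝟙ₕ ⊕ₕ (σₕ ⊕ₕ 𝟙ₕ)) ⨾ₕ (∇ₕ ⊕ₕ ∇ₕ) := by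
  -- For inputs x, y and outputs x + y − t, t, interpolation is applied with a = t, a' = y, b = x −
  -- t. Then a + b = x and a' + b = x + y − t, so its hypotheses are the guards on the left-hand
  -- side. The array has entries x − t + z, t − z in the first row and y − z, z in the second.
  obtain ⟨L, E, hL, hE⟩ := exists_interpolation_inputs (k := k)
  obtain ⟨N, F, N', F', hN, hN', hF, hF', h⟩ := interpolation (k := k)
  simp only [forall_and] at hE hF hF'
  have hP : ((Iₕ 2 ⊕ₕ σₕ) ⨾ₕ (𝟙ₕ ⊕ₕ (σₕ ⊕ₕ 𝟙ₕ)) ⨾ₕ (σₕ ⊕ₕ Iₕ 2) ⨾ₕ (𝟙ₕ ⊕ₕ (σₕ ⊕ₕ 𝟙ₕ))) ⨾ₕ π₄ₕ = π₄ₕ := by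
    have h₀ : (σₕ ⊕ₕ Iₕ 2) ⨾ₕ π₄ₕ = π₄ₕ := by rw [tensor_comp, id_comp, cond_comm]
    simp only [comp_assoc, nonneg_swap₁, nonneg_swap₂, h₀]
  -- The right-hand side binds s = t − z and z, whereas interpolation binds t and z; the two are
  -- related by t = s + z.
  have h₁ : (Iₕ 2 ⊕ₕ ε°ₕ) ⨾ₕ L ⨾ₕ (Iₕ 2 ⊕ₕ (Iₕ 3 ⊕ₕ ε°ₕ))
      = (Iₕ 2 ⊕ₕ (ε°ₕ ⊕ₕ ε°ₕ)) ⨾ₕ (Iₕ 2 ⊕ₕ ((𝟙ₕ ⊕ₕ Δₕ) ⨾ₕ (∇ₕ ⊕ₕ 𝟙ₕ))) ⨾ₕ (L ⊕ₕ 𝟙ₕ) := by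
    rw [← comp_assoc (Iₕ 2 ⊕ₕ (ε°ₕ ⊕ₕ ε°ₕ)), tensor_comp, coDelete_coDelete_add, id_comp,
      ← tensor_assoc₀₁ (Iₕ 2) (Iₕ 3), tensor_id, state_slide, ← comp_assoc, coDelete_coDelete]
  rw [guard_add_coAdd_guard (L := L ⨾ₕ (Iₕ 2 ⊕ₕ (N ⨾ₕ (𝟙ₕ ⊕ₕ (σₕ ⊕ₕ 𝟙ₕ))))),
    coAdd_guard_middle_swap_add (L := (Iₕ 2 ⊕ₕ ((𝟙ₕ ⊕ₕ Δₕ) ⨾ₕ (∇ₕ ⊕ₕ 𝟙ₕ))) ⨾ₕ (L ⊕ₕ 𝟙ₕ) ⨾ₕ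
      (Iₕ 2 ⊕ₕ (N' ⨾ₕ (Iₕ 2 ⊕ₕ σₕ) ⨾ₕ (𝟙ₕ ⊕ₕ (σₕ ⊕ₕ 𝟙ₕ)) ⨾ₕ (σₕ ⊕ₕ Iₕ 2) ⨾ₕ
        (𝟙ₕ ⊕ₕ (σₕ ⊕ₕ 𝟙ₕ))))), comp_assoc L, tensor_comp, comp_assoc N, nonneg_swap₁, id_comp, h]
  · rw [id_tensor_comp, ← comp_assoc L, ← comp_assoc (Iₕ 2 ⊕ₕ ε°ₕ), h₁]
    simp only [comp_assoc]
    rw [tensor_comp, comp_assoc N', hP, id_comp]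
  all_goals intro v; simp [tensorFun, hE, hF, hF']
  all_goals ring

end Ordered

/-! ### The polar operator on classes -/

local notation "Pₕ" => IHP.cls (GeqCirc.polar (GeqCirc.geq (k := k)))
local notation "Qₕ" => IHP.cls (GeqCirc.polar (GeqCirc.leq (k := k)))

open GeqCirc (polar)

theorem coScalar_neg_one : (coScalar (-1) : IHP k 1 1) = sₕ := by
  rw [coScalar_eq (by simp)]; norm_num

/-- Polarity exchanges copying with ∇° and addition with Δ°, so the axioms are permuted up to
orientation. The product of scalars also uses commutativity, and the last two axioms use that −1 is
its own inverse. -/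
theorem polar_ihEq {n m : ℕ} {c d : GeqCirc k n m} (h : GeqCirc.IHEq c d) :
    cls (polar c) = cls (polar d) := by
  cases h with
  | add_assoc => exact of_ihEq .co_copy_assoc
  | add_comm => exact of_ihEq .co_copy_comm
  | add_unit => exact of_ihEq .co_copy_unit
  | co_add_assoc => exact of_ihEq .copy_assoc
  | co_add_comm => exact of_ihEq .copy_comm
  | co_add_unit => exact of_ihEq .copy_unit
  | copy_assoc => exact of_ihEq .co_add_assoc
  | copy_comm => exact of_ihEq .co_add_comm
  | copy_unit => exact of_ihEq .co_add_unit
  | co_copy_assoc => exact of_ihEq .add_assoc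
  | co_copy_comm => exact of_ihEq .add_comm
  | co_copy_unit => exact of_ihEq .add_unit
  | bimonoid => exact of_ihEq .co_bimonoid
  | co_bimonoid => exact of_ihEq .bimonoid
  | bimonoid_unit => exact of_ihEq .co_bimonoid_counit
  | co_bimonoid_unit => exact of_ihEq .bimonoid_counit
  | bimonoid_counit => exact of_ihEq .co_bimonoid_unit
  | co_bimonoid_counit => exact of_ihEq .bimonoid_unit
  | bone => exact of_ihEq .co_bone
  | co_bone => exact of_ihEq .bone
  | scalar_add a => exact of_ihEq (.co_scalar_copy a)
  | co_scalar_add a => exact of_ihEq (.scalar_copy a)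
  | scalar_zero a => exact (of_ihEq (.co_scalar_delete a)).symm
  | co_scalar_zero a => exact (of_ihEq (.scalar_delete a)).symm
  | scalar_copy a => exact of_ihEq (.co_scalar_add a)
  | co_scalar_copy a => exact of_ihEq (.scalar_add a)
  | scalar_delete a => exact (of_ihEq (.co_scalar_zero a)).symm
  | co_scalar_delete a => exact (of_ihEq (.scalar_zero a)).symm
  | scalar_mul a b => rw [mul_comm]; exact of_ihEq (.co_scalar_mul b a)
  | co_scalar_mul a b => rw [mul_comm]; exact of_ihEq (.scalar_mul b a)
  | scalar_sum a b => exact of_ihEq (.co_scalar_sum a b)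
  | co_scalar_sum a b => exact of_ihEq (.scalar_sum a b)
  | zero_scalar => exact of_ihEq .co_zero_scalar
  | co_zero_scalar => exact of_ihEq .zero_scalar
  | scalar_inv a ha => exact (of_ihEq (.scalar_coinv a ha)).symm
  | scalar_coinv a ha => exact (of_ihEq (.scalar_inv a ha)).symm
  | copy_frobenius_left => exact of_ihEq .add_frobenius_left
  | copy_frobenius_right => exact of_ihEq .add_frobenius_right
  | copy_special => exact of_ihEq .add_special
  | copy_bone => exact of_ihEq .add_bone
  | add_frobenius_left => exact of_ihEq .copy_frobenius_left
  | add_frobenius_right => exact of_ihEq .copy_frobenius_right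
  | add_special => exact of_ihEq .copy_special
  | add_bone => exact of_ihEq .copy_bone
  | cap_white =>
    refine (cap_eq_left (k := k)).trans ?_
    rw [← coScalar_neg_one]
    rfl
  | cup_white =>
    have h : ηₕ ⨾ₕ ∇°ₕ = (ε°ₕ ⨾ₕ Δₕ) ⨾ₕ (sₕ ⊕ₕ 𝟙ₕ) := of_ihEq .cup_white
    have h' : ε°ₕ ⨾ₕ Δₕ = (ηₕ ⨾ₕ ∇°ₕ) ⨾ₕ (coScalar (-1) ⊕ₕ 𝟙ₕ) := by
      rw [h, comp_assoc, tensor_comp, coScalar_neg_one, neg_neg, id_comp, tensor_id, comp_id]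
    exact h'

theorem polar_ihIneq {n m : ℕ} {c d : GeqCirc k n m} (h : GeqCirc.IHIneq c d) :
    cls (polar d) ≤ cls (polar c) := by
  cases h with
  | coZero_delete => exact coZero_le_delete
  | co_coZero_delete => exact zero_le_coDelete

theorem cls_polar_geq : cls (polar GeqCirc.geq) = ρₕ := by
  have h : cls (polar GeqCirc.geq) = Δₕ ⨾ₕ (Gₕ ⊕ₕ 𝟙ₕ) ⨾ₕ (η°ₕ ⊕ₕ 𝟙ₕ) := rfl
  rw [h, tensor_comp, id_comp, ← nonneg, guard_left]

/-- Polarity turns the bends of copying type into bends along x + y = 0. Moving the guard through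
one of them negates its condition (`guard_sumZero`), and the bends then straighten out. -/
theorem cls_polar_leq : cls (polar GeqCirc.leq) = λₕ := by
  have h : cls (polar GeqCirc.leq) = ((ηₕ ⨾ₕ ∇°ₕ) ⊕ₕ 𝟙ₕ) ⨾ₕ
      (𝟙ₕ ⊕ₕ (cls (polar GeqCirc.geq) ⊕ₕ 𝟙ₕ)) ⨾ₕ (𝟙ₕ ⊕ₕ αₕ) := rfl
  have h₁ : ((ηₕ ⨾ₕ ∇°ₕ) ⊕ₕ 𝟙ₕ) ⨾ₕ (𝟙ₕ ⊕ₕ αₕ) = 𝟙ₕ := by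
    rw [comp_tensor_id, sumZero, id_tensor_comp, comp_assoc, ← comp_assoc (∇°ₕ ⊕ₕ 𝟙ₕ),
      add_frobenius_left, comp_assoc, ← comp_assoc, zero_add, id_comp, ← coAdd_comm, comp_assoc,
      swap_cond, coAdd_coZero_left]
  have h₂ : Iₕ 0 ⊕ₕ λₕ = λₕ := eq_of_heq (id_zero_tensor _)
  have h₃ := slide (ηₕ ⨾ₕ ∇°ₕ) λₕ
  rw [h₂] at h₃
  rw [h, cls_polar_geq, tensor_comp, guard_sumZero, id_comp, id_tensor_comp, ← tensor_assoc₁₁,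
    tensor_id, ← comp_assoc, h₃, comp_assoc, h₁, comp_id]

section Ordered

variable [IsStrictOrderedRing k]

theorem polar_ordEq {n m : ℕ} {c d : GeqCirc k n m} (h : GeqCirc.OrdEq c d) :
    cls (polar c) = cls (polar d) := by
  cases h with
  | geq_add =>
    show Δ°ₕ ⨾ₕ Pₕ
      = (Pₕ ⊕ₕ Pₕ) ⨾ₕ Δ°ₕ
    rw [cls_polar_geq]
    exact coCopy_guard _ copy_nonneg
  | geq_delete =>
    show Pₕ ⨾ₕ coZero = coZero
    rw [cls_polar_geq, guard_nonneg_coZero]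
  | geq_scalar_pos a ha =>
    show coScalar a ⨾ₕ Pₕ = Pₕ ⨾ₕ coScalar a
    rw [cls_polar_geq, coScalar_eq ha.ne', scalar_guard, scalar_nonneg (inv_pos.2 ha)]
  | geq_scalar_neg a ha =>
    show coScalar a ⨾ₕ Pₕ = Qₕ ⨾ₕ coScalar a
    rw [cls_polar_geq, cls_polar_leq, coScalar_eq ha.ne, scalar_guard,
      scalar_nonneg_of_neg (inv_lt_zero.2 ha)]
  | spider =>
    have h := spider_polar (k := k)
    rw [← cls_polar_geq] at h
    exact h
  | direction =>
    show Qₕ ⨾ₕ Pₕ = coZero ⨾ₕ zero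
    rw [cls_polar_geq, cls_polar_leq, guard_neg_guard]

theorem polar_ordIneq {n m : ℕ} {c d : GeqCirc k n m} (h : GeqCirc.OrdIneq c d) :
    cls (polar d) ≤ cls (polar c) := by
  cases h with
  | geq_copy =>
    show ∇°ₕ ⨾ₕ (Pₕ ⊕ₕ Pₕ)
      ≤ Pₕ ⨾ₕ ∇°ₕ
    rw [cls_polar_geq]
    exact guard_coAdd_le
  | geq_zero =>
    show Pₕ ⨾ₕ delete ≤ delete
    rw [cls_polar_geq, guard_delete]
    exact nonneg_le_delete
  | antisymm =>
    show 𝟙ₕ ≤ ∇°ₕ ⨾ₕ (Pₕ ⊕ₕ Qₕ) ⨾ₕ ∇ₕ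
    rw [cls_polar_geq, cls_polar_leq]
    exact id_le_coAdd_guard

theorem polar_le {n m : ℕ} {c d : GeqCirc k n m} (h : GeqCirc.IHPSub c d) :
    cls (polar d) ≤ cls (polar c) := by
  unfold GeqCirc.IHPSub at h
  induction h with
  | ax h =>
    cases h with
    | ihEq h => exact (polar_ihEq h).ge
    | ihEq_symm h => exact (polar_ihEq h).le
    | ihIneq h => exact polar_ihIneq h
    | ordEq h => exact (polar_ordEq h).ge
    | ordEq_symm h => exact (polar_ordEq h).le
    | ordIneq h => exact polar_ordIneq h
  | refl c => exact le_rfl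
  | trans _ _ ih ih' => exact ih'.trans ih
  | comp _ _ ih ih' =>
    simp only [GeqCirc.polar_comp, cls_comp]
    exact comp_mono ih ih'
  | tensor _ _ ih ih' =>
    simp only [GeqCirc.polar_tensor, cls_tensor]
    exact tensor_mono ih ih'

theorem polar_polar {n m : ℕ} (c : GeqCirc k n m) : cls (polar (polar c)) = cls c := by
  obtain ⟨t, rfl⟩ := FreeProp.exists_mk c
  induction t with
  | gen g =>
    cases g with
    | fwd g => cases g <;> rfl
    | bwd g => cases g <;> rfl
    | geq =>
      -- The only generator not returned verbatim: splitting off a nonnegative part and discarding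
      -- it is ≥.
      show ∇°ₕ ⨾ₕ (cls (polar GeqCirc.geq) ⊕ₕ 𝟙ₕ) ⨾ₕ (εₕ ⊕ₕ 𝟙ₕ) = Gₕ
      rw [cls_polar_geq, coAdd_guard_bend]
  | id n => rfl
  | sym n m => rfl
  | comp s t ihs iht =>
    calc _ = cls (polar (polar (FreeProp.mk s) ⨾ polar (FreeProp.mk t))) := rfl
      _ = cls (FreeProp.mk s) ⨾ₕ cls (FreeProp.mk t) := by
        rw [GeqCirc.polar_comp, cls_comp, ihs, iht]
      _ = _ := rfl
  | tensor s t ihs iht =>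
    calc _ = cls (polar (polar (FreeProp.mk s) ⊕ₚ polar (FreeProp.mk t))) := rfl
      _ = cls (FreeProp.mk s) ⊕ₕ cls (FreeProp.mk t) := by
        rw [GeqCirc.polar_tensor, cls_tensor, ihs, iht]
      _ = _ := rfl

end Ordered

end IHP

/-! ### The proposition -/

theorem mainTheorem11 {k : Type*} [Field k] [LinearOrder k] [IsStrictOrderedRing k] {n m : ℕ} :
    (∀ c d : GeqCirc k n m, GeqCirc.IHPSub c d →
      GeqCirc.IHPSub (GeqCirc.polar d) (GeqCirc.polar c)) ∧
    (∀ c : GeqCirc k n m, GeqCirc.IHPEq (GeqCirc.polar (GeqCirc.polar c)) c) ∧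
    (∀ c : GeqCirc k n m, (∃ a : FwdCirc k n m, a.incl = c) →
      ∃ b : BwdCirc k n m, b.incl = GeqCirc.polar c) := by
  refine ⟨fun c d h => IHP.polar_le h, fun c => IHP.cls_eq.1 (IHP.polar_polar c), ?_⟩
  rintro _ ⟨a, rfl⟩
  exact GeqCirc.exists_incl_eq_polar a
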